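/- Let $A$ and $B$ be simplicial sets and let $X$ be an $(A,B)$-cylinder, i.e. a simplicial set $X$ with a map $X\to\Delta[1]$ whose fibres over the vertices $0$ and $1$ are (identified with) $A$ and $B$ respectively. Let $p\colon X\to A\star B$ be the canonical morphism to the join, i.e. the unique map over $\Delta[1]$ that is compatible with the identifications of the fibres. For an object $(M,\mu\colon M\to A)$ of $\mathbf{sSet}/A$, let $M\backslash X\in\mathbf{sSet}/B$ be the object whose $n$-simplices over an $n$-simplex $\beta$ of $B$ are the maps $\sigma\colon M\star\Delta[n]\to X$ with $p\sigma=\mu\star\beta$. For an object $(T,\tau\colon T\to B)$ of $\mathbf{sSet}/B$, let $X/T\in\mathbf{sSet}/A$ be the object whose $m$-simplices over an $m$-simplex $\alpha$ of $A$ are the maps $\sigma\colon\Delta[m]\star T\to X$ with $p\sigma=\alpha\star\tau$. These are contravariantly functorial in $M$ and $T$ respectively, by precomposition. A left (resp. right) fibration is a map with the right lifting property with respect to the horn inclusions $\Lambda^k[n]\to\Delta[n]$ with $n\ge1$ and $0\le k<n$ (resp. $0<k\le n$); an inner fibration is a map with the right lifting property with respect to those with $n\geq 2$ and $0<k<n$.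 A morphism $w\colon Y\to Y'$ of $\mathbf{sSet}/B$ is a covariant equivalence if $\pi_0\mathbf{Fun}_B(Y',L)\to\pi_0\mathbf{Fun}_B(Y,L)$ is a bijection for every left fibration $L\to B$, where $\mathbf{Fun}_B(Y,L)$ is the simplicial set whose $n$-simplices are the maps $\Delta[n]\times Y\to L$ over $B$. The cylinder $X$ is called - vertically Reedy left fibrant if $(\Delta[m],\alpha)\backslash X\to(\partial\Delta[m],\alpha|_{\partial\Delta[m]})\backslash X$ is a left fibration for every $m\ge0$ and every $m$-simplex $\alpha$ of $A$; - horizontally Reedy right fibrant if $X/(\Delta[n],\beta)\to X/(\partial\Delta[n],\beta|_{\partial\Delta[n]})$ is a right fibration for every $n\ge0$ and every $n$-simplex $\beta$ of $B$; - vertically right local if, for every $m\ge1$ and every $m$-simplex $\alpha$ of $A$ with final vertex $\alpha_m$, the map $(\Delta[m],\alpha)\backslash X\to(\Delta[0],\alpha_m)\backslash X$ induced by the inclusion of the final vertex of $\Delta[m]$ is a covariant equivalence in $\mathbf{sSet}/B$. Then the following are equivalent: 1. the canonical morphism $X\to A\star B$ is an inner fibration; 2. $X$ is vertically Reedy left fibrant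 and horizontally Reedy right fibrant; 3. $X$ is vertically Reedy left fibrant and vertically right local. -/

import Mathlib

open CategoryTheory Simplicial Opposite MonoidalCategory CartesianMonoidalCategory

universe u

noncomputable section

namespace SSetCyl

/-! ### Fibres over the vertices of the interval -/

/-- The fibre `p⁻¹(ε)` of a simplicial set `p : X ⟶ Δ[1]` over the vertex `ε`,
as a subcomplex of `X`. -/
def fib {X : SSet.{u}} (ε : Fin 2) (p : X ⟶ Δ[1]) : X.Subcomplex :=
  (SSet.stdSimplex.face {ε}).preimage p

/-- The map induced on fibres by a map `f : Y ⟶ X` over `Δ[1]`. -/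
def fibMap {X Y : SSet.{u}} (ε : Fin 2) (f : Y ⟶ X) (p : X ⟶ Δ[1]) :
    (fib ε (f ≫ p) : SSet.{u}) ⟶ (fib ε p : SSet.{u}) :=
  (fib ε p).fromPreimage f

lemma stdMap_id (n : SimplexCategory) :
    SSet.stdSimplex.{u}.map (𝟙 n) = 𝟙 (SSet.stdSimplex.obj n) :=
  CategoryTheory.Functor.map_id _ _

lemma stdMap_comp {l m n : SimplexCategory} (f : l ⟶ m) (g : m ⟶ n) :
    SSet.stdSimplex.{u}.map (f ≫ g) = SSet.stdSimplex.map f ≫ SSet.stdSimplex.map g :=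
  CategoryTheory.Functor.map_comp _ _ _

/-! ### The join of simplicial sets -/

/-- An `n`-simplex of the join `A ⋆ B`. A map `χ : Δ[n] ⟶ Δ[1]` is the same as a decomposition of
the ordinal `[n]` into an initial segment `I` (possibly empty) and the complementary final segment
`J` (possibly empty), and the fibres of `χ` over `0` and `1` are the faces of `Δ[n]` spanned by
`I` and `J`. So a simplex of `A ⋆ B` consists of such a decomposition, a simplex of `A`
indexed by `I` (no datum if `I` is empty) and a simplex of `B` indexed by `J`
(no datum if `J` is empty). -/
structure JoinSimplex (A B : SSet.{u}) (n : SimplexCategory) : Type u where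
  /-- the decomposition of `[n]` -/
  χ : SSet.stdSimplex.{u}.obj n ⟶ Δ[1]
  /-- the simplex of `A` -/
  left : (fib 0 χ : SSet.{u}) ⟶ A
  /-- the simplex of `B` -/
  right : (fib 1 χ : SSet.{u}) ⟶ B

lemma JoinSimplex.ext' {A B : SSet.{u}} {n : SimplexCategory} {s t : JoinSimplex A B n}
    (h : s.χ = t.χ)
    (hl : ∀ (k : SimplexCategoryᵒᵖ) (x : (SSet.stdSimplex.{u}.obj n).obj k)
      (hs : x ∈ (fib 0 s.χ).obj k) (ht : x ∈ (fib 0 t.χ).obj k),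
      s.left.app k ⟨x, hs⟩ = t.left.app k ⟨x, ht⟩)
    (hr : ∀ (k : SimplexCategoryᵒᵖ) (x : (SSet.stdSimplex.{u}.obj n).obj k)
      (hs : x ∈ (fib 1 s.χ).obj k) (ht : x ∈ (fib 1 t.χ).obj k),
      s.right.app k ⟨x, hs⟩ = t.right.app k ⟨x, ht⟩) : s = t := by
  obtain ⟨χ, l, r⟩ := s
  obtain ⟨χ', l', r'⟩ := t
  obtain rfl : χ = χ' := h
  obtain rfl : l = l' := by
    ext k x
    exact hl k x.1 x.2 x.2
  obtain rfl : r = r' := by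
    ext k x
    exact hr k x.1 x.2 x.2
  rfl

/-- The join `A ⋆ B` of two simplicial sets. -/
def join (A B : SSet.{u}) : SSet.{u} where
  obj n := JoinSimplex A B n.unop
  map f := ↾fun s ↦
    { χ := SSet.stdSimplex.map f.unop ≫ s.χ
      left := fibMap 0 (SSet.stdSimplex.map f.unop) s.χ ≫ s.left
      right := fibMap 1 (SSet.stdSimplex.map f.unop) s.χ ≫ s.right }
  map_id n := by
    ext s : 3
    refine JoinSimplex.ext' ?_ ?_ ?_
    · change SSet.stdSimplex.map (𝟙 n.unop) ≫ s.χ = s.χ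
      rw [stdMap_id, Category.id_comp]
    · intro k x hs ht
      refine congrArg (s.left.app k) (Subtype.ext ?_)
      exact congrArg (fun φ ↦ φ.app k x) (stdMap_id n.unop)
    · intro k x hs ht
      refine congrArg (s.right.app k) (Subtype.ext ?_)
      exact congrArg (fun φ ↦ φ.app k x) (stdMap_id n.unop)
  map_comp f g := by
    ext s : 3
    refine JoinSimplex.ext' ?_ ?_ ?_
    · change SSet.stdSimplex.map (g.unop ≫ f.unop) ≫ s.χ =
        SSet.stdSimplex.map g.unop ≫ SSet.stdSimplex.map f.unop ≫ s.χ
      rw [stdMap_comp, Category.assoc]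
    · intros
      rfl
    · intros
      rfl

/-- The join `u ⋆ v : A ⋆ B ⟶ A' ⋆ B'` of two maps of simplicial sets. -/
def joinMap {A A' B B' : SSet.{u}} (u : A ⟶ A') (v : B ⟶ B') : join A B ⟶ join A' B' where
  app _ := ↾fun s ↦
    { χ := s.χ
      left := s.left ≫ u
      right := s.right ≫ v }
  naturality _ _ _ := rfl

lemma joinMap_id (A B : SSet.{u}) : joinMap (𝟙 A) (𝟙 B) = 𝟙 (join A B) := rfl

lemma joinMap_comp {A A' A'' B B' B'' : SSet.{u}} (u : A ⟶ A') (u' : A' ⟶ A'') (v : B ⟶ B')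
    (v' : B' ⟶ B'') : joinMap (u ≫ u') (v ≫ v') = joinMap u v ≫ joinMap u' v' := rfl

/-! ### Cylinders -/

/-- An `(A, B)`-cylinder: a simplicial set `X` with a map `p : X ⟶ Δ[1]` whose fibres over
the vertices `0` and `1` are `A` and `B`. -/
structure Cyl (A B : SSet.{u}) where
  /-- the underlying simplicial set -/
  X : SSet.{u}
  /-- the map to the interval -/
  p : X ⟶ Δ[1]
  /-- the identification of the fibre over `0` with `A` -/
  iso₀ : (fib 0 p : SSet.{u}) ≅ A
  /-- the identification of the fibre over `1` with `B` -/
  iso₁ : (fib 1 p : SSet.{u}) ≅ B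

variable {A B : SSet.{u}}

/-- The canonical morphism `X ⟶ A ⋆ B` of an `(A, B)`-cylinder `X`, that is,
the unique map over `Δ[1]` that is compatible with the identifications of the fibres. -/
def Cyl.toJoin (X : Cyl A B) : X.X ⟶ join A B where
  app _ := ↾fun x ↦
    { χ := SSet.yonedaEquiv.symm x ≫ X.p
      left := fibMap 0 (SSet.yonedaEquiv.symm x) X.p ≫ X.iso₀.hom
      right := fibMap 1 (SSet.yonedaEquiv.symm x) X.p ≫ X.iso₁.hom }
  naturality m n f := by
    ext x : 3
    refine JoinSimplex.ext' ?_ ?_ ?_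
    · change _ = SSet.stdSimplex.map f.unop ≫ SSet.yonedaEquiv.symm x ≫ X.p
      rw [SSet.yonedaEquiv_symm_naturality_left_assoc]
      rfl
    · intro k y hs ht
      refine congrArg (X.iso₀.hom.app k) (Subtype.ext ?_)
      exact congrArg (fun φ ↦ φ.app k y) (SSet.yonedaEquiv_symm_naturality_left f.unop x).symm
    · intro k y hs ht
      refine congrArg (X.iso₁.hom.app k) (Subtype.ext ?_)
      exact congrArg (fun φ ↦ φ.app k y) (SSet.yonedaEquiv_symm_naturality_left f.unop x).symm

/-! ### Left and right division -/

/-- The underlying simplicial set of the left division `M \ X`, for an object `M` of `sSet/A` and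
an `(A, B)`-cylinder `X`. As `M \ -` is right adjoint to `M ⊠ - = L (M ⋆ -)`, where `L` is the
reflection of `sSet/(A ⋆ B)` onto the `(A, B)`-cylinders, an `n`-simplex of `M \ X` over
the `n`-simplex `β` of `B` is a map `M ⋆ Δ[n] ⟶ X` over `A ⋆ B`, where the
structure map of `M ⋆ Δ[n]` is the join of that of `M` and `β`. -/
def leftDivObj (M : Over A) (X : Cyl A B) : SSet.{u} where
  obj n := { s : B.obj n × (join M.left (SSet.stdSimplex.obj n.unop) ⟶ X.X) //
    s.2 ≫ X.toJoin = joinMap M.hom (SSet.yonedaEquiv.symm s.1) }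
  map f := ↾fun s ↦ ⟨(B.map f s.1.1, joinMap (𝟙 _) (SSet.stdSimplex.map f.unop) ≫ s.1.2), by
    rw [Category.assoc, s.2, ← joinMap_comp, Category.id_comp,
      SSet.yonedaEquiv_symm_naturality_left]
    rfl⟩
  map_id n := by
    ext s : 3
    refine Subtype.ext (Prod.ext ?_ ?_)
    · simp
    · change joinMap (𝟙 _) (SSet.stdSimplex.map (𝟙 _)) ≫ s.1.2 = s.1.2
      rw [stdMap_id, joinMap_id, Category.id_comp]
  map_comp f g := by
    ext s : 3
    refine Subtype.ext (Prod.ext ?_ ?_)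
    · simp
    · change joinMap (𝟙 _) (SSet.stdSimplex.map (g.unop ≫ f.unop)) ≫ s.1.2 =
        joinMap (𝟙 _) (SSet.stdSimplex.map g.unop) ≫
          joinMap (𝟙 _) (SSet.stdSimplex.map f.unop) ≫ s.1.2
      rw [← Category.assoc, ← joinMap_comp, Category.id_comp, stdMap_comp]

/-- The left division `M \ X`, as an object of `sSet/B`. -/
def leftDiv (M : Over A) (X : Cyl A B) : Over B :=
  Over.mk (Y := leftDivObj M X) { app _ := ↾fun s ↦ s.1.1 }

/-- The morphism `f \ X : N \ X ⟶ M \ X` of `sSet/B` induced by a morphism `f : M ⟶ N`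
of `sSet/A`. -/
def leftDivMap {M N : Over A} (f : M ⟶ N) (X : Cyl A B) : leftDiv N X ⟶ leftDiv M X :=
  Over.homMk (U := leftDiv N X) (V := leftDiv M X)
    { app _ := ↾fun s ↦ ⟨(s.1.1, joinMap f.left (𝟙 _) ≫ s.1.2), by
        rw [Category.assoc, s.2, ← joinMap_comp, Category.id_comp, Over.w]⟩ }

/-- The underlying simplicial set of the right division `X / T`, for an object `T` of `sSet/B` and
an `(A, B)`-cylinder `X`: an `m`-simplex of `X / T` over the `m`-simplex `α` of `A` is a map
`Δ[m] ⋆ T ⟶ X` over `A ⋆ B`. -/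
def rightDivObj (X : Cyl A B) (T : Over B) : SSet.{u} where
  obj m := { s : A.obj m × (join (SSet.stdSimplex.obj m.unop) T.left ⟶ X.X) //
    s.2 ≫ X.toJoin = joinMap (SSet.yonedaEquiv.symm s.1) T.hom }
  map f := ↾fun s ↦ ⟨(A.map f s.1.1, joinMap (SSet.stdSimplex.map f.unop) (𝟙 _) ≫ s.1.2), by
    rw [Category.assoc, s.2, ← joinMap_comp, Category.id_comp,
      SSet.yonedaEquiv_symm_naturality_left]
    rfl⟩
  map_id n := by
    ext s : 3
    refine Subtype.ext (Prod.ext ?_ ?_)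
    · simp
    · change joinMap (SSet.stdSimplex.map (𝟙 _)) (𝟙 _) ≫ s.1.2 = s.1.2
      rw [stdMap_id, joinMap_id, Category.id_comp]
  map_comp f g := by
    ext s : 3
    refine Subtype.ext (Prod.ext ?_ ?_)
    · simp
    · change joinMap (SSet.stdSimplex.map (g.unop ≫ f.unop)) (𝟙 _) ≫ s.1.2 =
        joinMap (SSet.stdSimplex.map g.unop) (𝟙 _) ≫
          joinMap (SSet.stdSimplex.map f.unop) (𝟙 _) ≫ s.1.2
      rw [← Category.assoc, ← joinMap_comp, Category.id_comp, stdMap_comp]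

/-- The right division `X / T`, as an object of `sSet/A`. -/
def rightDiv (X : Cyl A B) (T : Over B) : Over A :=
  Over.mk (Y := rightDivObj X T) { app _ := ↾fun s ↦ s.1.1 }

/-- The morphism `X / g : X / T ⟶ X / S` of `sSet/A` induced by a morphism `g : S ⟶ T`
of `sSet/B`. -/
def rightDivMap (X : Cyl A B) {S T : Over B} (g : S ⟶ T) : rightDiv X T ⟶ rightDiv X S :=
  Over.homMk (U := rightDiv X T) (V := rightDiv X S)
    { app _ := ↾fun s ↦ ⟨(s.1.1, joinMap (𝟙 _) g.left ≫ s.1.2), by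
        rw [Category.assoc, s.2, ← joinMap_comp, Category.id_comp, Over.w]⟩ }

/-! ### Left and right fibrations -/

/-- The horn inclusions `Λ[n, k] ⟶ Δ[n]` with `n ≥ 1` and `0 ≤ k < n`. -/
inductive leftHornInclusions : MorphismProperty SSet.{u} where
  | intro {n : ℕ} (k : Fin (n + 2)) (hk : k < Fin.last (n + 1)) :
    leftHornInclusions Λ[n + 1, k].ι

/-- The horn inclusions `Λ[n, k] ⟶ Δ[n]` with `n ≥ 1` and `0 < k ≤ n`. -/
inductive rightHornInclusions : MorphismProperty SSet.{u} where
  | intro {n : ℕ} (k : Fin (n + 2)) (hk : 0 < k) :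
    rightHornInclusions Λ[n + 1, k].ι

/-- Left fibrations of simplicial sets. -/
def leftFibrations : MorphismProperty SSet.{u} := leftHornInclusions.rlp

/-- Right fibrations of simplicial sets. -/
def rightFibrations : MorphismProperty SSet.{u} := rightHornInclusions.rlp

/-! ### Covariant equivalences -/

/-- The simplicial hom `Fun_B(Y, L)` of two objects of `sSet/B`: its `n`-simplices are the
maps `Δ[n] × Y ⟶ L` over `B`. -/
def funOver (Y L : Over B) : SSet.{u} where
  obj n := { h : SSet.stdSimplex.obj n.unop ⊗ Y.left ⟶ L.left // h ≫ L.hom = snd _ _ ≫ Y.hom }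
  map f := ↾fun h ↦ ⟨SSet.stdSimplex.map f.unop ▷ Y.left ≫ h.1, by
    rw [Category.assoc, h.2, whiskerRight_snd_assoc]⟩
  map_id n := by
    ext h : 3
    refine Subtype.ext ?_
    change SSet.stdSimplex.map (𝟙 n.unop) ▷ Y.left ≫ h.1 = h.1
    rw [stdMap_id, id_whiskerRight, Category.id_comp]
  map_comp f g := by
    ext h : 3
    refine Subtype.ext ?_
    change SSet.stdSimplex.map (g.unop ≫ f.unop) ▷ Y.left ≫ h.1 =
      SSet.stdSimplex.map g.unop ▷ Y.left ≫ SSet.stdSimplex.map f.unop ▷ Y.left ≫ h.1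
    rw [stdMap_comp, comp_whiskerRight, Category.assoc]

/-- The map `Fun_B(Y', L) ⟶ Fun_B(Y, L)` induced by a morphism `w : Y ⟶ Y'` of `sSet/B`. -/
def funOverMap {Y Y' : Over B} (w : Y ⟶ Y') (L : Over B) : funOver Y' L ⟶ funOver Y L where
  app n := ↾fun h ↦ ⟨SSet.stdSimplex.obj n.unop ◁ w.left ≫ h.1, by
    rw [Category.assoc, h.2, whiskerLeft_snd_assoc, Over.w]⟩
  naturality m n f := by
    ext h : 3
    refine Subtype.ext ?_
    change _ ◁ w.left ≫ SSet.stdSimplex.map f.unop ▷ _ ≫ h.1 =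
      SSet.stdSimplex.map f.unop ▷ _ ≫ _ ◁ w.left ≫ h.1
    rw [whisker_exchange_assoc]

/-- A morphism `w : Y ⟶ Y'` of `sSet/B` is a covariant equivalence if it induces a bijection
`π₀ Fun_B(Y', L) → π₀ Fun_B(Y, L)` for every left fibration `L ⟶ B`. -/
def IsCovariantEquivalence {Y Y' : Over B} (w : Y ⟶ Y') : Prop :=
  ∀ L : Over B, leftFibrations L.hom → Function.Bijective (SSet.mapπ₀ (funOverMap w L))

/-! ### The conditions on cylinders -/

/-- The `m`-simplex `α` of `C`, as the object `(Δ[m], α)` of `sSet/C`. -/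
abbrev simplexOver {C : SSet.{u}} {m : ℕ} (α : Δ[m] ⟶ C) : Over C := Over.mk α

/-- For a map `i : K ⟶ Δ[m]`, the morphism `(K, α i) ⟶ (Δ[m], α)` of `sSet/C`. -/
abbrev simplexOverMap {C K : SSet.{u}} {m : ℕ} (i : K ⟶ Δ[m]) (α : Δ[m] ⟶ C) :
    Over.mk (i ≫ α) ⟶ simplexOver α := Over.homMk i

/-- The cylinder `X` is vertically Reedy left fibrant: the map
`(Δ[m], α) \ X ⟶ (∂Δ[m], ∂α) \ X` is a left fibration for every simplex `α` of `A`. -/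
def Cyl.VerticallyReedyLeftFibrant (X : Cyl A B) : Prop :=
  ∀ (m : ℕ) (α : Δ[m] ⟶ A), leftFibrations (leftDivMap (simplexOverMap ∂Δ[m].ι α) X).left

/-- The cylinder `X` is horizontally Reedy right fibrant: the map
`X / (Δ[n], β) ⟶ X / (∂Δ[n], ∂β)` is a right fibration for every simplex `β` of `B`. -/
def Cyl.HorizontallyReedyRightFibrant (X : Cyl A B) : Prop :=
  ∀ (n : ℕ) (β : Δ[n] ⟶ B), rightFibrations (rightDivMap X (simplexOverMap ∂Δ[n].ι β)).left

/-- The inclusion `Δ[0] ⟶ Δ[m]` of the final vertex. -/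
def finalVertex (m : ℕ) : (Δ[0] : SSet.{u}) ⟶ Δ[m] :=
  SSet.stdSimplex.map (SimplexCategory.const ⦋0⦌ ⦋m⦌ (Fin.last m))

/-- The cylinder `X` is vertically right local: the map `(Δ[m], α) \ X ⟶ (Δ[0], α_m) \ X`
induced by the inclusion of the final vertex is a covariant equivalence in `sSet/B`
for every simplex `α` of `A` of dimension `m ≥ 1`. -/
def Cyl.VerticallyRightLocal (X : Cyl A B) : Prop :=
  ∀ (m : ℕ) (_ : 1 ≤ m) (α : Δ[m] ⟶ A),
    IsCovariantEquivalence (leftDivMap (simplexOverMap (finalVertex m) α) X)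

end SSetCyl

end

/-!
# Inner fibrations over a join and Reedy fibrant cylinders

Let `X` be an `(A, B)`-cylinder. By construction, maps `T ⟶ M \ X` over `B` and maps `M ⟶ X / T`
over `A` are the same as maps `M ⋆ T ⟶ X` over `A ⋆ B`. The definitions only say so for `T` or `M` a
standard simplex; the general case (`exists_toLeftDiv_eq`, `exists_toRightDiv_eq`) holds because
each simplex of `M ⋆ T` either lies in `M`, where `X ⟶ A ⋆ B` is bijective, or is the image of a
simplex of `M ⋆ Δ[n]` under `M ⋆ t` for a simplex `t` of `T`. Hence, for `i : K ⟶ M` and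
`j : S ⟶ T`, lifting `j` against the maps `M \ X ⟶ K \ X`, lifting `i` against the maps
`X / T ⟶ X / S`, and lifting the pushout-join `M ⋆ S ∪ K ⋆ T ⟶ M ⋆ T` against `X ⟶ A ⋆ B` are the
same condition
`X.JoinLift i j` (`Cyl.joinLift_iff_leftDiv`, `Cyl.joinLift_iff_rightDiv`).

*Inner fibrations and Reedy fibrancy.* A map `χ : Δ[N] ⟶ Δ[1]` presents `Δ[N]` as the join of its
fibres (`stdJoinIso`). If both fibres are nonempty, the horn of `Δ[N]` at a vertex `k` is the
pushout-join of the horn at `k` of the fibre containing `k` and of the boundary of the other fibre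
(`Cyl.joinLift_horn_boundary_iff`, `Cyl.joinLift_boundary_horn_iff`). It is an inner horn exactly
when the horn of the fibre is a right horn, for the fibre over `0`, or a left horn, for the fibre
over `1`. So the inner horn lifting problems over simplices of `A ⋆ B` not contained in `A` or `B`
are those of the two Reedy conditions, and the other lifting problems have a unique solution.

*Right fibrancy and locality.* Assume that `X` is vertically Reedy left fibrant. Then
`M \ X ⟶ K \ X` is a left fibration for every monomorphism `K ⟶ M`, and so is `M \ X ⟶ B`. Let
`X.leftTrivial` be the class of the maps `i : K ⟶ M` such that `M \ X ⟶ K \ X` is always a trivial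
fibration. It is a class of maps with a left lifting property, so it is stable under pushouts and
composition, and horizontal right fibrancy says that it contains the right horn inclusions. A left
fibration between left fibrations over `B` is a trivial fibration if and only if it is a covariant
equivalence (`isCovariantEquivalence_of_rlp`, `IsCovariantEquivalence.rlp`). Therefore locality
says that `X.leftTrivial` contains the inclusions of the final vertices, and among monomorphisms the
class has the right cancellation property. The two conditions then agree because the right horn
inclusions and the inclusions of the final vertices generate each other under these operations
(`finalVertex_mem_of_rightHornInclusions_le`, `rightHornInclusions_le_of_finalVertex_mem`), by an
induction over the unions of facets `facets V S` of the faces of a standard simplex.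
-/

noncomputable section

namespace SSetCyl

/-! ### Covariant homotopy lifting for left fibrations -/

lemma isUniquelyCodimOneFace_index_congr {X : SSet.{u}} {x y y' : X.S}
    (h : x.IsUniquelyCodimOneFace y) (h' : x.IsUniquelyCodimOneFace y') (hy : y = y')
    {d : ℕ} (hd : x.dim = d) : h.index hd = h'.index hd := by
  subst hy
  rfl

lemma pairingCore_pairing_index_ne_last {X : SSet.{u}} {A : X.Subcomplex} (h : A.PairingCore)
    [h.IsProper] (hl : ∀ s, h.index s ≠ Fin.last _) (x : h.pairing.II) :
    (h.pairing.isUniquelyCodimOneFace x).index rfl ≠ Fin.last _ := by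
  obtain ⟨s, rfl⟩ := h.equivII.surjective x
  intro hs
  refine hl s ?_
  rw [← h.isUniquelyCodimOneFace_index s]
  exact (isUniquelyCodimOneFace_index_congr (h.isUniquelyCodimOneFace s)
    (h.pairing.isUniquelyCodimOneFace (h.equivII s))
    (congrArg (fun y ↦ y.val.toS) (h.pairing_p_equivII s)).symm rfl).trans hs

/-- The inclusion `{0} × Δ[n] ∪ Δ[1] × ∂Δ[n] ⟶ Δ[1] × Δ[n]` is left anodyne: the cells of Moss's
regular pairing for it are attached along horns `Λ[d, i]` with `i < d`. -/
lemma leftFibrations_llp_unionProd_boundary (n : ℕ) :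
    (leftFibrations.{u}).llp
      (SSet.Subcomplex.unionProd.{u} Λ[1, 0] ∂Δ[n]).ι := by
  let P := (SSet.prodStdSimplex.pairingCore.{u} (0 : Fin 1) n).pairing
  exact MorphismProperty.transfiniteCompositionsOfShape_le _ _ _
    ⟨P.rankFunction.relativeCellComplex.toTransfiniteCompositionOfShape, fun j hj ↦ by
      refine (?_ : (_ : MorphismProperty _) ≤ _ ) _
        (P.rankFunction.relativeCellComplex.attachCells j hj).pushouts_coproducts
      simp only [MorphismProperty.pushouts_le_iff, MorphismProperty.coproducts_le_iff]
      rintro _ _ _ ⟨c⟩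
      refine MorphismProperty.le_llp_rlp _ _ (leftHornInclusions.intro _ ?_)
      rw [Fin.lt_last_iff_ne_last]
      exact pairingCore_pairing_index_ne_last _
        (fun (s : SSet.prodStdSimplex.pairingCore.Type₁.{u} (0 : Fin 1) n) ↦
          (Fin.castSucc_lt_last s.index).ne) c.s⟩

open MonoidalClosed in
/-- Left fibrations have the covariant homotopy lifting property relative to a subcomplex. -/
lemma leftFibrations.hasLiftingProperty_unionProd {E B : SSet.{u}} {p : E ⟶ B}
    (hp : leftFibrations p) {Y : SSet.{u}} (K : Y.Subcomplex) :
    HasLiftingProperty (SSet.Subcomplex.unionProd.{u} Λ[1, 0] K).ι p := by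
  let sq₁₃ := Functor.PullbackObjObj.ofHasPullback MonoidalClosed.internalHom Λ[1, 0].ι p
  refine (internalHomAdjunction₂.hasLiftingProperty_iff
    ((SSet.Subcomplex.unionProd.pushoutObjObj Λ[1, 0] K)) sq₁₃).2 ?_
  suffices (MorphismProperty.monomorphisms _).rlp sq₁₃.π from this _ inferInstance
  rw [SSet.rlp_monomorphisms]
  rintro _ _ _ ⟨n⟩
  rw [← internalHomAdjunction₂.hasLiftingProperty_iff
    (SSet.Subcomplex.unionProd.pushoutObjObj.{u} _ _),
    SSet.Subcomplex.unionProd.pushoutObjObj_ι]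
  exact leftFibrations_llp_unionProd_boundary n _ hp

/-- The inclusion of `Y` in `Δ[1] × Y` at the vertex `ε`. -/
def prodIncl (ε : Fin 2) (Y : SSet.{u}) : Y ⟶ Δ[1] ⊗ Y :=
  CartesianMonoidalCategory.lift (SSet.const (SSet.stdSimplex.obj₀Equiv.symm ε)) (𝟙 Y)

@[simp]
lemma prodIncl_snd (ε : Fin 2) (Y : SSet.{u}) : prodIncl ε Y ≫ snd _ _ = 𝟙 Y := rfl

@[simp]
lemma prodIncl_snd_assoc (ε : Fin 2) (Y : SSet.{u}) {Z : SSet.{u}} (g : Y ⟶ Z) :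
    prodIncl ε Y ≫ snd _ _ ≫ g = g := rfl

lemma prodIncl_whiskerLeft_assoc (ε : Fin 2) {Y Y' Z : SSet.{u}} (f : Y ⟶ Y')
    (g : Δ[1] ⊗ Y' ⟶ Z) : prodIncl ε Y ≫ Δ[1] ◁ f ≫ g = f ≫ prodIncl ε Y' ≫ g := rfl

/-- The horn `Λ[1, 0]` is the vertex `0`. -/
lemma mem_horn_one_zero {k : SimplexCategoryᵒᵖ} (x : (Δ[1] : SSet.{u}).obj k)
    (hx : x ∈ (Λ[1, 0] : SSet.Subcomplex.{u} _).obj k) :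
    x = (SSet.const (SSet.stdSimplex.obj₀Equiv.symm 0) : (Δ[1] : SSet.{u}) ⟶ Δ[1]).app k x := by
  induction k using Opposite.rec with | _ k
  induction k using SimplexCategory.rec with | _ k
  rw [SSet.mem_horn_iff_notMem_range] at hx
  obtain ⟨j, hj, hx⟩ := hx
  refine SSet.stdSimplex.ext _ _ fun i ↦ ?_
  have : x i ≠ j := fun h ↦ hx ⟨i, h⟩
  refine (?_ : x i = (0 : Fin 2)).trans rfl
  clear hx
  generalize x i = a at this
  revert a j
  decide

/-- The covariant homotopy lifting property, in terms of maps: a homotopy `b` in the base, a lift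
`f` of its source, and a lift `g` of its restriction to a subcomplex `K`, extend to a lift of
`b`. -/
lemma leftFibrations.exists_lift {E B : SSet.{u}} {p : E ⟶ B} (hp : leftFibrations p)
    {Y : SSet.{u}} (K : Y.Subcomplex) (f : Y ⟶ E) (g : Δ[1] ⊗ (K : SSet.{u}) ⟶ E)
    (b : Δ[1] ⊗ Y ⟶ B) (hfg : K.ι ≫ f = prodIncl 0 _ ≫ g)
    (hf : f ≫ p = prodIncl 0 _ ≫ b) (hg : g ≫ p = Δ[1] ◁ K.ι ≫ b) :
    ∃ h : Δ[1] ⊗ Y ⟶ E, prodIncl 0 _ ≫ h = f ∧ Δ[1] ◁ K.ι ≫ h = g ∧ h ≫ p = b := by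
  have po := SSet.Subcomplex.unionProd.isPushout.{u} Λ[1, 0] K
  have fac : ∀ (Z : SSet.{u}), ((Λ[1, 0] : SSet.Subcomplex.{u} _).ι ▷ Z) =
      snd _ _ ≫ prodIncl 0 Z := by
    intro Z
    apply CartesianMonoidalCategory.hom_ext
    · refine NatTrans.ext (funext fun k ↦ ?_)
      ext x
      exact mem_horn_one_zero _ x.1.2
    · rfl
  have w₁ : (Λ[1, 0] : SSet.Subcomplex.{u} _).ι ▷ (K : SSet.{u}) ≫ g =
      (Λ[1, 0] : SSet.{u}) ◁ K.ι ≫ snd _ _ ≫ f := by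
    rw [fac, Category.assoc, ← hfg]
    rfl
  have := hp.hasLiftingProperty_unionProd K
  have sq : CommSq (po.desc g (snd _ _ ≫ f) w₁)
      (SSet.Subcomplex.unionProd.{u} Λ[1, 0] K).ι p b := ⟨by
    apply po.hom_ext
    · rw [po.inl_desc_assoc, hg]; rfl
    · rw [po.inr_desc_assoc, Category.assoc, hf, SSet.Subcomplex.unionProd.ι₂_ι_assoc, fac]; rfl⟩
  refine ⟨sq.lift, ?_, ?_, sq.fac_right⟩
  · let s : Y ⟶ (Λ[1, 0] : SSet.{u}) ⊗ Y := CartesianMonoidalCategory.lift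
      (SSet.const ⟨SSet.stdSimplex.obj₀Equiv.symm 0, by
        rw [SSet.mem_horn_iff_notMem_range]
        exact ⟨1, by decide, by rintro ⟨i, hi⟩; exact absurd hi (zero_ne_one (α := Fin 2))⟩⟩) (𝟙 Y)
    have h₁ : s ≫ SSet.Subcomplex.unionProd.ι₂ Λ[1, 0] K ≫
        (SSet.Subcomplex.unionProd.{u} Λ[1, 0] K).ι = prodIncl 0 Y := rfl
    rw [← h₁, Category.assoc, Category.assoc, sq.fac_left, po.inr_desc]
    rfl
  · rw [← SSet.Subcomplex.unionProd.ι₁_ι, Category.assoc, sq.fac_left, po.inl_desc]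

/-! ### Covariant equivalences and trivial fibrations -/

section Ends

variable (Y : SSet.{u})

/-- The subcomplex `∂Δ[1] × Y` of `Δ[1] × Y`. -/
def prodEnds : (Δ[1] ⊗ Y).Subcomplex :=
  SSet.Subcomplex.range (prodIncl 0 Y) ⊔ SSet.Subcomplex.range (prodIncl 1 Y)

lemma range_prodIncl_le (ε : Fin 2) : SSet.Subcomplex.range (prodIncl ε Y) ≤ prodEnds Y := by
  fin_cases ε
  · exact le_sup_left
  · exact le_sup_right

/-- The inclusion of `Y` in `∂Δ[1] × Y` at the vertex `ε`. -/
def toProdEnds (ε : Fin 2) : Y ⟶ (prodEnds Y : SSet.{u}) :=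
  SSet.Subcomplex.lift (prodIncl ε Y) (range_prodIncl_le Y ε)

lemma toProdEnds_ι (ε : Fin 2) : toProdEnds Y ε ≫ (prodEnds Y).ι = prodIncl ε Y := rfl

lemma toProdEnds_ι_assoc (ε : Fin 2) {Z : SSet.{u}} (g : Δ[1] ⊗ Y ⟶ Z) :
    toProdEnds Y ε ≫ (prodEnds Y).ι ≫ g = prodIncl ε Y ≫ g := rfl

end Ends

/-- Maps out of a union of two subcomplexes that agree on the intersection can be glued. -/
lemma exists_desc_sup {Z E : SSet.{u}} {P Q : Z.Subcomplex} (a : (P : SSet.{u}) ⟶ E)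
    (b : (Q : SSet.{u}) ⟶ E)
    (h : ∀ (k : SimplexCategoryᵒᵖ) (z : Z.obj k) (hp : z ∈ P.obj k) (hq : z ∈ Q.obj k),
      a.app k ⟨z, hp⟩ = b.app k ⟨z, hq⟩) :
    ∃ c : ((P ⊔ Q : Z.Subcomplex) : SSet.{u}) ⟶ E,
      SSet.Subcomplex.homOfLE le_sup_left ≫ c = a ∧
      SSet.Subcomplex.homOfLE le_sup_right ≫ c = b := by
  have po := SSet.Subcomplex.BicartSq.isPushout (X := Z) (A₁ := P ⊓ Q) (A₂ := P) (A₃ := Q)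
    (A₄ := P ⊔ Q) ⟨rfl, rfl⟩
  have w : SSet.Subcomplex.homOfLE inf_le_left ≫ a =
      SSet.Subcomplex.homOfLE (inf_le_right : P ⊓ Q ≤ Q) ≫ b := by
    ext k ⟨z, hp, hq⟩
    exact h k z hp hq
  exact ⟨po.desc a b w, po.inl_desc _ _ _, po.inr_desc _ _ _⟩

lemma prodIncl_zero_ne_one {Y : SSet.{u}} {k : SimplexCategoryᵒᵖ} (y y' : Y.obj k) :
    (prodIncl 0 Y).app k y ≠ (prodIncl 1 Y).app k y' := by
  induction k using Opposite.rec with | _ k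
  induction k using SimplexCategory.rec with | _ k
  intro h
  have h₁ : (SSet.const (X := Y) (SSet.stdSimplex.obj₀Equiv.symm (0 : Fin 2))).app _ y =
      (SSet.const (X := Y) (SSet.stdSimplex.obj₀Equiv.symm (1 : Fin 2))).app _ y' :=
    congrArg Prod.fst h
  have h₂ := congrArg (fun s : (Δ[1] : SSet.{u}) _⦋k⦌ ↦ s 0) h₁
  exact zero_ne_one (α := Fin 2) h₂

lemma exists_desc_prodEnds {Y Z : SSet.{u}} (u : Fin 2 → (Y ⟶ Z)) :
    ∃ c : (prodEnds Y : SSet.{u}) ⟶ Z, ∀ ε, toProdEnds Y ε ≫ c = u ε := by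
  obtain ⟨c, h₀, h₁⟩ := exists_desc_sup
    (P := SSet.Subcomplex.range (prodIncl 0 Y)) (Q := SSet.Subcomplex.range (prodIncl 1 Y))
    (SSet.Subcomplex.ι _ ≫ snd _ _ ≫ u 0) (SSet.Subcomplex.ι _ ≫ snd _ _ ≫ u 1) (by
      rintro k _ ⟨y, rfl⟩ ⟨y', h⟩
      exact absurd h.symm (prodIncl_zero_ne_one y y'))
  refine ⟨c, fun ε ↦ ?_⟩
  fin_cases ε
  · exact congrArg (fun t ↦ SSet.Subcomplex.toRange (prodIncl 0 Y) ≫ t) h₀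
  · exact congrArg (fun t ↦ SSet.Subcomplex.toRange (prodIncl 1 Y) ≫ t) h₁

lemma prodEnds_hom_ext {Y Z : SSet.{u}} {f g : (prodEnds Y : SSet.{u}) ⟶ Z}
    (h : ∀ ε, toProdEnds Y ε ≫ f = toProdEnds Y ε ≫ g) : f = g := by
  ext k ⟨z, hz⟩
  obtain ⟨y, rfl⟩ | ⟨y, rfl⟩ := hz
  · exact ConcreteCategory.congr_hom (congr_app (h 0) k) y
  · exact ConcreteCategory.congr_hom (congr_app (h 1) k) y

lemma exists_desc_whisker_prodEnds {Y Z : SSet.{u}} (u : Fin 2 → (Δ[1] ⊗ Y ⟶ Z)) :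
    ∃ c : Δ[1] ⊗ (prodEnds Y : SSet.{u}) ⟶ Z, ∀ ε, Δ[1] ◁ toProdEnds Y ε ≫ c = u ε := by
  obtain ⟨c, hc⟩ := exists_desc_prodEnds (fun ε ↦ MonoidalClosed.curry (u ε))
  refine ⟨MonoidalClosed.uncurry c, fun ε ↦ ?_⟩
  rw [← MonoidalClosed.uncurry_natural_left, hc, MonoidalClosed.uncurry_curry]

lemma whisker_prodEnds_hom_ext {Y Z : SSet.{u}} {f g : Δ[1] ⊗ (prodEnds Y : SSet.{u}) ⟶ Z}
    (h : ∀ ε, Δ[1] ◁ toProdEnds Y ε ≫ f = Δ[1] ◁ toProdEnds Y ε ≫ g) : f = g := by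
  apply MonoidalClosed.curry_injective
  refine prodEnds_hom_ext fun ε ↦ ?_
  rw [← MonoidalClosed.curry_natural_left, ← MonoidalClosed.curry_natural_left, h]

/-- Filling of open squares in a left fibration: given the side `f` and the two sides `g 0`, `g 1`
issued from its ends, one obtains the side opposite to `f`, over the prescribed square `b`. -/
lemma leftFibrations.exists_square_filler {E B Y : SSet.{u}} {p : E ⟶ B} (hp : leftFibrations p)
    (f : Δ[1] ⊗ Y ⟶ E) (g : Fin 2 → (Δ[1] ⊗ Y ⟶ E)) (b : Δ[1] ⊗ (Δ[1] ⊗ Y) ⟶ B)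
    (hfg : ∀ ε, prodIncl ε _ ≫ f = prodIncl 0 _ ≫ g ε)
    (hf : f ≫ p = prodIncl 0 _ ≫ b) (hg : ∀ ε, g ε ≫ p = Δ[1] ◁ prodIncl ε Y ≫ b) :
    ∃ e : Δ[1] ⊗ Y ⟶ E, (∀ ε, prodIncl ε _ ≫ e = prodIncl 1 _ ≫ g ε) ∧
      e ≫ p = prodIncl 1 _ ≫ b := by
  obtain ⟨c, hc⟩ := exists_desc_whisker_prodEnds g
  have h₁ : (prodEnds Y).ι ≫ f = prodIncl 0 _ ≫ c := prodEnds_hom_ext fun ε ↦ by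
    rw [toProdEnds_ι_assoc, hfg, ← hc, prodIncl_whiskerLeft_assoc]
  have h₂ : c ≫ p = Δ[1] ◁ (prodEnds Y).ι ≫ b := whisker_prodEnds_hom_ext fun ε ↦ by
    rw [reassoc_of% hc ε, hg, ← MonoidalCategory.whiskerLeft_comp_assoc, toProdEnds_ι]
  obtain ⟨h, h₀, h₁, h₂⟩ := hp.exists_lift (prodEnds Y) f c b h₁ hf h₂
  refine ⟨prodIncl 1 _ ≫ h, fun ε ↦ ?_, by rw [Category.assoc, h₂]⟩
  rw [← hc, ← h₁, ← MonoidalCategory.whiskerLeft_comp_assoc, toProdEnds_ι,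
    prodIncl_whiskerLeft_assoc]

variable {B : SSet.{u}}

/-- Two morphisms of `sSet/B` are related if there is a homotopy `Δ[1] × Y ⟶ L` over `B` from
the first one to the second one. -/
def HomotopicOver {Y L : Over B} (f g : Y ⟶ L) : Prop :=
  ∃ h : Δ[1] ⊗ Y.left ⟶ L.left, prodIncl 0 _ ≫ h = f.left ∧ prodIncl 1 _ ≫ h = g.left ∧
    h ≫ L.hom = snd _ _ ≫ Y.hom

namespace HomotopicOver

lemma refl {Y L : Over B} (f : Y ⟶ L) : HomotopicOver f f :=
  ⟨snd _ _ ≫ f.left, by simp, by simp, by simp⟩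

lemma comp {Y L L' : Over B} {f g : Y ⟶ L} (h : HomotopicOver f g) (k : L ⟶ L') :
    HomotopicOver (f ≫ k) (g ≫ k) := by
  obtain ⟨h, h₀, h₁, h₂⟩ := h
  exact ⟨h ≫ k.left, by rw [reassoc_of% h₀, Over.comp_left], by rw [reassoc_of% h₁, Over.comp_left],
    by simpa using h₂⟩

lemma precomp {Y' Y L : Over B} {f g : Y ⟶ L} (h : HomotopicOver f g) (k : Y' ⟶ Y) :
    HomotopicOver (k ≫ f) (k ≫ g) := by
  obtain ⟨h, h₀, h₁, h₂⟩ := h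
  refine ⟨Δ[1] ◁ k.left ≫ h, ?_, ?_, ?_⟩
  · rw [Over.comp_left, ← h₀]; rfl
  · rw [Over.comp_left, ← h₁]; rfl
  · rw [Category.assoc, h₂, whiskerLeft_snd_assoc, Over.w]

/-- The homotopy relation is Euclidean, by filling an open square with one degenerate side. With
reflexivity, this makes it an equivalence relation. -/
lemma euclidean {Y L : Over B} (hL : leftFibrations L.hom) {f g k : Y ⟶ L}
    (h : HomotopicOver f g) (h' : HomotopicOver f k) : HomotopicOver g k := by
  obtain ⟨h, h₀, h₁, h₂⟩ := h
  obtain ⟨h', h₀', h₁', h₂'⟩ := h'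
  obtain ⟨e, he, he'⟩ := hL.exists_square_filler (snd _ _ ≫ f.left) ![h, h']
    (snd _ _ ≫ snd _ _ ≫ Y.hom) (fun ε ↦ by fin_cases ε <;> simp [h₀, h₀']) (by simp)
    (fun ε ↦ by fin_cases ε <;> simp [h₂, h₂'])
  exact ⟨e, by simpa [h₁] using he 0, by simpa [h₁'] using he 1, by simpa using he'⟩

lemma symm {Y L : Over B} (hL : leftFibrations L.hom) {f g : Y ⟶ L}
    (h : HomotopicOver f g) : HomotopicOver g f :=
  euclidean hL h (refl f)

lemma trans {Y L : Over B} (hL : leftFibrations L.hom) {f g k : Y ⟶ L}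
    (h : HomotopicOver f g) (h' : HomotopicOver g k) : HomotopicOver f k :=
  euclidean hL (symm hL h) h'

end HomotopicOver

/-- The vertex of `Fun_B(Y, L)` given by a morphism `Y ⟶ L` of `sSet/B`. -/
def funVertex {Y L : Over B} (f : Y ⟶ L) : (funOver Y L) _⦋0⦌ :=
  ⟨snd _ _ ≫ f.left, by rw [Category.assoc, Over.w]⟩

lemma funVertex_surjective {Y L : Over B} : Function.Surjective (funVertex (Y := Y) (L := L)) := by
  intro h
  let i : Y.left ⟶ Δ[0] ⊗ Y.left :=
    CartesianMonoidalCategory.lift (SSet.stdSimplex.isTerminalObj₀.from _) (𝟙 _)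
  have hi : snd _ _ ≫ i = 𝟙 _ :=
    CartesianMonoidalCategory.hom_ext _ _ (SSet.stdSimplex.isTerminalObj₀.hom_ext _ _) (by simp [i])
  refine ⟨Over.homMk (i ≫ h.1) ?_, Subtype.ext ?_⟩
  · rw [Category.assoc, h.2]
    simp [i]
  · change snd _ _ ≫ i ≫ h.1 = h.1
    rw [reassoc_of% hi]

lemma δ_one_whiskerRight (Y : SSet.{u}) :
    SSet.stdSimplex.{u}.δ (1 : Fin 2) ▷ Y = snd _ _ ≫ prodIncl 0 Y := by
  rw [SSet.stdSimplex.δ_one_eq_const]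
  rfl

lemma δ_zero_whiskerRight (Y : SSet.{u}) :
    SSet.stdSimplex.{u}.δ (0 : Fin 2) ▷ Y = snd _ _ ≫ prodIncl 1 Y := by
  rw [SSet.stdSimplex.δ_zero_eq_const]
  rfl

lemma π₀Rel_funVertex_iff {Y L : Over B} (f g : Y ⟶ L) :
    SSet.π₀Rel (funVertex f) (funVertex g) ↔ HomotopicOver f g := by
  have inj : ∀ {a b : Y.left ⟶ L.left}, snd Δ[0] _ ≫ a = snd _ _ ≫ b → a = b := by
    intro a b hab
    simpa using congrArg (fun t ↦ CartesianMonoidalCategory.lift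
      (SSet.stdSimplex.isTerminalObj₀.from _) (𝟙 _) ≫ t) hab
  constructor
  · rintro ⟨e⟩
    refine ⟨e.edge.1, inj ?_, inj ?_, e.edge.2⟩
    · have := congrArg Subtype.val e.src_eq
      rw [← Category.assoc, ← δ_one_whiskerRight]
      exact this
    · have := congrArg Subtype.val e.tgt_eq
      rw [← Category.assoc, ← δ_zero_whiskerRight]
      exact this
  · rintro ⟨h, h₀, h₁, h₂⟩
    refine ⟨SSet.Edge.mk (⟨h, h₂⟩ : (funOver Y L) _⦋1⦌) (Subtype.ext ?_) (Subtype.ext ?_)⟩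
    · change SSet.stdSimplex.{u}.δ (1 : Fin 2) ▷ Y.left ≫ h = snd _ _ ≫ f.left
      rw [δ_one_whiskerRight, Category.assoc, h₀]
    · change SSet.stdSimplex.{u}.δ (0 : Fin 2) ▷ Y.left ≫ h = snd _ _ ≫ g.left
      rw [δ_zero_whiskerRight, Category.assoc, h₁]

/-- As homotopies into a left fibration can be reversed and composed, the components of
`Fun_B(Y, L)` are the homotopy classes of morphisms `Y ⟶ L` over `B`. -/
lemma mk_funVertex_eq_iff {Y L : Over B} (hL : leftFibrations L.hom) (f g : Y ⟶ L) :
    SSet.π₀.mk (funVertex f) = SSet.π₀.mk (funVertex g) ↔ HomotopicOver f g := by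
  constructor
  · intro h
    rw [SSet.π₀.mk_eq_mk_iff] at h
    have key : ∀ x y : (funOver Y L) _⦋0⦌, Relation.EqvGen SSet.π₀Rel x y →
        ∀ f g, funVertex f = x → funVertex g = y → HomotopicOver f g := by
      intro x y h
      induction h with
      | rel x y h =>
        rintro f g rfl rfl
        exact (π₀Rel_funVertex_iff f g).1 h
      | refl x =>
        intro f g hf hg
        have h₁ := (π₀Rel_funVertex_iff f f).2 (.refl f)
        rw [hf, ← hg] at h₁
        rw [← hg] at hf
        exact (π₀Rel_funVertex_iff f g).1 (by rw [hf]; exact h₁)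
      | symm x y _ ih => exact fun f g hf hg ↦ (ih g f hg hf).symm hL
      | trans x y z _ _ ih ih' =>
        intro f g hf hg
        obtain ⟨k, hk⟩ := funVertex_surjective y
        exact (ih f k hf hk).trans hL (ih' k g hk hg)
    exact key _ _ h f g rfl rfl
  · intro h
    exact SSet.π₀.sound ((π₀Rel_funVertex_iff f g).2 h).some

lemma funOverMap_app_funVertex {Y Y' L : Over B} (w : Y ⟶ Y') (f : Y' ⟶ L) :
    (funOverMap w L).app _ (funVertex f) = funVertex (w ≫ f) := by
  refine Subtype.ext ?_
  change _ ◁ w.left ≫ snd _ _ ≫ f.left = snd _ _ ≫ (w ≫ f).left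
  simp

lemma IsCovariantEquivalence.of_comp {Y Y' Y'' : Over B} {f : Y ⟶ Y'} {g : Y' ⟶ Y''}
    (hg : IsCovariantEquivalence g) (hfg : IsCovariantEquivalence (f ≫ g)) :
    IsCovariantEquivalence f := by
  intro L hL
  refine (Function.Bijective.of_comp_iff _ (hg L hL)).1 ?_
  convert hfg L hL
  ext x
  have : funOverMap (f ≫ g) L = funOverMap g L ≫ funOverMap f L := by
    refine NatTrans.ext (funext fun n ↦ ?_)
    ext h
    refine Subtype.ext ?_
    change _ ◁ (f ≫ g).left ≫ h.1 = _ ◁ f.left ≫ _ ◁ g.left ≫ h.1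
    simp
  rw [this, SSet.mapπ₀_comp_apply]
  rfl

/-- A trivial fibration over `B` is a covariant equivalence: it has a section, which is a homotopy
inverse over `B`. -/
lemma isCovariantEquivalence_of_rlp {Y Y' : Over B} (w : Y ⟶ Y')
    (hw : SSet.modelCategoryQuillen.I.rlp w.left) : IsCovariantEquivalence w := by
  rw [← SSet.rlp_monomorphisms] at hw
  have h₁ := hw (⊥ : Y'.left.Subcomplex).ι (inferInstanceAs (Mono _))
  have h₂ := hw (prodEnds Y.left).ι (inferInstanceAs (Mono _))
  have sq₁ : CommSq (SSet.Subcomplex.isInitialBot.to Y.left) (⊥ : Y'.left.Subcomplex).ι w.left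
    (𝟙 _) := ⟨SSet.Subcomplex.isInitialBot.hom_ext _ _⟩
  have hs : sq₁.lift ≫ w.left = 𝟙 _ := sq₁.fac_right
  let s : Y' ⟶ Y := Over.homMk sq₁.lift (by rw [← Over.w w, reassoc_of% hs])
  have hsw : s ≫ w = 𝟙 _ := by ext : 1; exact hs
  obtain ⟨c, hc⟩ := exists_desc_prodEnds ![w.left ≫ s.left, 𝟙 _]
  have sq₂ : CommSq c (prodEnds Y.left).ι w.left (snd _ _ ≫ w.left) := ⟨prodEnds_hom_ext fun ε ↦ by
    rw [reassoc_of% hc ε, toProdEnds_ι_assoc, prodIncl_snd_assoc]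
    fin_cases ε
    · change (w.left ≫ s.left) ≫ w.left = w.left
      rw [Category.assoc, ← Over.comp_left, hsw, Over.id_left, Category.comp_id]
    · exact Category.id_comp _⟩
  have hG : HomotopicOver (w ≫ s) (𝟙 Y) := by
    refine ⟨sq₂.lift, ?_, ?_, ?_⟩
    · rw [← toProdEnds_ι, Category.assoc, sq₂.fac_left, hc]; rfl
    · rw [← toProdEnds_ι, Category.assoc, sq₂.fac_left, hc]; rfl
    · rw [← Over.w w, sq₂.fac_right_assoc, Category.assoc]
  intro L hL
  refine Function.bijective_iff_has_inverse.2 ⟨SSet.mapπ₀ (funOverMap s L), fun x ↦ ?_, fun x ↦ ?_⟩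
  · obtain ⟨x, rfl⟩ := SSet.π₀.mk_surjective x
    obtain ⟨f, rfl⟩ := funVertex_surjective x
    rw [SSet.mapπ₀_mk, SSet.mapπ₀_mk, funOverMap_app_funVertex, funOverMap_app_funVertex,
      reassoc_of% hsw]
  · obtain ⟨x, rfl⟩ := SSet.π₀.mk_surjective x
    obtain ⟨f, rfl⟩ := funVertex_surjective x
    rw [SSet.mapπ₀_mk, SSet.mapπ₀_mk, funOverMap_app_funVertex, funOverMap_app_funVertex,
      mk_funVertex_eq_iff hL]
    simpa using hG.comp f

/-- A left fibration between left fibrations over `B` which is a covariant equivalence is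
a trivial fibration: it is shrinkable over `B`. -/
lemma IsCovariantEquivalence.rlp {Y Y' : Over B} {w : Y ⟶ Y'} (hw : IsCovariantEquivalence w)
    (hY : leftFibrations Y.hom) (hY' : leftFibrations Y'.hom) (hw' : leftFibrations w.left) :
    SSet.modelCategoryQuillen.I.rlp w.left := by
  obtain ⟨x, hx⟩ := (hw Y hY).2 (SSet.π₀.mk (funVertex (𝟙 Y)))
  obtain ⟨x, rfl⟩ := SSet.π₀.mk_surjective x
  obtain ⟨v, rfl⟩ := funVertex_surjective x
  rw [SSet.mapπ₀_mk, funOverMap_app_funVertex, mk_funVertex_eq_iff hY] at hx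
  have hx' : HomotopicOver (v ≫ w) (𝟙 Y') := by
    rw [← mk_funVertex_eq_iff hY']
    apply (hw Y' hY').1
    rw [SSet.mapπ₀_mk, SSet.mapπ₀_mk, funOverMap_app_funVertex, funOverMap_app_funVertex,
      mk_funVertex_eq_iff hY']
    simpa using hx.comp w
  -- deform `v` along a lift of the homotopy `v ≫ w ⟶ 𝟙`, so that it becomes a section `s` of `w`
  obtain ⟨H, H₀, H₁, H₂⟩ := hx'
  obtain ⟨h, h₀, -, h₂⟩ := hw'.exists_lift ⊥ v.left
    (MonoidalClosed.uncurry (SSet.Subcomplex.isInitialBot.to _)) H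
    (SSet.Subcomplex.isInitialBot.hom_ext _ _) (by rw [H₀, Over.comp_left])
    (MonoidalClosed.curry_injective (SSet.Subcomplex.isInitialBot.hom_ext _ _))
  have hsw : (prodIncl 1 _ ≫ h) ≫ w.left = 𝟙 _ := by rw [Category.assoc, h₂, H₁]; rfl
  let s : Y' ⟶ Y := Over.homMk (prodIncl 1 _ ≫ h) (by
    rw [← Over.w w, ← Category.assoc, hsw, Category.id_comp])
  have hvs : HomotopicOver v s := ⟨h, h₀, rfl, by rw [← Over.w w, reassoc_of% h₂, H₂]⟩
  replace hsw : s.left ≫ w.left = 𝟙 _ := hsw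
  obtain ⟨G, G₀, G₁, G₂⟩ := ((hvs.precomp w).symm hY).trans hY hx
  rw [Over.comp_left] at G₀
  rw [Over.id_left] at G₁
  -- make the homotopy `w ≫ s ⟶ 𝟙` fibrewise over `Y'`
  obtain ⟨e, he, he'⟩ := hw'.exists_square_filler (snd _ _ ≫ w.left ≫ s.left)
    ![G ≫ w.left ≫ s.left, G] (Δ[1] ◁ snd _ _ ≫ G ≫ w.left)
    (fun ε ↦ by
      fin_cases ε
      · change prodIncl 0 _ ≫ _ = prodIncl 0 _ ≫ G ≫ w.left ≫ s.left
        rw [reassoc_of% G₀, reassoc_of% hsw, prodIncl_snd_assoc]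
      · change prodIncl 1 _ ≫ _ = prodIncl 0 _ ≫ G
        rw [G₀, prodIncl_snd_assoc])
    (by
      rw [prodIncl_whiskerLeft_assoc, reassoc_of% G₀, hsw, Category.assoc, Category.assoc, hsw])
    (fun ε ↦ by
      rw [← MonoidalCategory.whiskerLeft_comp_assoc, prodIncl_snd,
        MonoidalCategory.whiskerLeft_id, Category.id_comp]
      fin_cases ε
      · change (G ≫ w.left ≫ s.left) ≫ w.left = _
        rw [Category.assoc, Category.assoc, hsw, Category.comp_id]
      · rfl)
  have he₀ : prodIncl 0 _ ≫ e = w.left ≫ s.left := by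
    refine (he 0).trans ?_
    change prodIncl 1 _ ≫ G ≫ w.left ≫ s.left = _
    rw [reassoc_of% G₁]
  have he₁ : prodIncl 1 _ ≫ e = 𝟙 _ := (he 1).trans G₁
  rw [prodIncl_whiskerLeft_assoc, reassoc_of% G₁] at he'
  rintro _ _ _ ⟨n⟩
  refine ⟨fun {y y'} sq ↦ ?_⟩
  obtain ⟨k, k₀, k₁, k₂⟩ := hw'.exists_lift ∂Δ[n] (y' ≫ s.left) (Δ[1] ◁ y ≫ e) (snd _ _ ≫ y')
    (by rw [prodIncl_whiskerLeft_assoc, he₀, ← sq.w_assoc])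
    (by rw [Category.assoc, hsw, Category.comp_id, prodIncl_snd_assoc])
    (by rw [Category.assoc, he', whiskerLeft_snd_assoc, whiskerLeft_snd_assoc, sq.w])
  refine ⟨⟨prodIncl 1 _ ≫ k, ?_, ?_⟩⟩
  · rw [← prodIncl_whiskerLeft_assoc, k₁, prodIncl_whiskerLeft_assoc, he₁, Category.comp_id]
  · rw [Category.assoc, k₂, prodIncl_snd_assoc]

/-! ### Simplices over the interval and their fibres -/

section Fibres

variable {d : ℕ}

/-- Maps between standard simplices are determined by their effect on vertices. -/
lemma stdSimplex_hom_app_apply {m k : ℕ} (χ : (Δ[d] : SSet.{u}) ⟶ Δ[m])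
    (y : (Δ[d] : SSet.{u}) _⦋k⦌) (i : Fin (k + 1)) :
    (χ.app (op ⦋k⦌) y : (Δ[m] : SSet.{u}) _⦋k⦌) i = SSet.yonedaEquiv χ (y i) := by
  obtain ⟨c, rfl⟩ := SSet.yonedaEquiv.symm.surjective χ
  rw [Equiv.apply_symm_apply]
  rfl

lemma mem_fib_iff {ε : Fin 2} (χ : (Δ[d] : SSet.{u}) ⟶ Δ[1]) {k : ℕ}
    (y : (Δ[d] : SSet.{u}) _⦋k⦌) :
    y ∈ (fib ε χ).obj (op ⦋k⦌) ↔ ∀ i, SSet.yonedaEquiv χ (y i) = ε := by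
  refine (SSet.stdSimplex.mem_face_iff _ _).trans (forall_congr' fun i ↦ ?_)
  rw [Finset.mem_singleton, stdSimplex_hom_app_apply]

lemma notMem_fib_one_of_mem_fib_zero {Z : SSet.{u}} (χ : Z ⟶ Δ[1])
    {k : SimplexCategoryᵒᵖ} {y : Z.obj k}
    (h₀ : y ∈ (fib 0 χ).obj k) (h₁ : y ∈ (fib 1 χ).obj k) : False := by
  induction k using Opposite.rec with | _ k
  induction k using SimplexCategory.rec with | _ k
  have h₀ := (SSet.stdSimplex.mem_face_iff _ _).1 h₀ 0
  have h₁ := (SSet.stdSimplex.mem_face_iff _ _).1 h₁ 0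
  rw [Finset.mem_singleton] at h₀ h₁
  exact zero_ne_one (α := Fin 2) (h₀.symm.trans h₁)

lemma eq_of_fib_eq_top {Z : SSet.{u}} {ε : Fin 2} {χ χ' : Z ⟶ Δ[1]} (h : fib ε χ = ⊤)
    (h' : fib ε χ' = ⊤) : χ = χ' := by
  refine NatTrans.ext (funext fun k ↦ ?_)
  ext y
  induction k using Opposite.rec with | _ k
  induction k using SimplexCategory.rec with | _ k
  refine SSet.stdSimplex.ext _ _ fun i ↦ ?_
  have hy : y ∈ (fib ε χ).obj _ := by rw [h]; trivial
  have hy' : y ∈ (fib ε χ').obj _ := by rw [h']; trivial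
  have hy := (SSet.stdSimplex.mem_face_iff _ _).1 hy i
  have hy' := (SSet.stdSimplex.mem_face_iff _ _).1 hy' i
  rw [Finset.mem_singleton] at hy hy'
  exact hy.trans hy'.symm

/-- Unless `χ` is constant with value `0`, the simplex retracts onto its final face `χ⁻¹(1)`. -/
lemma fib_zero_eq_top_or_exists_retraction {n : SimplexCategory}
    (χ : SSet.stdSimplex.{u}.obj n ⟶ Δ[1]) :
    fib 0 χ = ⊤ ∨
      ∃ r : SSet.stdSimplex.{u}.obj n ⟶ (fib 1 χ : SSet.{u}), (fib 1 χ).ι ≫ r = 𝟙 _ := by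
  induction n using SimplexCategory.rec with | _ d
  by_cases h : ∃ j, SSet.yonedaEquiv χ j = 1
  · right
    let j₀ := Fin.find _ h
    have hj₀ : SSet.yonedaEquiv χ j₀ = 1 := Fin.find_spec h
    have hmin : ∀ j, SSet.yonedaEquiv χ j = 1 → j₀ ≤ j := fun j hj ↦ Fin.find_le_of_pos h hj
    have hmax : ∀ j, SSet.yonedaEquiv χ (max j j₀) = 1 := fun j ↦
      le_antisymm (Fin.le_last _)
        (hj₀.symm.le.trans
          (SSet.stdSimplex.monotone_apply (SSet.yonedaEquiv χ) (le_max_right j j₀)))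
    let g : ⦋d⦌ ⟶ ⦋d⦌ := SimplexCategory.Hom.mk
      ⟨fun j ↦ max j j₀, fun a b hab ↦ max_le_max hab le_rfl⟩
    refine ⟨SSet.Subcomplex.lift (SSet.stdSimplex.map g) ?_, ?_⟩
    · rintro k _ ⟨y, rfl⟩
      induction k using Opposite.rec with | _ k
      induction k using SimplexCategory.rec with | _ k
      exact (mem_fib_iff χ _).2 fun i ↦ hmax (y i)
    · refine NatTrans.ext (funext fun k ↦ ?_)
      ext ⟨y, hy⟩
      induction k using Opposite.rec with | _ k
      induction k using SimplexCategory.rec with | _ k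
      refine Subtype.ext (SSet.stdSimplex.ext _ _ fun i ↦ ?_)
      exact max_eq_left (hmin _ ((mem_fib_iff χ _).1 hy i))
  · left
    refine top_le_iff.1 fun k y _ ↦ ?_
    induction k using Opposite.rec with | _ k
    induction k using SimplexCategory.rec with | _ k
    refine (mem_fib_iff χ _).2 fun i ↦ ?_
    have := not_exists.1 h (y i)
    generalize SSet.yonedaEquiv χ (y i) = a at this
    revert a
    decide

/-- Unless `χ` is constant with value `1`, the simplex retracts onto its initial face `χ⁻¹(0)`. -/
lemma fib_one_eq_top_or_exists_retraction {n : SimplexCategory}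
    (χ : SSet.stdSimplex.{u}.obj n ⟶ Δ[1]) :
    fib 1 χ = ⊤ ∨
      ∃ r : SSet.stdSimplex.{u}.obj n ⟶ (fib 0 χ : SSet.{u}), (fib 0 χ).ι ≫ r = 𝟙 _ := by
  induction n using SimplexCategory.rec with | _ d
  by_cases h : ∃ j, SSet.yonedaEquiv χ j = 0
  · right
    obtain ⟨j₀, hj₀, hmin⟩ : ∃ j₀, SSet.yonedaEquiv χ j₀ = 0 ∧
        ∀ j, SSet.yonedaEquiv χ j = 0 → j ≤ j₀ := by
      let F : Finset (Fin (d + 1)) := Finset.univ.filter fun j ↦ SSet.yonedaEquiv χ j = 0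
      have hF : F.Nonempty := by
        obtain ⟨j, hj⟩ := h
        exact ⟨j, Finset.mem_filter.2 ⟨Finset.mem_univ _, hj⟩⟩
      exact ⟨F.max' hF, (Finset.mem_filter.1 (F.max'_mem hF)).2,
        fun j hj ↦ F.le_max' _ (Finset.mem_filter.2 ⟨Finset.mem_univ _, hj⟩)⟩
    have hmax : ∀ j, SSet.yonedaEquiv χ (min j j₀) = 0 := fun j ↦
      le_antisymm
        ((SSet.stdSimplex.monotone_apply (SSet.yonedaEquiv χ) (min_le_right j j₀)).trans hj₀.le)
        (Fin.zero_le _)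
    let g : ⦋d⦌ ⟶ ⦋d⦌ := SimplexCategory.Hom.mk
      ⟨fun j ↦ min j j₀, fun a b hab ↦ min_le_min hab le_rfl⟩
    refine ⟨SSet.Subcomplex.lift (SSet.stdSimplex.map g) ?_, ?_⟩
    · rintro k _ ⟨y, rfl⟩
      induction k using Opposite.rec with | _ k
      induction k using SimplexCategory.rec with | _ k
      exact (mem_fib_iff χ _).2 fun i ↦ hmax (y i)
    · refine NatTrans.ext (funext fun k ↦ ?_)
      ext ⟨y, hy⟩
      induction k using Opposite.rec with | _ k
      induction k using SimplexCategory.rec with | _ k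
      refine Subtype.ext (SSet.stdSimplex.ext _ _ fun i ↦ ?_)
      exact min_eq_left (hmin _ ((mem_fib_iff χ _).1 hy i))
  · left
    refine top_le_iff.1 fun k y _ ↦ ?_
    induction k using Opposite.rec with | _ k
    induction k using SimplexCategory.rec with | _ k
    refine (mem_fib_iff χ _).2 fun i ↦ ?_
    have := not_exists.1 h (y i)
    generalize SSet.yonedaEquiv χ (y i) = a at this
    revert a
    decide

end Fibres

lemma fib_comp_eq_top {Y Z : SSet.{u}} {ε : Fin 2} (f : Y ⟶ Z) {χ : Z ⟶ Δ[1]} (h : fib ε χ = ⊤) :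
    fib ε (f ≫ χ) = ⊤ := by
  change (fib ε χ).preimage f = ⊤
  rw [h]
  rfl

section FibreLifts

variable {A B : SSet.{u}} (X : Cyl A B)

lemma JoinSimplex.left_congr {A B : SSet.{u}} {n : SimplexCategory} {s t : JoinSimplex A B n}
    (h : s = t) {k : SimplexCategoryᵒᵖ} (x : (SSet.stdSimplex.{u}.obj n).obj k)
    (hs : x ∈ (fib 0 s.χ).obj k) (ht : x ∈ (fib 0 t.χ).obj k) :
    s.left.app k ⟨x, hs⟩ = t.left.app k ⟨x, ht⟩ := by
  subst h
  rfl

lemma JoinSimplex.right_congr {A B : SSet.{u}} {n : SimplexCategory} {s t : JoinSimplex A B n}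
    (h : s = t) {k : SimplexCategoryᵒᵖ} (x : (SSet.stdSimplex.{u}.obj n).obj k)
    (hs : x ∈ (fib 1 s.χ).obj k) (ht : x ∈ (fib 1 t.χ).obj k) :
    s.right.app k ⟨x, hs⟩ = t.right.app k ⟨x, ht⟩ := by
  subst h
  rfl

lemma stdSimplex_map_id_simplex {n : SimplexCategory} {k : SimplexCategoryᵒᵖ}
    (y : (SSet.stdSimplex.{u}.obj n).obj k) :
    (SSet.stdSimplex.{u}.obj n).map (SSet.stdSimplex.objEquiv y).op (SSet.yonedaEquiv (𝟙 _)) = y :=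
  SSet.stdSimplex.objEquiv.injective (Category.comp_id (SSet.stdSimplex.objEquiv y))

lemma yonedaEquiv_symm_app_id_simplex {Z : SSet.{u}} {n : SimplexCategory} (x : Z.obj (op n)) :
    (SSet.yonedaEquiv.symm x).app (op n) (SSet.yonedaEquiv (𝟙 _)) = x :=
  SSet.yonedaEquiv.apply_symm_apply x

/-- Over a simplex of `A ⋆ B` contained in `A`, the map `X ⟶ A ⋆ B` is bijective. -/
lemma Cyl.existsUnique_of_fib_zero {n : SimplexCategory} (s : JoinSimplex A B n)
    (hs : fib 0 s.χ = ⊤) : ∃! x : X.X.obj (op n), X.toJoin.app (op n) x = s := by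
  let e : (SSet.stdSimplex.{u}.obj n).obj (op n) := SSet.yonedaEquiv (𝟙 _)
  have he : e ∈ (fib 0 s.χ).obj (op n) := by rw [hs]; trivial
  let a : A.obj (op n) := s.left.app _ ⟨e, he⟩
  let x := X.iso₀.inv.app _ a
  have hx : X.iso₀.hom.app _ x = a := by
    change (X.iso₀.inv ≫ X.iso₀.hom).app _ a = a
    rw [X.iso₀.inv_hom_id]
    rfl
  refine ⟨x.1, ?_, fun y hy ↦ ?_⟩
  · have hχ : fib 0 (SSet.yonedaEquiv.symm x.1 ≫ X.p) = ⊤ :=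
      top_le_iff.1 fun k y _ ↦ (fib 0 X.p).map (SSet.stdSimplex.objEquiv y).op x.2
    have hχ' : SSet.yonedaEquiv.symm x.1 ≫ X.p = s.χ := eq_of_fib_eq_top hχ hs
    refine JoinSimplex.ext' hχ' (fun k y h₁ h₂ ↦ ?_) (fun k y h₁ h₂ ↦ ?_)
    · have h₃ : X.iso₀.hom.app k ((fib 0 X.p : SSet.{u}).map (SSet.stdSimplex.objEquiv y).op x) =
          A.map (SSet.stdSimplex.objEquiv y).op a := by
        rw [← hx]
        exact NatTrans.naturality_apply X.iso₀.hom _ _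
      refine h₃.trans ((NatTrans.naturality_apply s.left _ _).symm.trans ?_)
      exact congrArg (s.left.app k) (Subtype.ext (stdSimplex_map_id_simplex y))
    · exact (notMem_fib_one_of_mem_fib_zero _ (y := y) (by rw [hs]; trivial) h₂).elim
  · have h₁ : e ∈ (fib 0 (SSet.yonedaEquiv.symm y ≫ X.p)).obj _ := by
      have h₂ : fib 0 (X.toJoin.app (op n) y : JoinSimplex A B n).χ = ⊤ := by rw [hy, hs]
      exact h₂.symm ▸ trivial
    have h₂ : y ∈ (fib 0 X.p).obj _ := by
      rw [← yonedaEquiv_symm_app_id_simplex y]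
      exact h₁
    have h₃ : X.iso₀.hom.app _ ⟨y, h₂⟩ = a :=
      (congrArg (X.iso₀.hom.app (op n))
        (Subtype.ext (yonedaEquiv_symm_app_id_simplex y).symm)).trans
          (JoinSimplex.left_congr hy e h₁ he)
    change y = (X.iso₀.inv.app _ a).1
    rw [← h₃]
    change y = ((X.iso₀.hom ≫ X.iso₀.inv).app _ ⟨y, h₂⟩).1
    rw [X.iso₀.hom_inv_id]
    rfl

/-- Over a simplex of `A ⋆ B` contained in `B`, the map `X ⟶ A ⋆ B` is bijective. -/
lemma Cyl.existsUnique_of_fib_one {n : SimplexCategory} (s : JoinSimplex A B n)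
    (hs : fib 1 s.χ = ⊤) : ∃! x : X.X.obj (op n), X.toJoin.app (op n) x = s := by
  let e : (SSet.stdSimplex.{u}.obj n).obj (op n) := SSet.yonedaEquiv (𝟙 _)
  have he : e ∈ (fib 1 s.χ).obj (op n) := by rw [hs]; trivial
  let a : B.obj (op n) := s.right.app _ ⟨e, he⟩
  let x := X.iso₁.inv.app _ a
  have hx : X.iso₁.hom.app _ x = a := by
    change (X.iso₁.inv ≫ X.iso₁.hom).app _ a = a
    rw [X.iso₁.inv_hom_id]
    rfl
  refine ⟨x.1, ?_, fun y hy ↦ ?_⟩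
  · have hχ : fib 1 (SSet.yonedaEquiv.symm x.1 ≫ X.p) = ⊤ :=
      top_le_iff.1 fun k y _ ↦ (fib 1 X.p).map (SSet.stdSimplex.objEquiv y).op x.2
    have hχ' : SSet.yonedaEquiv.symm x.1 ≫ X.p = s.χ := eq_of_fib_eq_top hχ hs
    refine JoinSimplex.ext' hχ' (fun k y h₁ h₂ ↦ ?_) (fun k y h₁ h₂ ↦ ?_)
    · exact (notMem_fib_one_of_mem_fib_zero _ (y := y) h₂ (by rw [hs]; trivial)).elim
    · have h₃ : X.iso₁.hom.app k ((fib 1 X.p : SSet.{u}).map (SSet.stdSimplex.objEquiv y).op x) =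
          B.map (SSet.stdSimplex.objEquiv y).op a := by
        rw [← hx]
        exact NatTrans.naturality_apply X.iso₁.hom _ _
      refine h₃.trans ((NatTrans.naturality_apply s.right _ _).symm.trans ?_)
      exact congrArg (s.right.app k) (Subtype.ext (stdSimplex_map_id_simplex y))
  · have h₁ : e ∈ (fib 1 (SSet.yonedaEquiv.symm y ≫ X.p)).obj _ := by
      have h₂ : fib 1 (X.toJoin.app (op n) y : JoinSimplex A B n).χ = ⊤ := by rw [hy, hs]
      exact h₂.symm ▸ trivial
    have h₂ : y ∈ (fib 1 X.p).obj _ := by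
      rw [← yonedaEquiv_symm_app_id_simplex y]
      exact h₁
    have h₃ : X.iso₁.hom.app _ ⟨y, h₂⟩ = a :=
      (congrArg (X.iso₁.hom.app (op n))
        (Subtype.ext (yonedaEquiv_symm_app_id_simplex y).symm)).trans
          (JoinSimplex.right_congr hy e h₁ he)
    change y = (X.iso₁.inv.app _ a).1
    rw [← h₃]
    change y = ((X.iso₁.hom ≫ X.iso₁.inv).app _ ⟨y, h₂⟩).1
    rw [X.iso₁.hom_inv_id]
    rfl

end FibreLifts

/-! ### Maps into a left division -/

section LeftDivision

variable {A B : SSet.{u}} (X : Cyl A B) {M T : SSet.{u}} (α : M ⟶ A) (β : T ⟶ B)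

/-- The map `T ⟶ M \ X` over `B` corresponding to a map `M ⋆ T ⟶ X` over `A ⋆ B`. -/
def toLeftDiv (σ : join M T ⟶ X.X) (hσ : σ ≫ X.toJoin = joinMap α β) :
    T ⟶ leftDivObj (Over.mk α) X where
  app n := ↾fun t ↦ ⟨(β.app n t, joinMap (𝟙 _) (SSet.yonedaEquiv.symm t) ≫ σ), by
    rw [Category.assoc, hσ, ← joinMap_comp, Category.id_comp, SSet.yonedaEquiv_symm_comp]
    rfl⟩
  naturality m n f := by
    ext t
    refine Subtype.ext (Prod.ext ?_ ?_)
    · exact NatTrans.naturality_apply β f t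
    · change joinMap (𝟙 _) (SSet.yonedaEquiv.symm (T.map f.unop.op t)) ≫ σ =
        joinMap (𝟙 _) (SSet.stdSimplex.map f.unop) ≫
          joinMap (𝟙 _) (SSet.yonedaEquiv.symm t) ≫ σ
      rw [← SSet.yonedaEquiv_symm_naturality_left, ← Category.assoc, ← joinMap_comp,
        Category.id_comp]

variable {X α β}

lemma toLeftDiv_hom (σ : join M T ⟶ X.X) (hσ : σ ≫ X.toJoin = joinMap α β) :
    toLeftDiv X α β σ hσ ≫ (leftDiv (Over.mk α) X).hom = β := rfl

lemma comp_toLeftDiv {S : SSet.{u}} (j : S ⟶ T) (σ : join M T ⟶ X.X)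
    (hσ : σ ≫ X.toJoin = joinMap α β) :
    j ≫ toLeftDiv X α β σ hσ = toLeftDiv X α (j ≫ β) (joinMap (𝟙 M) j ≫ σ)
      (by rw [Category.assoc, hσ, ← joinMap_comp, Category.id_comp]) := by
  refine NatTrans.ext (funext fun n ↦ ?_)
  ext t
  refine Subtype.ext (Prod.ext rfl ?_)
  change joinMap (𝟙 _) (SSet.yonedaEquiv.symm (j.app (op n.unop) t)) ≫ σ =
    joinMap (𝟙 _) (SSet.yonedaEquiv.symm t) ≫ joinMap (𝟙 M) j ≫ σ
  rw [← SSet.yonedaEquiv_symm_comp, ← Category.assoc, ← joinMap_comp, Category.id_comp]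

lemma toLeftDiv_comp {K : SSet.{u}} (i : K ⟶ M) (σ : join M T ⟶ X.X)
    (hσ : σ ≫ X.toJoin = joinMap α β) :
    toLeftDiv X α β σ hσ ≫ (leftDivMap (Over.homMk i : Over.mk (i ≫ α) ⟶ Over.mk α) X).left =
      toLeftDiv X (i ≫ α) β (joinMap i (𝟙 T) ≫ σ)
      (by rw [Category.assoc, hσ, ← joinMap_comp, Category.id_comp]) := rfl

lemma toLeftDiv_injective {σ σ' : join M T ⟶ X.X} (hσ : σ ≫ X.toJoin = joinMap α β)
    (hσ' : σ' ≫ X.toJoin = joinMap α β) (h : toLeftDiv X α β σ hσ = toLeftDiv X α β σ' hσ') :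
    σ = σ' := by
  refine NatTrans.ext (funext fun n ↦ ?_)
  ext s
  obtain hs | ⟨r, hr⟩ := fib_zero_eq_top_or_exists_retraction (n := n.unop) s.χ
  · exact (X.existsUnique_of_fib_zero (n := n.unop) ((joinMap α β).app n s) hs).unique
      (ConcreteCategory.congr_hom (congr_app hσ n) s)
      (ConcreteCategory.congr_hom (congr_app hσ' n) s)
  · let t : T.obj (op n.unop) := SSet.yonedaEquiv (r ≫ s.right)
    have h₁ := congrArg (fun z : (leftDivObj (Over.mk α) X).obj n ↦
      z.1.2.app n ⟨s.χ, s.left, (fib 1 s.χ).ι⟩) (ConcreteCategory.congr_hom (congr_app h n) t)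
    have h₂ : (joinMap (𝟙 M) (SSet.yonedaEquiv.symm t)).app n ⟨s.χ, s.left, (fib 1 s.χ).ι⟩ = s := by
      change (⟨s.χ, s.left, (fib 1 s.χ).ι ≫ SSet.yonedaEquiv.symm t⟩ : JoinSimplex _ _ _) = s
      rw [Equiv.symm_apply_apply, reassoc_of% hr]
      rfl
    change σ.app n ((joinMap (𝟙 M) (SSet.yonedaEquiv.symm t)).app n _) =
      σ'.app n ((joinMap (𝟙 M) (SSet.yonedaEquiv.symm t)).app n _) at h₁
    rwa [h₂] at h₁

/-- The value of the map `M ⋆ T ⟶ X` corresponding to `φ : T ⟶ M \ X` on the image under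
`M ⋆ t : M ⋆ Δ[m] ⟶ M ⋆ T` of the simplex `s`. -/
def leftDivEval (φ : T ⟶ leftDivObj (Over.mk α) X) {m n : SimplexCategory} (t : T.obj (op m))
    (s : JoinSimplex M (SSet.stdSimplex.{u}.obj m) n) : X.X.obj (op n) :=
  (φ.app (op m) t).1.2.app (op n) s

lemma toJoin_leftDivEval (φ : T ⟶ leftDivObj (Over.mk α) X)
    (hφ : φ ≫ (leftDiv (Over.mk α) X).hom = β) {m n : SimplexCategory} (t : T.obj (op m))
    (s : JoinSimplex M (SSet.stdSimplex.{u}.obj m) n) :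
    X.toJoin.app (op n) (leftDivEval φ t s) =
      (joinMap α (SSet.yonedaEquiv.symm t ≫ β)).app (op n) s := by
  have h := ConcreteCategory.congr_hom (congr_app (φ.app (op m) t).2 (op n)) s
  refine h.trans ?_
  rw [SSet.yonedaEquiv_symm_comp, ← hφ]
  rfl

lemma map_leftDivEval (φ : T ⟶ leftDivObj (Over.mk α) X) {m n n' : SimplexCategory} (f : n' ⟶ n)
    (t : T.obj (op m)) (s : JoinSimplex M (SSet.stdSimplex.{u}.obj m) n) :
    X.X.map f.op (leftDivEval φ t s) = leftDivEval φ t ((join _ _).map f.op s) :=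
  (NatTrans.naturality_apply (φ.app (op m) t).1.2 f.op s).symm

lemma leftDivEval_map (φ : T ⟶ leftDivObj (Over.mk α) X) {m m' n : SimplexCategory} (g : m' ⟶ m)
    (t : T.obj (op m)) (s : JoinSimplex M (SSet.stdSimplex.{u}.obj m') n) :
    leftDivEval φ (T.map g.op t) s =
      leftDivEval φ t ((joinMap (𝟙 M) (SSet.stdSimplex.map g)).app (op n) s) := by
  have h := NatTrans.naturality_apply φ g.op t
  exact congrArg (fun z : (leftDivObj (Over.mk α) X).obj (op m') ↦ z.1.2.app (op n) s) h

/-- `leftDivEval` only depends on the simplex of `M ⋆ T`. -/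
lemma leftDivEval_congr (φ : T ⟶ leftDivObj (Over.mk α) X)
    (hφ : φ ≫ (leftDiv (Over.mk α) X).hom = β) {m m' n : SimplexCategory} (t : T.obj (op m))
    (t' : T.obj (op m')) (χ : SSet.stdSimplex.{u}.obj n ⟶ Δ[1]) (l : (fib 0 χ : SSet.{u}) ⟶ M)
    (c : (fib 1 χ : SSet.{u}) ⟶ SSet.stdSimplex.obj m)
    (c' : (fib 1 χ : SSet.{u}) ⟶ SSet.stdSimplex.obj m')
    (h : c ≫ SSet.yonedaEquiv.symm t = c' ≫ SSet.yonedaEquiv.symm t') :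
    leftDivEval φ t ⟨χ, l, c⟩ = leftDivEval φ t' ⟨χ, l, c'⟩ := by
  obtain hχ | ⟨r, hr⟩ := fib_zero_eq_top_or_exists_retraction χ
  · refine (X.existsUnique_of_fib_zero (n := n)
      ((joinMap α (SSet.yonedaEquiv.symm t ≫ β)).app (op n) ⟨χ, l, c⟩) hχ).unique
      (toJoin_leftDivEval φ hφ t _) ((toJoin_leftDivEval φ hφ t' _).trans ?_)
    change (⟨χ, l ≫ α, c' ≫ SSet.yonedaEquiv.symm t' ≫ β⟩ : JoinSimplex A B n) =
      ⟨χ, l ≫ α, c ≫ SSet.yonedaEquiv.symm t ≫ β⟩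
    rw [← reassoc_of% h]
  · have key : ∀ {m : SimplexCategory} (t : T.obj (op m))
        (c : (fib 1 χ : SSet.{u}) ⟶ SSet.stdSimplex.obj m), leftDivEval φ t ⟨χ, l, c⟩ =
          leftDivEval φ (SSet.yonedaEquiv (r ≫ c ≫ SSet.yonedaEquiv.symm t))
            ⟨χ, l, (fib 1 χ).ι⟩ := by
      intro m t c
      obtain ⟨g, hg⟩ := SSet.stdSimplex.{u}.map_surjective (r ≫ c)
      have h₁ : SSet.yonedaEquiv (r ≫ c ≫ SSet.yonedaEquiv.symm t) = T.map g.op t := by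
        rw [← Category.assoc, ← hg, SSet.yonedaEquiv_symm_naturality_left, Equiv.apply_symm_apply]
      rw [h₁, leftDivEval_map]
      change _ = leftDivEval φ t ⟨χ, l, (fib 1 χ).ι ≫ SSet.stdSimplex.map g⟩
      rw [hg, reassoc_of% hr]
    rw [key t c, key t' c', h]

/-- Every map `T ⟶ M \ X` over `B` comes from a map `M ⋆ T ⟶ X` over `A ⋆ B`. -/
lemma exists_toLeftDiv_eq (φ : T ⟶ leftDivObj (Over.mk α) X)
    (hφ : φ ≫ (leftDiv (Over.mk α) X).hom = β) :
    ∃ (σ : join M T ⟶ X.X) (hσ : σ ≫ X.toJoin = joinMap α β), toLeftDiv X α β σ hσ = φ := by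
  -- `P n s x` says that `x` is the value at `s` of the map being constructed. It has exactly one
  -- solution `x`, so that naturality only needs to be checked on `P`.
  let P (n : SimplexCategory) (s : JoinSimplex M T n) (x : X.X.obj (op n)) : Prop :=
    X.toJoin.app (op n) x = (joinMap α β).app (op n) s ∧
      ∀ (m : SimplexCategory) (t : T.obj (op m))
        (c : (fib 1 s.χ : SSet.{u}) ⟶ SSet.stdSimplex.obj m),
          c ≫ SSet.yonedaEquiv.symm t = s.right → x = leftDivEval φ t ⟨s.χ, s.left, c⟩
  have eval : ∀ {m n : SimplexCategory} (s : JoinSimplex M T n) (t : T.obj (op m))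
      (c : (fib 1 s.χ : SSet.{u}) ⟶ SSet.stdSimplex.obj m),
      c ≫ SSet.yonedaEquiv.symm t = s.right → X.toJoin.app (op n)
        (leftDivEval φ t ⟨s.χ, s.left, c⟩) = (joinMap α β).app (op n) s := by
    intro m n s t c hc
    rw [toJoin_leftDivEval φ hφ]
    change (⟨s.χ, s.left ≫ α, c ≫ SSet.yonedaEquiv.symm t ≫ β⟩ : JoinSimplex A B n) =
      ⟨s.χ, s.left ≫ α, s.right ≫ β⟩
    rw [reassoc_of% hc]
  have hP : ∀ (n : SimplexCategory) (s : JoinSimplex M T n), ∃! x, P n s x := by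
    intro n s
    obtain hs | ⟨r, hr⟩ := fib_zero_eq_top_or_exists_retraction s.χ
    · obtain ⟨x, hx, hx'⟩ := X.existsUnique_of_fib_zero (n := n) ((joinMap α β).app (op n) s) hs
      exact ⟨x, ⟨hx, fun m t c hc ↦ (hx' _ (eval s t c hc)).symm⟩, fun y hy ↦ hx' y hy.1⟩
    · have h₁ : (fib 1 s.χ).ι ≫ SSet.yonedaEquiv.symm (SSet.yonedaEquiv (r ≫ s.right)) =
          s.right := by
        rw [Equiv.symm_apply_apply, reassoc_of% hr]
      exact ⟨_, ⟨eval s _ _ h₁, fun m t c hc ↦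
        leftDivEval_congr φ hφ _ _ _ _ _ _ (h₁.trans hc.symm)⟩, fun y hy ↦ hy.2 _ _ _ h₁⟩
  choose Φ hΦ hΦ' using hP
  let σ : join M T ⟶ X.X :=
    { app n := ↾fun s ↦ Φ n.unop s
      naturality := by
        intro n n' f
        ext s
        refine (hΦ' n'.unop _ _ ?_).symm
        refine ⟨?_, fun m t c hc ↦ ?_⟩
        · exact (NatTrans.naturality_apply X.toJoin f (Φ n.unop s)).trans
            (congrArg _ (hΦ n.unop s).1)
        · change (fib 1 (SSet.stdSimplex.map f.unop ≫ s.χ) : SSet.{u}) ⟶ _ at c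
          change X.X.map f (Φ n.unop s) = leftDivEval φ t
            ⟨SSet.stdSimplex.map f.unop ≫ s.χ,
              fibMap 0 (SSet.stdSimplex.map f.unop) s.χ ≫ s.left, c⟩
          change c ≫ _ = fibMap 1 (SSet.stdSimplex.map f.unop) s.χ ≫ s.right at hc
          obtain hs | ⟨r, hr⟩ := fib_zero_eq_top_or_exists_retraction (n := n.unop) s.χ
          · refine (X.existsUnique_of_fib_zero (n := n'.unop)
              ((joinMap α β).app n' ((join M T).map f s))
              (fib_comp_eq_top (SSet.stdSimplex.map f.unop) hs)).unique ?_ ?_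
            · exact (NatTrans.naturality_apply X.toJoin f (Φ n.unop s)).trans
                (congrArg _ (hΦ n.unop s).1)
            · exact eval (n := n'.unop) ((join M T).map f s) t c hc
          · have h₁ : (fib 1 s.χ).ι ≫ SSet.yonedaEquiv.symm (SSet.yonedaEquiv (r ≫ s.right)) =
                s.right := by
              rw [Equiv.symm_apply_apply, reassoc_of% hr]
            rw [(hΦ n.unop s).2 _ _ _ h₁]
            refine (map_leftDivEval φ f.unop _ _).trans (leftDivEval_congr φ hφ _ _ _ _ _ _ ?_)
            rw [hc, Category.assoc, h₁]
            rfl }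
  have hσ : σ ≫ X.toJoin = joinMap α β := by
    refine NatTrans.ext (funext fun n ↦ ?_)
    ext s
    exact (hΦ n.unop s).1
  refine ⟨σ, hσ, ?_⟩
  refine NatTrans.ext (funext fun n ↦ ?_)
  ext t
  refine Subtype.ext (Prod.ext ?_ ?_)
  · exact (ConcreteCategory.congr_hom (congr_app hφ n) t).symm
  · refine NatTrans.ext (funext fun k ↦ ?_)
    ext s
    exact (hΦ k.unop ⟨JoinSimplex.χ s, JoinSimplex.left s,
      JoinSimplex.right s ≫ SSet.yonedaEquiv.symm t⟩).2 n.unop t (JoinSimplex.right s) rfl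

end LeftDivision

/-! ### Maps into a right division -/

section RightDivision

variable {A B : SSet.{u}} (X : Cyl A B) {M T : SSet.{u}} (α : M ⟶ A) (β : T ⟶ B)

/-- The map `M ⟶ X / T` over `A` corresponding to a map `M ⋆ T ⟶ X` over `A ⋆ B`. -/
def toRightDiv (σ : join M T ⟶ X.X) (hσ : σ ≫ X.toJoin = joinMap α β) :
    M ⟶ rightDivObj X (Over.mk β) where
  app n := ↾fun t ↦ ⟨(α.app n t, joinMap (SSet.yonedaEquiv.symm t) (𝟙 _) ≫ σ), by
    rw [Category.assoc, hσ, ← joinMap_comp, Category.id_comp, SSet.yonedaEquiv_symm_comp]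
    rfl⟩
  naturality m n f := by
    ext t
    refine Subtype.ext (Prod.ext ?_ ?_)
    · exact NatTrans.naturality_apply α f t
    · change joinMap (SSet.yonedaEquiv.symm (M.map f.unop.op t)) (𝟙 _) ≫ σ =
        joinMap (SSet.stdSimplex.map f.unop) (𝟙 _) ≫
          joinMap (SSet.yonedaEquiv.symm t) (𝟙 _) ≫ σ
      rw [← SSet.yonedaEquiv_symm_naturality_left, ← Category.assoc, ← joinMap_comp,
        Category.id_comp]

variable {X α β}

lemma comp_toRightDiv {K : SSet.{u}} (i : K ⟶ M) (σ : join M T ⟶ X.X)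
    (hσ : σ ≫ X.toJoin = joinMap α β) :
    i ≫ toRightDiv X α β σ hσ = toRightDiv X (i ≫ α) β (joinMap i (𝟙 T) ≫ σ)
      (by rw [Category.assoc, hσ, ← joinMap_comp, Category.id_comp]) := by
  refine NatTrans.ext (funext fun n ↦ ?_)
  ext t
  refine Subtype.ext (Prod.ext rfl ?_)
  change joinMap (SSet.yonedaEquiv.symm (i.app (op n.unop) t)) (𝟙 _) ≫ σ =
    joinMap (SSet.yonedaEquiv.symm t) (𝟙 _) ≫ joinMap i (𝟙 T) ≫ σ
  rw [← SSet.yonedaEquiv_symm_comp, ← Category.assoc, ← joinMap_comp, Category.id_comp]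

lemma toRightDiv_comp {S : SSet.{u}} (j : S ⟶ T) (σ : join M T ⟶ X.X)
    (hσ : σ ≫ X.toJoin = joinMap α β) :
    toRightDiv X α β σ hσ ≫ (rightDivMap X (Over.homMk j : Over.mk (j ≫ β) ⟶ Over.mk β)).left =
      toRightDiv X α (j ≫ β) (joinMap (𝟙 M) j ≫ σ)
      (by rw [Category.assoc, hσ, ← joinMap_comp, Category.id_comp]) := rfl

lemma toRightDiv_injective {σ σ' : join M T ⟶ X.X} (hσ : σ ≫ X.toJoin = joinMap α β)
    (hσ' : σ' ≫ X.toJoin = joinMap α β) (h : toRightDiv X α β σ hσ = toRightDiv X α β σ' hσ') :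
    σ = σ' := by
  refine NatTrans.ext (funext fun n ↦ ?_)
  ext s
  obtain hs | ⟨r, hr⟩ := fib_one_eq_top_or_exists_retraction (n := n.unop) s.χ
  · exact (X.existsUnique_of_fib_one (n := n.unop) ((joinMap α β).app n s) hs).unique
      (ConcreteCategory.congr_hom (congr_app hσ n) s)
      (ConcreteCategory.congr_hom (congr_app hσ' n) s)
  · let t : M.obj (op n.unop) := SSet.yonedaEquiv (r ≫ s.left)
    have h₁ := congrArg (fun z : (rightDivObj X (Over.mk β)).obj n ↦
      z.1.2.app n ⟨s.χ, (fib 0 s.χ).ι, s.right⟩) (ConcreteCategory.congr_hom (congr_app h n) t)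
    have h₂ : (joinMap (SSet.yonedaEquiv.symm t) (𝟙 T)).app n ⟨s.χ, (fib 0 s.χ).ι, s.right⟩ =
        s := by
      change (⟨s.χ, (fib 0 s.χ).ι ≫ SSet.yonedaEquiv.symm t, s.right⟩ : JoinSimplex _ _ _) = s
      rw [Equiv.symm_apply_apply, reassoc_of% hr]
      rfl
    change σ.app n ((joinMap (SSet.yonedaEquiv.symm t) (𝟙 T)).app n _) =
      σ'.app n ((joinMap (SSet.yonedaEquiv.symm t) (𝟙 T)).app n _) at h₁
    rwa [h₂] at h₁

/-- The value of the map `M ⋆ T ⟶ X` corresponding to `φ : M ⟶ X / T` on the image under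
`t ⋆ T : Δ[m] ⋆ T ⟶ M ⋆ T` of the simplex `s`. -/
def rightDivEval (φ : M ⟶ rightDivObj X (Over.mk β)) {m n : SimplexCategory} (t : M.obj (op m))
    (s : JoinSimplex (SSet.stdSimplex.{u}.obj m) T n) : X.X.obj (op n) :=
  (φ.app (op m) t).1.2.app (op n) s

lemma toJoin_rightDivEval (φ : M ⟶ rightDivObj X (Over.mk β))
    (hφ : φ ≫ (rightDiv X (Over.mk β)).hom = α) {m n : SimplexCategory} (t : M.obj (op m))
    (s : JoinSimplex (SSet.stdSimplex.{u}.obj m) T n) :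
    X.toJoin.app (op n) (rightDivEval φ t s) =
      (joinMap (SSet.yonedaEquiv.symm t ≫ α) β).app (op n) s := by
  have h := ConcreteCategory.congr_hom (congr_app (φ.app (op m) t).2 (op n)) s
  refine h.trans ?_
  rw [SSet.yonedaEquiv_symm_comp, ← hφ]
  rfl

lemma map_rightDivEval (φ : M ⟶ rightDivObj X (Over.mk β)) {m n n' : SimplexCategory} (f : n' ⟶ n)
    (t : M.obj (op m)) (s : JoinSimplex (SSet.stdSimplex.{u}.obj m) T n) :
    X.X.map f.op (rightDivEval φ t s) = rightDivEval φ t ((join _ _).map f.op s) :=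
  (NatTrans.naturality_apply (φ.app (op m) t).1.2 f.op s).symm

lemma rightDivEval_map (φ : M ⟶ rightDivObj X (Over.mk β)) {m m' n : SimplexCategory} (g : m' ⟶ m)
    (t : M.obj (op m)) (s : JoinSimplex (SSet.stdSimplex.{u}.obj m') T n) :
    rightDivEval φ (M.map g.op t) s =
      rightDivEval φ t ((joinMap (SSet.stdSimplex.map g) (𝟙 T)).app (op n) s) := by
  have h := NatTrans.naturality_apply φ g.op t
  exact congrArg (fun z : (rightDivObj X (Over.mk β)).obj (op m') ↦ z.1.2.app (op n) s) h

/-- `rightDivEval` only depends on the simplex of `M ⋆ T`. -/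
lemma rightDivEval_congr (φ : M ⟶ rightDivObj X (Over.mk β))
    (hφ : φ ≫ (rightDiv X (Over.mk β)).hom = α) {m m' n : SimplexCategory} (t : M.obj (op m))
    (t' : M.obj (op m')) (χ : SSet.stdSimplex.{u}.obj n ⟶ Δ[1])
    (c : (fib 0 χ : SSet.{u}) ⟶ SSet.stdSimplex.obj m)
    (c' : (fib 0 χ : SSet.{u}) ⟶ SSet.stdSimplex.obj m') (l : (fib 1 χ : SSet.{u}) ⟶ T)
    (h : c ≫ SSet.yonedaEquiv.symm t = c' ≫ SSet.yonedaEquiv.symm t') :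
    rightDivEval φ t ⟨χ, c, l⟩ = rightDivEval φ t' ⟨χ, c', l⟩ := by
  obtain hχ | ⟨r, hr⟩ := fib_one_eq_top_or_exists_retraction χ
  · refine (X.existsUnique_of_fib_one (n := n)
      ((joinMap (SSet.yonedaEquiv.symm t ≫ α) β).app (op n) ⟨χ, c, l⟩) hχ).unique
      (toJoin_rightDivEval φ hφ t _) ((toJoin_rightDivEval φ hφ t' _).trans ?_)
    change (⟨χ, c' ≫ SSet.yonedaEquiv.symm t' ≫ α, l ≫ β⟩ : JoinSimplex A B n) =
      ⟨χ, c ≫ SSet.yonedaEquiv.symm t ≫ α, l ≫ β⟩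
    rw [← reassoc_of% h]
  · have key : ∀ {m : SimplexCategory} (t : M.obj (op m))
        (c : (fib 0 χ : SSet.{u}) ⟶ SSet.stdSimplex.obj m), rightDivEval φ t ⟨χ, c, l⟩ =
          rightDivEval φ (SSet.yonedaEquiv (r ≫ c ≫ SSet.yonedaEquiv.symm t))
            ⟨χ, (fib 0 χ).ι, l⟩ := by
      intro m t c
      obtain ⟨g, hg⟩ := SSet.stdSimplex.{u}.map_surjective (r ≫ c)
      have h₁ : SSet.yonedaEquiv (r ≫ c ≫ SSet.yonedaEquiv.symm t) = M.map g.op t := by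
        rw [← Category.assoc, ← hg, SSet.yonedaEquiv_symm_naturality_left, Equiv.apply_symm_apply]
      rw [h₁, rightDivEval_map]
      change _ = rightDivEval φ t ⟨χ, (fib 0 χ).ι ≫ SSet.stdSimplex.map g, l⟩
      rw [hg, reassoc_of% hr]
    rw [key t c, key t' c', h]

/-- Every map `M ⟶ X / T` over `A` comes from a map `M ⋆ T ⟶ X` over `A ⋆ B`. -/
lemma exists_toRightDiv_eq (φ : M ⟶ rightDivObj X (Over.mk β))
    (hφ : φ ≫ (rightDiv X (Over.mk β)).hom = α) :
    ∃ (σ : join M T ⟶ X.X) (hσ : σ ≫ X.toJoin = joinMap α β), toRightDiv X α β σ hσ = φ := by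
  -- `P n s x` says that `x` is the value at `s` of the map being constructed. It has exactly one
  -- solution `x`, so that naturality only needs to be checked on `P`.
  let P (n : SimplexCategory) (s : JoinSimplex M T n) (x : X.X.obj (op n)) : Prop :=
    X.toJoin.app (op n) x = (joinMap α β).app (op n) s ∧
      ∀ (m : SimplexCategory) (t : M.obj (op m))
        (c : (fib 0 s.χ : SSet.{u}) ⟶ SSet.stdSimplex.obj m),
          c ≫ SSet.yonedaEquiv.symm t = s.left → x = rightDivEval φ t ⟨s.χ, c, s.right⟩
  have eval : ∀ {m n : SimplexCategory} (s : JoinSimplex M T n) (t : M.obj (op m))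
      (c : (fib 0 s.χ : SSet.{u}) ⟶ SSet.stdSimplex.obj m),
      c ≫ SSet.yonedaEquiv.symm t = s.left → X.toJoin.app (op n)
        (rightDivEval φ t ⟨s.χ, c, s.right⟩) = (joinMap α β).app (op n) s := by
    intro m n s t c hc
    rw [toJoin_rightDivEval φ hφ]
    change (⟨s.χ, c ≫ SSet.yonedaEquiv.symm t ≫ α, s.right ≫ β⟩ : JoinSimplex A B n) =
      ⟨s.χ, s.left ≫ α, s.right ≫ β⟩
    rw [reassoc_of% hc]
  have hP : ∀ (n : SimplexCategory) (s : JoinSimplex M T n), ∃! x, P n s x := by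
    intro n s
    obtain hs | ⟨r, hr⟩ := fib_one_eq_top_or_exists_retraction s.χ
    · obtain ⟨x, hx, hx'⟩ := X.existsUnique_of_fib_one (n := n) ((joinMap α β).app (op n) s) hs
      exact ⟨x, ⟨hx, fun m t c hc ↦ (hx' _ (eval s t c hc)).symm⟩, fun y hy ↦ hx' y hy.1⟩
    · have h₁ : (fib 0 s.χ).ι ≫ SSet.yonedaEquiv.symm (SSet.yonedaEquiv (r ≫ s.left)) =
          s.left := by
        rw [Equiv.symm_apply_apply, reassoc_of% hr]
      exact ⟨_, ⟨eval s _ _ h₁, fun m t c hc ↦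
        rightDivEval_congr φ hφ _ _ _ _ _ _ (h₁.trans hc.symm)⟩, fun y hy ↦ hy.2 _ _ _ h₁⟩
  choose Φ hΦ hΦ' using hP
  let σ : join M T ⟶ X.X :=
    { app n := ↾fun s ↦ Φ n.unop s
      naturality := by
        intro n n' f
        ext s
        refine (hΦ' n'.unop _ _ ?_).symm
        refine ⟨?_, fun m t c hc ↦ ?_⟩
        · exact (NatTrans.naturality_apply X.toJoin f (Φ n.unop s)).trans
            (congrArg _ (hΦ n.unop s).1)
        · change (fib 0 (SSet.stdSimplex.map f.unop ≫ s.χ) : SSet.{u}) ⟶ _ at c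
          change X.X.map f (Φ n.unop s) = rightDivEval φ t
            ⟨SSet.stdSimplex.map f.unop ≫ s.χ, c,
              fibMap 1 (SSet.stdSimplex.map f.unop) s.χ ≫ s.right⟩
          change c ≫ _ = fibMap 0 (SSet.stdSimplex.map f.unop) s.χ ≫ s.left at hc
          obtain hs | ⟨r, hr⟩ := fib_one_eq_top_or_exists_retraction (n := n.unop) s.χ
          · refine (X.existsUnique_of_fib_one (n := n'.unop)
              ((joinMap α β).app n' ((join M T).map f s))
              (fib_comp_eq_top (SSet.stdSimplex.map f.unop) hs)).unique ?_ ?_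
            · exact (NatTrans.naturality_apply X.toJoin f (Φ n.unop s)).trans
                (congrArg _ (hΦ n.unop s).1)
            · exact eval (n := n'.unop) ((join M T).map f s) t c hc
          · have h₁ : (fib 0 s.χ).ι ≫ SSet.yonedaEquiv.symm (SSet.yonedaEquiv (r ≫ s.left)) =
                s.left := by
              rw [Equiv.symm_apply_apply, reassoc_of% hr]
            rw [(hΦ n.unop s).2 _ _ _ h₁]
            refine (map_rightDivEval φ f.unop _ _).trans
              (rightDivEval_congr φ hφ _ _ _ _ _ _ ?_)
            rw [hc, Category.assoc, h₁]
            rfl }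
  have hσ : σ ≫ X.toJoin = joinMap α β := by
    refine NatTrans.ext (funext fun n ↦ ?_)
    ext s
    exact (hΦ n.unop s).1
  refine ⟨σ, hσ, ?_⟩
  refine NatTrans.ext (funext fun n ↦ ?_)
  ext t
  refine Subtype.ext (Prod.ext ?_ ?_)
  · exact (ConcreteCategory.congr_hom (congr_app hφ n) t).symm
  · refine NatTrans.ext (funext fun k ↦ ?_)
    ext s
    exact (hΦ k.unop ⟨JoinSimplex.χ s, JoinSimplex.left s ≫ SSet.yonedaEquiv.symm t,
      JoinSimplex.right s⟩).2 n.unop t (JoinSimplex.left s) rfl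

end RightDivision

/-! ### Lifting against pushout-joins -/

section JoinLift

variable {A B : SSet.{u}}

/-- The lifting property of an `(A, B)`-cylinder `X` against the pushout-join of `i : K ⟶ M` and
`j : S ⟶ T`: for all `α : M ⟶ A` and `β : T ⟶ B`, compatible maps `M ⋆ S ⟶ X` and `K ⋆ T ⟶ X` over
`A ⋆ B` extend to `M ⋆ T`. Spelling out the compatible pair avoids forming the pushout
`M ⋆ S ∪ K ⋆ T`. -/
def Cyl.JoinLift (X : Cyl A B) {K M S T : SSet.{u}} (i : K ⟶ M) (j : S ⟶ T) : Prop :=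
  ∀ (α : M ⟶ A) (β : T ⟶ B) (a : join M S ⟶ X.X) (b : join K T ⟶ X.X),
    a ≫ X.toJoin = joinMap α (j ≫ β) → b ≫ X.toJoin = joinMap (i ≫ α) β →
    joinMap i (𝟙 S) ≫ a = joinMap (𝟙 K) j ≫ b →
    ∃ c : join M T ⟶ X.X, c ≫ X.toJoin = joinMap α β ∧ joinMap (𝟙 M) j ≫ c = a ∧
      joinMap i (𝟙 T) ≫ c = b

variable {X : Cyl A B} {K M S T : SSet.{u}}

lemma toLeftDiv_congr {α : M ⟶ A} {β β' : T ⟶ B} (hβ : β = β') {σ σ' : join M T ⟶ X.X}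
    (h : σ = σ') (hσ : σ ≫ X.toJoin = joinMap α β) (hσ' : σ' ≫ X.toJoin = joinMap α β') :
    toLeftDiv X α β σ hσ = toLeftDiv X α β' σ' hσ' := by
  subst hβ h
  rfl

lemma toRightDiv_congr {α α' : M ⟶ A} {β : T ⟶ B} (hα : α = α') {σ σ' : join M T ⟶ X.X}
    (h : σ = σ') (hσ : σ ≫ X.toJoin = joinMap α β) (hσ' : σ' ≫ X.toJoin = joinMap α' β) :
    toRightDiv X α β σ hσ = toRightDiv X α' β σ' hσ' := by
  subst hα h
  rfl

/-- The lifting property against a pushout-join, transposed to the left divisions. -/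
lemma Cyl.joinLift_iff_leftDiv (i : K ⟶ M) (j : S ⟶ T) :
    X.JoinLift i j ↔ ∀ α : M ⟶ A, HasLiftingProperty j
      (leftDivMap (Over.homMk i : Over.mk (i ≫ α) ⟶ Over.mk α) X).left := by
  constructor
  · intro H α
    refine ⟨fun {f g} sq ↦ ?_⟩
    obtain ⟨β, hβ⟩ : ∃ β, g ≫ (leftDiv (Over.mk (i ≫ α)) X).hom = β := ⟨_, rfl⟩
    have hf : f ≫ (leftDiv (Over.mk α) X).hom = j ≫ β := by
      rw [← hβ, ← sq.w_assoc, Over.w]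
    obtain ⟨a, ha, rfl⟩ := exists_toLeftDiv_eq f hf
    obtain ⟨b, hb, rfl⟩ := exists_toLeftDiv_eq g hβ
    obtain ⟨c, hc, hca, hcb⟩ := H α β a b ha hb (by
      have := sq.w
      erw [toLeftDiv_comp, comp_toLeftDiv] at this
      exact toLeftDiv_injective _ _ this)
    refine ⟨⟨⟨toLeftDiv X α β c hc, ?_, ?_⟩⟩⟩
    · exact (comp_toLeftDiv j c hc).trans (toLeftDiv_congr rfl hca _ _)
    · exact (toLeftDiv_comp i c hc).trans (toLeftDiv_congr rfl hcb _ _)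
  · intro H α β a b ha hb hab
    have := H α
    have sq : CommSq (toLeftDiv X α (j ≫ β) a ha : S ⟶ (leftDiv (Over.mk α) X).left) j
        (leftDivMap (Over.homMk i : Over.mk (i ≫ α) ⟶ Over.mk α) X).left
        (toLeftDiv X (i ≫ α) β b hb) :=
      ⟨(toLeftDiv_comp i a ha).trans ((toLeftDiv_congr rfl hab _ _).trans
        (comp_toLeftDiv j b hb).symm)⟩
    obtain ⟨⟨l⟩⟩ := this.sq_hasLift sq
    obtain ⟨c, hc, hc'⟩ := exists_toLeftDiv_eq (α := α) (β := β) l.l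
      (congrArg (fun t ↦ t ≫ (leftDiv (Over.mk (i ≫ α)) X).hom) l.fac_right)
    refine ⟨c, hc, ?_, ?_⟩
    · have h := l.fac_left
      rw [← hc'] at h
      exact toLeftDiv_injective _ _ ((comp_toLeftDiv j c hc).symm.trans h)
    · have h := l.fac_right
      rw [← hc'] at h
      exact toLeftDiv_injective _ _ ((toLeftDiv_comp i c hc).symm.trans h)

/-- The lifting property against a pushout-join, transposed to the right divisions. -/
lemma Cyl.joinLift_iff_rightDiv (i : K ⟶ M) (j : S ⟶ T) :
    X.JoinLift i j ↔ ∀ β : T ⟶ B, HasLiftingProperty i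
      (rightDivMap X (Over.homMk j : Over.mk (j ≫ β) ⟶ Over.mk β)).left := by
  constructor
  · intro H β
    refine ⟨fun {f g} sq ↦ ?_⟩
    obtain ⟨α, hα⟩ : ∃ α, g ≫ (rightDiv X (Over.mk (j ≫ β))).hom = α := ⟨_, rfl⟩
    have hf : f ≫ (rightDiv X (Over.mk β)).hom = i ≫ α := by
      rw [← hα, ← sq.w_assoc, Over.w]
    obtain ⟨b, hb, rfl⟩ := exists_toRightDiv_eq f hf
    obtain ⟨a, ha, rfl⟩ := exists_toRightDiv_eq g hα
    obtain ⟨c, hc, hca, hcb⟩ := H α β a b ha hb (by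
      have := sq.w
      erw [toRightDiv_comp, comp_toRightDiv] at this
      exact (toRightDiv_injective _ _ this).symm)
    refine ⟨⟨⟨toRightDiv X α β c hc, ?_, ?_⟩⟩⟩
    · exact (comp_toRightDiv i c hc).trans (toRightDiv_congr rfl hcb _ _)
    · exact (toRightDiv_comp j c hc).trans (toRightDiv_congr rfl hca _ _)
  · intro H α β a b ha hb hab
    have := H β
    have sq : CommSq (toRightDiv X (i ≫ α) β b hb : K ⟶ (rightDiv X (Over.mk β)).left) i
        (rightDivMap X (Over.homMk j : Over.mk (j ≫ β) ⟶ Over.mk β)).left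
        (toRightDiv X α (j ≫ β) a ha) :=
      ⟨(toRightDiv_comp j b hb).trans ((toRightDiv_congr rfl hab.symm _ _).trans
        (comp_toRightDiv i a ha).symm)⟩
    obtain ⟨⟨l⟩⟩ := this.sq_hasLift sq
    obtain ⟨c, hc, hc'⟩ := exists_toRightDiv_eq (α := α) (β := β) l.l
      (congrArg (fun t ↦ t ≫ (rightDiv X (Over.mk (j ≫ β))).hom) l.fac_right)
    refine ⟨c, hc, ?_, ?_⟩
    · have h := l.fac_right
      rw [← hc'] at h
      exact toRightDiv_injective _ _ ((toRightDiv_comp j c hc).symm.trans h)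
    · have h := l.fac_left
      rw [← hc'] at h
      exact toRightDiv_injective _ _ ((comp_toRightDiv i c hc).symm.trans h)

lemma Cyl.JoinLift.of_arrow_iso_right {S' T' : SSet.{u}} {i : K ⟶ M} {j : S ⟶ T} {j' : S' ⟶ T'}
    (e : Arrow.mk j ≅ Arrow.mk j') (h : X.JoinLift i j) : X.JoinLift i j' := by
  rw [joinLift_iff_leftDiv] at h ⊢
  intro α
  exact (HasLiftingProperty.iff_of_arrow_iso_left e _).1 (h α)

lemma Cyl.JoinLift.of_arrow_iso_left {K' M' : SSet.{u}} {i : K ⟶ M} {i' : K' ⟶ M'} {j : S ⟶ T}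
    (e : Arrow.mk i ≅ Arrow.mk i') (h : X.JoinLift i j) : X.JoinLift i' j := by
  rw [joinLift_iff_rightDiv] at h ⊢
  intro β
  exact (HasLiftingProperty.iff_of_arrow_iso_left e _).1 (h β)

lemma Cyl.verticallyReedyLeftFibrant_iff :
    X.VerticallyReedyLeftFibrant ↔ ∀ (m n : ℕ) (k : Fin (n + 2)), k < Fin.last (n + 1) →
      X.JoinLift (∂Δ[m] : SSet.Subcomplex.{u} _).ι (Λ[n + 1, k] : SSet.Subcomplex.{u} _).ι := by
  simp only [joinLift_iff_leftDiv]
  constructor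
  · intro h m n k hk α
    exact h m α _ (.intro k hk)
  · rintro h m α _ _ _ ⟨k, hk⟩
    exact h m _ k hk α

lemma Cyl.horizontallyReedyRightFibrant_iff :
    X.HorizontallyReedyRightFibrant ↔ ∀ (n m : ℕ) (k : Fin (m + 2)), 0 < k →
      X.JoinLift (Λ[m + 1, k] : SSet.Subcomplex.{u} _).ι (∂Δ[n] : SSet.Subcomplex.{u} _).ι := by
  simp only [joinLift_iff_rightDiv]
  constructor
  · intro h n m k hk β
    exact h n β _ (.intro k hk)
  · rintro h n β _ _ _ ⟨k, hk⟩
    exact h n _ k hk β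

end JoinLift

/-! ### Left division by monomorphisms -/

section Division

variable {A B : SSet.{u}} (X : Cyl A B)

/-- Over a simplicial set `T ≅ ∅ ⋆ T`, the map `X ⟶ A ⋆ B` has exactly one lift. -/
lemma Cyl.existsUnique_of_isEmpty {K T : SSet.{u}} (hK : ∀ k, IsEmpty (K.obj k)) (α : K ⟶ A)
    (β : T ⟶ B) : ∃! b : join K T ⟶ X.X, b ≫ X.toJoin = joinMap α β := by
  have top : ∀ {n : SimplexCategory} (s : JoinSimplex K T n), fib 1 s.χ = ⊤ := by
    intro n s
    obtain h | ⟨r, -⟩ := fib_one_eq_top_or_exists_retraction s.χ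
    · exact h
    · exact ((hK _).false ((r ≫ s.left).app (op n) (SSet.yonedaEquiv (𝟙 _)))).elim
  have H : ∀ (n : SimplexCategory) (s : JoinSimplex K T n), ∃! x : X.X.obj (op n),
      X.toJoin.app (op n) x = (joinMap α β).app (op n) s :=
    fun n s ↦ X.existsUnique_of_fib_one (n := n) ((joinMap α β).app (op n) s) (top s)
  choose Φ hΦ hΦ' using H
  refine ⟨{ app n := ↾fun s ↦ Φ n.unop s
            naturality := ?_ }, ?_, fun c hc ↦ ?_⟩
  · intro n n' f
    ext s
    exact (hΦ' n'.unop ((join K T).map f s) _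
      ((NatTrans.naturality_apply X.toJoin f (Φ n.unop s)).trans
        (congrArg _ (hΦ n.unop s)))).symm
  · refine NatTrans.ext (funext fun n ↦ ?_)
    ext s
    exact hΦ n.unop s
  · refine NatTrans.ext (funext fun n ↦ ?_)
    ext s
    exact hΦ' n.unop s _ (ConcreteCategory.congr_hom (congr_app hc n) s)

variable {X}

/-- Vertical Reedy left fibrancy gives lifts against all monomorphisms, since
`X / Δ[n] ⟶ X / Λ[n, k]` is a trivial fibration for `k < n`. -/
lemma Cyl.VerticallyReedyLeftFibrant.joinLift (hX : X.VerticallyReedyLeftFibrant) {K M : SSet.{u}}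
    (i : K ⟶ M) [Mono i] {n : ℕ} (k : Fin (n + 2)) (hk : k < Fin.last (n + 1)) :
    X.JoinLift i (Λ[n + 1, k] : SSet.Subcomplex.{u} _).ι := by
  rw [joinLift_iff_rightDiv]
  intro β
  suffices (MorphismProperty.monomorphisms _).rlp
    (rightDivMap X (Over.homMk (Λ[n + 1, k] : SSet.Subcomplex.{u} _).ι :
      Over.mk ((Λ[n + 1, k] : SSet.Subcomplex.{u} _).ι ≫ β) ⟶ Over.mk β)).left from
    this _ inferInstance
  rw [SSet.rlp_monomorphisms]
  rintro _ _ _ ⟨m⟩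
  exact joinLift_iff_rightDiv _ _ |>.1 (verticallyReedyLeftFibrant_iff.1 hX m n k hk) β

lemma Cyl.VerticallyReedyLeftFibrant.leftFibrations_leftDivMap (hX : X.VerticallyReedyLeftFibrant)
    {K M : SSet.{u}} (i : K ⟶ M) [Mono i] (α : M ⟶ A) :
    leftFibrations (leftDivMap (Over.homMk i : Over.mk (i ≫ α) ⟶ Over.mk α) X).left := by
  rintro _ _ _ ⟨k, hk⟩
  exact joinLift_iff_leftDiv _ _ |>.1 (hX.joinLift i k hk) α

/-- The map `M \ X ⟶ B` is a left fibration: it is the map `M \ X ⟶ ∅ \ X` up to the isomorphism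
`∅ \ X ≅ B`. -/
lemma Cyl.VerticallyReedyLeftFibrant.leftFibrations_leftDiv (hX : X.VerticallyReedyLeftFibrant)
    {M : SSet.{u}} (α : M ⟶ A) : leftFibrations (leftDiv (Over.mk α) X).hom := by
  suffices ∀ {n : ℕ} (k : Fin (n + 2)), k < Fin.last (n + 1) → HasLiftingProperty
      (Λ[n + 1, k] : SSet.Subcomplex.{u} _).ι (leftDiv (Over.mk α) X).hom by
    rintro _ _ _ ⟨k, hk⟩
    exact this k hk
  intro n k hk
  refine ⟨fun {f β} sq ↦ ?_⟩
  obtain ⟨a, ha, rfl⟩ := exists_toLeftDiv_eq f sq.w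
  let i := (⊥ : M.Subcomplex).ι
  have hi : ∀ k, IsEmpty ((⊥ : M.Subcomplex).toSSet.obj k) := fun k ↦ ⟨fun x ↦ x.2.elim⟩
  obtain ⟨b, hb, -⟩ := X.existsUnique_of_isEmpty hi (i ≫ α) β
  obtain ⟨c, hc, hca, -⟩ := hX.joinLift i k hk α β a b ha hb
    ((X.existsUnique_of_isEmpty hi (i ≫ α) (_ ≫ β)).unique (by
      rw [Category.assoc, ha, ← joinMap_comp, Category.id_comp]) (by
      rw [Category.assoc, hb, ← joinMap_comp, Category.id_comp]))
  exact ⟨⟨⟨toLeftDiv X α β c hc, (comp_toLeftDiv _ c hc).trans (toLeftDiv_congr rfl hca _ _),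
    toLeftDiv_hom c hc⟩⟩⟩

variable (X)

/-- The maps `i : K ⟶ M` such that `M \ X ⟶ K \ X` is a trivial fibration for every `M ⟶ A`.
By adjunction, these are the maps with the left lifting property against
`X / Δ[n] ⟶ X / ∂Δ[n]` for every simplex of `B`. -/
def Cyl.leftTrivial : MorphismProperty SSet.{u} :=
  (MorphismProperty.ofHoms fun (s : Σ n : ℕ, Δ[n] ⟶ B) ↦
    (rightDivMap X (simplexOverMap ∂Δ[s.1].ι s.2)).left).llp

variable {X}

lemma Cyl.leftTrivial_iff_joinLift {K M : SSet.{u}} (i : K ⟶ M) :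
    X.leftTrivial i ↔ ∀ n, X.JoinLift i (∂Δ[n] : SSet.Subcomplex.{u} _).ι := by
  simp only [joinLift_iff_rightDiv]
  constructor
  · intro h n β
    exact h _ (.mk (⟨n, β⟩ : Σ n : ℕ, Δ[n] ⟶ B))
  · rintro h _ _ _ ⟨n, β⟩
    exact h n β

/-- The description of `X.leftTrivial` in terms of left divisions. -/
lemma Cyl.leftTrivial_iff_rlp {K M : SSet.{u}} (i : K ⟶ M) :
    X.leftTrivial i ↔ ∀ α : M ⟶ A, SSet.modelCategoryQuillen.I.rlp
      (leftDivMap (Over.homMk i : Over.mk (i ≫ α) ⟶ Over.mk α) X).left := by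
  rw [leftTrivial_iff_joinLift]
  simp only [joinLift_iff_leftDiv]
  constructor
  · rintro h α _ _ _ ⟨n⟩
    exact h n α
  · intro h n α
    exact h α _ (SSet.modelCategoryQuillen.boundary_ι_mem_I n)

lemma Cyl.horizontallyReedyRightFibrant_iff_leftTrivial :
    X.HorizontallyReedyRightFibrant ↔ rightHornInclusions ≤ X.leftTrivial := by
  rw [horizontallyReedyRightFibrant_iff]
  constructor
  · rintro h _ _ _ ⟨k, hk⟩
    rw [leftTrivial_iff_joinLift]
    exact fun n ↦ h n _ k hk
  · intro h n m k hk
    exact (leftTrivial_iff_joinLift _).1 (h _ (.intro k hk)) n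

/-- Right cancellation, from the 2-out-of-3 property of covariant equivalences. -/
lemma Cyl.VerticallyReedyLeftFibrant.leftTrivial_of_precomp (hX : X.VerticallyReedyLeftFibrant)
    {K L M : SSet.{u}} (i : K ⟶ L) (j : L ⟶ M) [Mono j] (hi : X.leftTrivial i)
    (hij : X.leftTrivial (i ≫ j)) : X.leftTrivial j := by
  rw [leftTrivial_iff_rlp] at hi hij ⊢
  intro α
  refine IsCovariantEquivalence.rlp ?_ (hX.leftFibrations_leftDiv α)
    (hX.leftFibrations_leftDiv _) (hX.leftFibrations_leftDivMap j α)
  exact IsCovariantEquivalence.of_comp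
    (isCovariantEquivalence_of_rlp _ (hi (j ≫ α))) (isCovariantEquivalence_of_rlp _ (hij α))

lemma finalVertex_zero : finalVertex.{u} 0 = 𝟙 _ :=
  SSet.stdSimplex.isTerminalObj₀.hom_ext _ _

instance (m : ℕ) : Mono (finalVertex.{u} m) :=
  (SSet.stdSimplex.isTerminalObj₀.isSplitMono_from _).mono

lemma Cyl.VerticallyReedyLeftFibrant.verticallyRightLocal_iff (hX : X.VerticallyReedyLeftFibrant) :
    X.VerticallyRightLocal ↔ ∀ m, X.leftTrivial (finalVertex m) := by
  constructor
  · rintro h (_ | m)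
    · rw [finalVertex_zero]
      exact MorphismProperty.id_mem (W := (MorphismProperty.llp _)) _
    · rw [leftTrivial_iff_rlp]
      intro α
      exact (h (m + 1) (by lia) α).rlp (hX.leftFibrations_leftDiv α)
        (hX.leftFibrations_leftDiv _) (hX.leftFibrations_leftDivMap _ α)
  · intro h m _ α
    exact isCovariantEquivalence_of_rlp _ ((leftTrivial_iff_rlp _).1 (h m) α)

end Division

/-! ### Unions of facets of a face -/

section Faces

lemma subcomplex_stdSimplex_ext {m : ℕ} {P Q : (Δ[m] : SSet.{u}).Subcomplex}
    (h : ∀ (d : ℕ) (x : (Δ[m] : SSet.{u}) _⦋d⦌), x ∈ P.obj (op ⦋d⦌) ↔ x ∈ Q.obj (op ⦋d⦌)) :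
    P = Q := by
  refine le_antisymm (fun k x hx ↦ ?_) (fun k x hx ↦ ?_)
  · exact (h k.unop.len x).1 hx
  · exact (h k.unop.len x).2 hx

variable {m : ℕ}

/-- The union of the facets of the face `V` of `Δ[m]` opposite to the vertices `j ∈ S`. For
`S = V` this is the boundary of `V`, and for `S = V \ {k}` the horn of `V` at `k`. -/
def facets (V S : Finset (Fin (m + 1))) : (Δ[m] : SSet.{u}).Subcomplex :=
  ⨆ j : S, SSet.stdSimplex.face (V.erase j)

lemma mem_facets_iff (V S : Finset (Fin (m + 1))) {d : ℕ} (x : (Δ[m] : SSet.{u}) _⦋d⦌) :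
    x ∈ (facets V S).obj (op ⦋d⦌) ↔ ∃ j ∈ S, ∀ i, x i ∈ V.erase j := by
  rw [facets, Subfunctor.iSup_obj, Set.mem_iUnion]
  simp only [SSet.stdSimplex.mem_face_iff, Subtype.exists, exists_prop]

lemma facets_le_face (V S : Finset (Fin (m + 1))) :
    facets.{u} V S ≤ SSet.stdSimplex.face V :=
  iSup_le fun _ ↦ (SSet.stdSimplex.face_le_face_iff _ _).2 (Finset.erase_subset _ _)

lemma facets_singleton (V : Finset (Fin (m + 1))) (j : Fin (m + 1)) :
    facets.{u} V {j} = SSet.stdSimplex.face (V.erase j) :=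
  subcomplex_stdSimplex_ext fun d x ↦ by
    rw [mem_facets_iff, SSet.stdSimplex.mem_face_iff]
    simp

/-- Adding the facet opposite to `k` to `facets V S` glues the face `V.erase k` along its
subcomplex `facets (V.erase k) S`. -/
lemma facets_bicartSq (V S : Finset (Fin (m + 1))) (k : Fin (m + 1)) :
    SSet.Subcomplex.BicartSq (facets.{u} (V.erase k) S) (SSet.stdSimplex.face (V.erase k))
      (facets V S) (facets V (insert k S)) where
  sup_eq := subcomplex_stdSimplex_ext fun d x ↦ by
    change x ∈ _ ∪ _ ↔ _
    rw [Set.mem_union, mem_facets_iff, mem_facets_iff, SSet.stdSimplex.mem_face_iff]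
    simp
  inf_eq := subcomplex_stdSimplex_ext fun d x ↦ by
    change x ∈ _ ∩ _ ↔ _
    rw [Set.mem_inter_iff, mem_facets_iff, mem_facets_iff, SSet.stdSimplex.mem_face_iff]
    simp only [Finset.mem_erase]
    exact ⟨fun ⟨h, j, hj, h'⟩ ↦ ⟨j, hj, fun i ↦ ⟨(h' i).1, h i⟩⟩,
      fun ⟨j, hj, h⟩ ↦ ⟨fun i ↦ (h i).2, j, hj, fun i ↦ ⟨(h i).1, (h i).2.2⟩⟩⟩

/-- The inclusion of the face `V` of `Δ[m]`, as a map `Δ[n] ⟶ Δ[m]`, given an enumeration of `V`. -/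
def faceMap {n : ℕ} {V : Finset (Fin (m + 1))} (e : Fin (n + 1) ≃o V) :
    (Δ[n] : SSet.{u}) ⟶ Δ[m] :=
  SSet.stdSimplex.map (SimplexCategory.Hom.mk ⟨fun i ↦ e i, fun _ _ h ↦ e.monotone h⟩)

lemma faceMap_app_apply {n : ℕ} {V : Finset (Fin (m + 1))} (e : Fin (n + 1) ≃o V) {d : ℕ}
    (y : (Δ[n] : SSet.{u}) _⦋d⦌) (i : Fin (d + 1)) :
    ((faceMap e).app (op ⦋d⦌) y : (Δ[m] : SSet.{u}) _⦋d⦌) i = e (y i) := rfl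

lemma faceMap_injective {n : ℕ} {V : Finset (Fin (m + 1))} (e : Fin (n + 1) ≃o V)
    (k : SimplexCategoryᵒᵖ) : Function.Injective ((faceMap.{u} e).app k) := by
  induction k using Opposite.rec with | _ k
  induction k using SimplexCategory.rec with | _ k
  intro x y h
  refine SSet.stdSimplex.ext _ _ fun i ↦ ?_
  have := DFunLike.congr_fun h i
  rw [faceMap_app_apply, faceMap_app_apply] at this
  exact e.injective (Subtype.ext this)

lemma range_faceMap {n : ℕ} {V : Finset (Fin (m + 1))} (e : Fin (n + 1) ≃o V) :
    SSet.Subcomplex.range (faceMap.{u} e) = SSet.stdSimplex.face V := by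
  refine subcomplex_stdSimplex_ext fun d x ↦ ?_
  rw [SSet.stdSimplex.mem_face_iff]
  constructor
  · rintro ⟨y, rfl⟩ i
    rw [faceMap_app_apply]
    exact (e (y i)).2
  · intro h
    refine ⟨SSet.stdSimplex.objMk ⟨fun i ↦ e.symm ⟨x i, h i⟩,
      fun i j hij ↦ e.symm.monotone (SSet.stdSimplex.monotone_apply x hij)⟩, ?_⟩
    refine SSet.stdSimplex.ext _ _ fun i ↦ ?_
    rw [faceMap_app_apply]
    exact congrArg Subtype.val (e.apply_symm_apply ⟨x i, h i⟩)

lemma isIso_of_bijective {Y Z : SSet.{u}} (f : Y ⟶ Z)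
    (h : ∀ k, Function.Bijective (f.app k)) : IsIso f := by
  rw [NatTrans.isIso_iff_isIso_app]
  intro k
  rw [isIso_iff_bijective]
  exact h k

/-- The inclusion of a subcomplex of a face, seen in the standard simplex of its dimension. -/
def preimageFaceMapIso {n : ℕ} {V : Finset (Fin (m + 1))} (e : Fin (n + 1) ≃o V)
    {P : (Δ[m] : SSet.{u}).Subcomplex} (hP : P ≤ SSet.stdSimplex.face V) :
    Arrow.mk (P.preimage (faceMap e)).ι ≅ Arrow.mk (SSet.Subcomplex.homOfLE hP) := by
  let f : (Δ[n] : SSet.{u}) ⟶ (SSet.stdSimplex.face V : SSet.{u}) :=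
    SSet.Subcomplex.lift (faceMap e) (range_faceMap e).le
  have hf : IsIso f := isIso_of_bijective _ fun k ↦
    ⟨fun x y h ↦ faceMap_injective e k (congrArg Subtype.val h), fun ⟨y, hy⟩ ↦ by
      obtain ⟨x, rfl⟩ := (range_faceMap e).ge _ hy
      exact ⟨x, rfl⟩⟩
  have hg : IsIso (P.fromPreimage (faceMap e)) := isIso_of_bijective _ fun k ↦
    ⟨fun x y h ↦ Subtype.ext (faceMap_injective e k (congrArg Subtype.val h)), fun ⟨y, hy⟩ ↦ by
      obtain ⟨x, rfl⟩ := (range_faceMap e).ge _ (hP _ hy)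
      exact ⟨⟨x, hy⟩, rfl⟩⟩
  exact Arrow.isoMk (asIso (P.fromPreimage (faceMap e))) (asIso f) rfl

lemma preimage_faceMap_facets_erase {n : ℕ} {V : Finset (Fin (m + 1))} (e : Fin (n + 1) ≃o V)
    (k : Fin (n + 1)) : (facets.{u} V (V.erase (e k))).preimage (faceMap e) = Λ[n, k] := by
  refine subcomplex_stdSimplex_ext fun d x ↦ ?_
  rw [SSet.mem_horn_iff_notMem_range]
  refine (mem_facets_iff _ _ _).trans ⟨?_, ?_⟩
  · rintro ⟨j, hj, h⟩
    rw [Finset.mem_erase] at hj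
    refine ⟨e.symm ⟨j, hj.2⟩, ?_, ?_⟩
    · intro h
      exact hj.1 (congrArg Subtype.val (e.symm_apply_eq.1 h))
    · rintro ⟨i, hi⟩
      have := h i
      rw [faceMap_app_apply, hi] at this
      simp at this
  · rintro ⟨j, hj, h⟩
    refine ⟨e j, ?_, fun i ↦ ?_⟩
    · simpa [Finset.mem_erase, Subtype.ext_iff] using hj
    · rw [faceMap_app_apply, Finset.mem_erase]
      refine ⟨fun hi ↦ h ⟨i, e.injective (Subtype.ext hi)⟩, (e (x i)).2⟩

lemma preimage_faceMap_facets_self {n : ℕ} {V : Finset (Fin (m + 1))} (e : Fin (n + 1) ≃o V) :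
    (facets.{u} V V).preimage (faceMap e) = ∂Δ[n] := by
  refine subcomplex_stdSimplex_ext fun d x ↦ ?_
  rw [SSet.mem_boundary_iff_notMem_range]
  refine (mem_facets_iff _ _ _).trans ⟨?_, ?_⟩
  · rintro ⟨j, hj, h⟩
    refine ⟨e.symm ⟨j, hj⟩, ?_⟩
    rintro ⟨i, hi⟩
    have := h i
    rw [faceMap_app_apply, hi] at this
    simp at this
  · rintro ⟨j, h⟩
    refine ⟨e j, (e j).2, fun i ↦ ?_⟩
    rw [faceMap_app_apply, Finset.mem_erase]
    refine ⟨fun hi ↦ h ⟨i, e.injective (Subtype.ext hi)⟩, (e (x i)).2⟩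

/-- The horn of the face `V` at its vertex `e k`. -/
def facetsHornIso {n : ℕ} {V : Finset (Fin (m + 1))} (e : Fin (n + 1) ≃o V) (k : Fin (n + 1)) :
    Arrow.mk (Λ[n, k] : SSet.Subcomplex.{u} _).ι ≅
      Arrow.mk (SSet.Subcomplex.homOfLE (facets_le_face.{u} V (V.erase (e k)))) :=
  eqToIso (by rw [preimage_faceMap_facets_erase]) ≪≫ preimageFaceMapIso e (facets_le_face _ _)

/-- The boundary of the face `V`. -/
def facetsBoundaryIso {n : ℕ} {V : Finset (Fin (m + 1))} (e : Fin (n + 1) ≃o V) :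
    Arrow.mk (∂Δ[n] : SSet.Subcomplex.{u} _).ι ≅
      Arrow.mk (SSet.Subcomplex.homOfLE (facets_le_face.{u} V V)) :=
  eqToIso (by rw [preimage_faceMap_facets_self]) ≪≫ preimageFaceMapIso e (facets_le_face _ _)

lemma range_finalVertex (n : ℕ) :
    SSet.Subcomplex.range (finalVertex.{u} n) = SSet.stdSimplex.face {Fin.last n} := by
  refine subcomplex_stdSimplex_ext fun d x ↦ ?_
  rw [SSet.stdSimplex.mem_face_iff]
  constructor
  · rintro ⟨y, rfl⟩ i
    exact Finset.mem_singleton.2 rfl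
  · intro h
    refine ⟨SSet.stdSimplex.objMk ⟨fun _ ↦ 0, fun _ _ _ ↦ le_rfl⟩, ?_⟩
    refine SSet.stdSimplex.ext _ _ fun i ↦ ?_
    exact (Finset.mem_singleton.1 (h i)).symm

/-- The final vertex of the face `V`. -/
def finalVertexFaceIso {n : ℕ} {V : Finset (Fin (m + 1))} (e : Fin (n + 1) ≃o V) :
    Arrow.mk (finalVertex.{u} n) ≅ Arrow.mk (SSet.Subcomplex.homOfLE
      ((SSet.stdSimplex.face_le_face_iff.{u} _ _).2
        (Finset.singleton_subset_iff.2 (e (Fin.last n)).2))) := by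
  refine Arrow.isoMk (g := Arrow.mk (SSet.Subcomplex.range (finalVertex n)).ι)
    (asIso (SSet.Subcomplex.toRange (finalVertex n))) (Iso.refl _) rfl ≪≫
    eqToIso ?_ ≪≫ preimageFaceMapIso e _
  have : SSet.Subcomplex.range (finalVertex.{u} n) =
      (SSet.stdSimplex.face {(e (Fin.last n)).1}).preimage (faceMap e) := by
    rw [range_finalVertex]
    refine subcomplex_stdSimplex_ext fun d x ↦ ?_
    rw [SSet.stdSimplex.mem_face_iff]
    refine Iff.trans ?_ (SSet.stdSimplex.mem_face_iff _ _).symm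
    refine forall_congr' fun i ↦ ?_
    rw [faceMap_app_apply, Finset.mem_singleton, Finset.mem_singleton, ← Subtype.ext_iff,
      e.injective.eq_iff]
  rw [this]

end Faces

/-! ### Right horns and final vertices -/

section Generation

lemma homOfLE_mem_of_eq {W : MorphismProperty SSet.{u}} [W.ContainsIdentities] {Y : SSet.{u}}
    {P Q : Y.Subcomplex} (h : P = Q) :
    W (SSet.Subcomplex.homOfLE h.le) := by
  subst h
  exact W.id_mem _

/-- The vertices of `Δ[n]`, as an enumeration of `Finset.univ`. -/
def univOrderIso (n : ℕ) : Fin (n + 1) ≃o (Finset.univ : Finset (Fin (n + 1))) :=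
  Finset.orderIsoOfFin _ (Finset.card_fin _)

variable {W : MorphismProperty SSet.{u}} [W.IsStableUnderCobaseChange] {m : ℕ}

lemma facets_insert_mem {V S : Finset (Fin (m + 1))} {k : Fin (m + 1)}
    (h : W (SSet.Subcomplex.homOfLE (facets_le_face.{u} (V.erase k) S))) :
    W (SSet.Subcomplex.homOfLE (facets_bicartSq.{u} V S k).le₃₄) :=
  W.of_isPushout (facets_bicartSq V S k).isPushout.flip h

lemma finalVertexFace_mem_of_finalVertex_mem (hW : ∀ n, W (finalVertex n))
    (V : Finset (Fin (m + 1))) (v : Fin (m + 1)) (hv : v ∈ V) (hV : ∀ i ∈ V, i ≤ v) :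
    W (SSet.Subcomplex.homOfLE ((SSet.stdSimplex.face_le_face_iff.{u} {v} V).2
      (Finset.singleton_subset_iff.2 hv))) := by
  obtain ⟨n, hn⟩ : ∃ n, V.card = n + 1 := by
    have := Finset.card_pos.2 ⟨v, hv⟩
    exact ⟨V.card - 1, by lia⟩
  let e := V.orderIsoOfFin hn
  have hev : (e (Fin.last n)).1 = v := by
    refine le_antisymm (hV _ (e _).2) ?_
    obtain ⟨j, hj⟩ := e.surjective ⟨v, hv⟩
    obtain rfl : (e j).1 = v := congrArg Subtype.val hj
    exact e.monotone (Fin.le_last j)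
  subst hev
  exact (W.arrow_mk_iso_iff (finalVertexFaceIso e)).1 (hW n)

variable [W.IsMultiplicative]

/-- A class of maps containing the right horn inclusions and stable under pushouts and composition
contains the generalized right horns `facets V S ⟶ face V`. -/
lemma facets_mem_of_rightHornInclusions_le (hW : rightHornInclusions ≤ W)
    (V S : Finset (Fin (m + 1))) (hSV : S ⊆ V)
    (h : ∃ i ∈ S, ∃ k ∈ V, k ∉ S ∧ i < k) :
    W (SSet.Subcomplex.homOfLE (facets_le_face.{u} V S)) := by
  obtain ⟨i, hi, k, hk, hkS, hik⟩ := h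
  -- as long as `V \ S` contains a vertex `k' ≠ k`, add the facet opposite to `k'`
  by_cases h' : ∃ k' ∈ V, k' ∉ S ∧ k' ≠ k
  · obtain ⟨k', hk', hkS', hkk'⟩ := h'
    have h₁ := facets_mem_of_rightHornInclusions_le hW (V.erase k') S
      (fun x hx ↦ Finset.mem_erase.2 ⟨by rintro rfl; exact hkS' hx, hSV hx⟩)
      ⟨i, hi, k, Finset.mem_erase.2 ⟨hkk'.symm, hk⟩, hkS, hik⟩
    have h₂ := facets_mem_of_rightHornInclusions_le hW V (insert k' S)
      (Finset.insert_subset hk' hSV) ⟨i, Finset.mem_insert_of_mem hi, k, hk,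
        by simp [hkS, hkk'.symm], hik⟩
    exact W.comp_mem _ _ (facets_insert_mem h₁) h₂
  -- otherwise `facets V S` is the horn of `V` at `k`, which is not the first vertex of `V`
  · push Not at h'
    obtain rfl : S = V.erase k := by
      ext x
      rw [Finset.mem_erase]
      refine ⟨fun hx ↦ ⟨by rintro rfl; exact hkS hx, hSV hx⟩, fun hx ↦ ?_⟩
      by_contra hxS
      exact hx.1 (h' x hx.2 hxS)
    obtain ⟨n, hn⟩ : ∃ n, V.card = n + 1 + 1 := by
      have := Finset.one_lt_card.2 ⟨i, hSV hi, k, hk, hik.ne⟩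
      exact ⟨V.card - 2, by lia⟩
    let e := V.orderIsoOfFin hn
    obtain ⟨k', hk'⟩ := e.surjective ⟨k, hk⟩
    have hk₀ : 0 < k' := by
      refine lt_of_le_of_lt (Fin.zero_le (e.symm ⟨i, hSV hi⟩)) ?_
      rw [OrderIso.symm_apply_lt, hk']
      exact hik
    obtain rfl : (e k').1 = k := congrArg Subtype.val hk'
    exact (W.arrow_mk_iso_iff (facetsHornIso e k')).1 (hW _ (.intro k' hk₀))
termination_by V.card + (V \ S).card
decreasing_by
  · have h₁ := Finset.card_erase_lt_of_mem hk'
    have h₂ : ((V.erase k') \ S).card ≤ (V \ S).card :=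
      Finset.card_le_card (Finset.sdiff_subset_sdiff (Finset.erase_subset _ _) subset_rfl)
    lia
  · have h₁ : (V \ insert k' S).card < (V \ S).card := by
      refine Finset.card_lt_card ⟨Finset.sdiff_subset_sdiff subset_rfl (Finset.subset_insert _ _),
        fun h ↦ ?_⟩
      have := h (Finset.mem_sdiff.2 ⟨hk', hkS'⟩)
      simp at this
    lia

/-- Remove the vertices of `V` other than the final one `v`, one at a time: for such a vertex `d`,
the facet of `V` opposite to `d` is the generalized right horn `facets V {d}` and contains `v`. -/
lemma finalVertexFace_mem_of_rightHornInclusions_le (hW : rightHornInclusions ≤ W)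
    (V : Finset (Fin (m + 1))) (v : Fin (m + 1)) (hv : v ∈ V) (hV : ∀ i ∈ V, i ≤ v) :
    W (SSet.Subcomplex.homOfLE ((SSet.stdSimplex.face_le_face_iff.{u} {v} V).2
      (Finset.singleton_subset_iff.2 hv))) := by
  by_cases h : ∃ d ∈ V, d ≠ v
  · obtain ⟨d, hd, hdv⟩ := h
    have hv' : v ∈ V.erase d := Finset.mem_erase.2 ⟨hdv.symm, hv⟩
    have h₁ := finalVertexFace_mem_of_rightHornInclusions_le hW (V.erase d) v hv'
      (fun i hi ↦ hV i (Finset.mem_of_mem_erase hi))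
    have h₂ := facets_mem_of_rightHornInclusions_le hW V {d} (Finset.singleton_subset_iff.2 hd)
      ⟨d, Finset.mem_singleton_self d, v, hv, by simpa using hdv.symm, lt_of_le_of_ne (hV d hd) hdv⟩
    have h₃ : W (SSet.Subcomplex.homOfLE (facets_singleton.{u} V d).ge) :=
      homOfLE_mem_of_eq (facets_singleton V d).symm
    exact W.comp_mem _ _ h₁ (W.comp_mem _ _ h₃ h₂)
  · push Not at h
    obtain rfl : V = {v} := Finset.eq_singleton_iff_unique_mem.2 ⟨hv, h⟩
    exact W.id_mem _
termination_by V.card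
decreasing_by exact Finset.card_erase_lt_of_mem hd

lemma finalVertex_mem_of_rightHornInclusions_le (hW : rightHornInclusions ≤ W) (n : ℕ) :
    W (finalVertex n) := by
  let e := univOrderIso n
  exact (W.arrow_mk_iso_iff (finalVertexFaceIso e)).2
    (finalVertexFace_mem_of_rightHornInclusions_le hW _ _ (e (Fin.last n)).2 fun i hi ↦ by
      obtain ⟨j, hj⟩ := e.surjective ⟨i, hi⟩
      obtain rfl : (e j).1 = i := congrArg Subtype.val hj
      exact e.monotone (Fin.le_last j))

/-- A class of maps containing the inclusions of final vertices, stable under pushouts and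
composition and with right cancellation among monomorphisms contains the generalized right horns
`facets V S ⟶ face V`. -/
lemma facets_mem_of_finalVertex_mem
    (hc : ∀ {K L M : SSet.{u}} (i : K ⟶ L) (j : L ⟶ M) [Mono j], W i → W (i ≫ j) → W j)
    (hW : ∀ n, W (finalVertex n)) (V S : Finset (Fin (m + 1))) (hSV : S ⊆ V)
    (h : ∃ i ∈ S, ∃ k ∈ V, k ∉ S ∧ i < k) :
    W (SSet.Subcomplex.homOfLE (facets_le_face.{u} V S)) := by
  obtain ⟨i, hi, k, hk, hkS, hik⟩ := h
  have ih : ∀ j ∈ V, ∀ S' ⊆ V.erase j, (∃ i ∈ S', ∃ k ∈ V.erase j, k ∉ S' ∧ i < k) →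
      W (SSet.Subcomplex.homOfLE (facets_le_face.{u} (V.erase j) S')) :=
    fun j hj S' hS' h' ↦ facets_mem_of_finalVertex_mem hc hW (V.erase j) S' hS' h'
  obtain ⟨v, hv, hV⟩ : ∃ v ∈ V, ∀ i ∈ V, i ≤ v := ⟨V.max' ⟨i, hSV hi⟩, V.max'_mem _, V.le_max'⟩
  -- if `v ∉ S`, the final vertex `v` lies in each of the facets; add them one at a time
  have vert : ∀ S ⊆ V, v ∉ S → S.Nonempty →
      ∃ h : SSet.stdSimplex.face.{u} {v} ≤ facets V S, W (SSet.Subcomplex.homOfLE h) := by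
    intro S
    induction S using Finset.induction_on with
    | empty => simp
    | insert j S hj hS =>
      intro hSV hvS _
      rw [Finset.insert_subset_iff] at hSV
      rw [Finset.mem_insert, not_or] at hvS
      by_cases hS₀ : S.Nonempty
      · obtain ⟨h₁, h₂⟩ := hS hSV.2 hvS.2 hS₀
        refine ⟨h₁.trans (facets_bicartSq V S j).le₃₄, W.comp_mem _ _ h₂ (facets_insert_mem ?_)⟩
        obtain ⟨i, hi⟩ := hS₀
        exact ih j hSV.1 S (fun x hx ↦ Finset.mem_erase.2 ⟨by rintro rfl; exact hj hx, hSV.2 hx⟩)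
          ⟨i, hi, v, Finset.mem_erase.2 ⟨hvS.1, hv⟩, hvS.2,
            lt_of_le_of_ne (hV i (hSV.2 hi)) (by rintro rfl; exact hvS.2 hi)⟩
      · obtain rfl := Finset.not_nonempty_iff_eq_empty.1 hS₀
        have hv' : v ∈ V.erase j := Finset.mem_erase.2 ⟨hvS.1, hv⟩
        have h₁ : SSet.stdSimplex.face (V.erase j) = facets.{u} V (insert j ∅) :=
          (facets_singleton V j).symm
        have h₂ := (SSet.stdSimplex.face_le_face_iff.{u} {v} _).2
          (Finset.singleton_subset_iff.2 hv')
        exact ⟨h₂.trans h₁.le, W.comp_mem _ _ (finalVertexFace_mem_of_finalVertex_mem hW _ v hv'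
          fun i hi ↦ hV i (Finset.mem_of_mem_erase hi)) (homOfLE_mem_of_eq h₁)⟩
  -- cancel the inclusion of the final vertex
  have key : ∀ S ⊆ V, v ∉ S → S.Nonempty →
      W (SSet.Subcomplex.homOfLE (facets_le_face.{u} V S)) := by
    intro S hSV hvS hS
    obtain ⟨h₁, h₂⟩ := vert S hSV hvS hS
    exact hc (SSet.Subcomplex.homOfLE h₁) _ h₂ (finalVertexFace_mem_of_finalVertex_mem hW V v hv hV)
  -- if `v ∈ S`, compare with the union of the facets opposite to the other vertices in `S`
  by_cases hvS : v ∈ S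
  · obtain ⟨S', hvS', rfl⟩ : ∃ S', v ∉ S' ∧ insert v S' = S :=
      ⟨S.erase v, Finset.notMem_erase _ _, Finset.insert_erase hvS⟩
    rw [Finset.insert_subset_iff] at hSV
    rw [Finset.mem_insert, not_or] at hkS
    have hi' : i ∈ S' := (Finset.mem_insert.1 hi).resolve_left (hik.trans_le (hV k hk)).ne
    exact hc _ _ (facets_insert_mem (ih v hv S' (fun x hx ↦ Finset.mem_erase.2
      ⟨by rintro rfl; exact hvS' hx, hSV.2 hx⟩) ⟨i, hi', k, Finset.mem_erase.2 ⟨hkS.1, hk⟩,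
        hkS.2, hik⟩)) (key S' hSV.2 hvS' ⟨i, hi'⟩)
  · exact key S hSV hvS ⟨i, hi⟩
termination_by V.card
decreasing_by exact Finset.card_erase_lt_of_mem hj

lemma rightHornInclusions_le_of_finalVertex_mem
    (hc : ∀ {K L M : SSet.{u}} (i : K ⟶ L) (j : L ⟶ M) [Mono j], W i → W (i ≫ j) → W j)
    (hW : ∀ n, W (finalVertex n)) : rightHornInclusions ≤ W := by
  rintro _ _ _ @⟨n, k, hk⟩
  let e := univOrderIso (n + 1)
  refine (W.arrow_mk_iso_iff (facetsHornIso e k)).2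
    (facets_mem_of_finalVertex_mem hc hW _ _ (Finset.erase_subset _ _)
      ⟨e 0, ?_, e k, (e k).2, Finset.notMem_erase _ _, e.strictMono hk⟩)
  exact Finset.mem_erase.2 ⟨fun h ↦ (e.strictMono hk).ne (Subtype.ext h), (e 0).2⟩

end Generation

section Locality

variable {A B : SSet.{u}} {X : Cyl A B}

instance : X.leftTrivial.IsStableUnderCobaseChange :=
  inferInstanceAs (MorphismProperty.llp _).IsStableUnderCobaseChange

instance : X.leftTrivial.IsMultiplicative :=
  inferInstanceAs (MorphismProperty.llp _).IsMultiplicative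

lemma Cyl.VerticallyReedyLeftFibrant.horizontallyReedyRightFibrant_iff_verticallyRightLocal
    (hX : X.VerticallyReedyLeftFibrant) :
    X.HorizontallyReedyRightFibrant ↔ X.VerticallyRightLocal := by
  rw [horizontallyReedyRightFibrant_iff_leftTrivial, hX.verticallyRightLocal_iff]
  exact ⟨finalVertex_mem_of_rightHornInclusions_le,
    rightHornInclusions_le_of_finalVertex_mem fun i j _ ↦ hX.leftTrivial_of_precomp i j⟩

end Locality

/-! ### Standard simplices as joins -/

section StandardCylinder

variable {N : ℕ}

/-- A map `χ : Δ[N] ⟶ Δ[1]`, seen as a cylinder between its fibres. -/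
def stdCyl (χ : (Δ[N] : SSet.{u}) ⟶ Δ[1]) : Cyl (fib 0 χ : SSet.{u}) (fib 1 χ : SSet.{u}) where
  X := Δ[N]
  p := χ
  iso₀ := Iso.refl _
  iso₁ := Iso.refl _

lemma obj₀Equiv_symm_mem_fib_iff {d : ℕ} {ε : Fin 2} (χ : (Δ[d] : SSet.{u}) ⟶ Δ[1])
    (i : Fin (d + 1)) :
    SSet.stdSimplex.obj₀Equiv.symm i ∈ (fib ε χ).obj (op ⦋0⦌) ↔ SSet.yonedaEquiv χ i = ε :=
  (mem_fib_iff _ _).trans ⟨fun h ↦ h 0, fun h _ ↦ h⟩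

/-- A map from a subcomplex of a standard simplex to a standard simplex is determined by its effect
on vertices. -/
lemma subcomplex_hom_app_apply {d : ℕ} {P : (Δ[d] : SSet.{u}).Subcomplex}
    (l : (P : SSet.{u}) ⟶ Δ[N]) {k : ℕ} (y : (Δ[d] : SSet.{u}) _⦋k⦌) (hy : y ∈ P.obj (op ⦋k⦌))
    (i : Fin (k + 1)) (hi : SSet.stdSimplex.obj₀Equiv.symm (y i) ∈ P.obj (op ⦋0⦌)) :
    (l.app (op ⦋k⦌) ⟨y, hy⟩ : (Δ[N] : SSet.{u}) _⦋k⦌) i =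
      (l.app (op ⦋0⦌) ⟨SSet.stdSimplex.obj₀Equiv.symm (y i), hi⟩ : (Δ[N] : SSet.{u}) _⦋0⦌) 0 := by
  have h := NatTrans.naturality_apply l (SimplexCategory.const ⦋0⦌ ⦋k⦌ i).op ⟨y, hy⟩
  have h' : (P : SSet.{u}).map (SimplexCategory.const ⦋0⦌ ⦋k⦌ i).op ⟨y, hy⟩ =
      ⟨SSet.stdSimplex.obj₀Equiv.symm (y i), hi⟩ :=
    Subtype.ext (SSet.stdSimplex.ext _ _ fun _ ↦ rfl)
  rw [h'] at h
  exact (DFunLike.congr_fun h 0).symm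

lemma fin_two_eq_zero_or_one (a : Fin 2) : a = 0 ∨ a = 1 := by
  revert a
  decide

lemma toJoin_stdCyl_injective (χ : (Δ[N] : SSet.{u}) ⟶ Δ[1]) {d : ℕ} :
    Function.Injective ((stdCyl χ).toJoin.app (op ⦋d⦌)) := by
  intro x y h
  refine SSet.stdSimplex.ext _ _ fun i ↦ ?_
  have hχ : SSet.yonedaEquiv.symm x ≫ χ = SSet.yonedaEquiv.symm y ≫ χ :=
    congrArg JoinSimplex.χ h
  have hx := obj₀Equiv_symm_mem_fib_iff (SSet.yonedaEquiv.symm x ≫ χ) i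
    (ε := SSet.yonedaEquiv (SSet.yonedaEquiv.symm x ≫ χ) i) |>.2 rfl
  obtain h₀ | h₀ := fin_two_eq_zero_or_one (SSet.yonedaEquiv (SSet.yonedaEquiv.symm x ≫ χ) i)
  · rw [h₀] at hx
    have := congrArg Subtype.val (JoinSimplex.left_congr h _ hx (by rw [hχ] at hx; exact hx))
    exact DFunLike.congr_fun this 0
  · rw [h₀] at hx
    have := congrArg Subtype.val (JoinSimplex.right_congr h _ hx (by rw [hχ] at hx; exact hx))
    exact DFunLike.congr_fun this 0

lemma yonedaEquiv_fib_val {ε : Fin 2} (χ : (Δ[N] : SSet.{u}) ⟶ Δ[1]) {k : ℕ}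
    (y : (fib ε χ : SSet.{u}) _⦋k⦌) (i : Fin (k + 1)) : SSet.yonedaEquiv χ (y.1 i) = ε :=
  (mem_fib_iff _ _).1 y.2 i

/-- A simplex of the join of the two fibres comes from a simplex of `Δ[N]`: the vertices in the
fibre over `0` precede those in the fibre over `1`. -/
lemma toJoin_stdCyl_surjective (χ : (Δ[N] : SSet.{u}) ⟶ Δ[1]) {d : ℕ} :
    Function.Surjective ((stdCyl χ).toJoin.app (op ⦋d⦌)) := by
  intro s
  change JoinSimplex _ _ ⦋d⦌ at s
  let c : Fin (d + 1) → Fin 2 := fun i ↦ SSet.yonedaEquiv s.χ i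
  have hc : Monotone c := SSet.stdSimplex.monotone_apply (SSet.yonedaEquiv s.χ)
  have hc₁ : ∀ i, c i ≠ 0 → c i = 1 := fun i h ↦ (fin_two_eq_zero_or_one (c i)).resolve_left h
  -- the vertices of the simplex of `Δ[N]` corresponding to `s`
  let f : Fin (d + 1) → Fin (N + 1) := fun i ↦
    if h : c i = 0 then
      (s.left.app (op ⦋0⦌) ⟨_, (obj₀Equiv_symm_mem_fib_iff s.χ i).2 h⟩).1 0
    else (s.right.app (op ⦋0⦌) ⟨_, (obj₀Equiv_symm_mem_fib_iff s.χ i).2 (hc₁ i h)⟩).1 0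
  have hl : ∀ {k : ℕ} (y : (Δ[d] : SSet.{u}) _⦋k⦌) (hy : y ∈ (fib 0 s.χ).obj (op ⦋k⦌)) (i),
      (s.left.app (op ⦋k⦌) ⟨y, hy⟩).1 i = f (y i) := by
    intro k y hy i
    have h : c (y i) = 0 := (mem_fib_iff _ _).1 hy i
    refine (subcomplex_hom_app_apply (s.left ≫ (fib 0 χ).ι) y hy i
      ((obj₀Equiv_symm_mem_fib_iff s.χ _).2 h)).trans ?_
    simp only [f, dif_pos h]
    rfl
  have hr : ∀ {k : ℕ} (y : (Δ[d] : SSet.{u}) _⦋k⦌) (hy : y ∈ (fib 1 s.χ).obj (op ⦋k⦌)) (i),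
      (s.right.app (op ⦋k⦌) ⟨y, hy⟩).1 i = f (y i) := by
    intro k y hy i
    have h : c (y i) = 1 := (mem_fib_iff _ _).1 hy i
    refine (subcomplex_hom_app_apply (s.right ≫ (fib 1 χ).ι) y hy i
      ((obj₀Equiv_symm_mem_fib_iff s.χ _).2 h)).trans ?_
    have h' : c (y i) ≠ 0 := by rw [h]; decide
    simp only [f, dif_neg h']
    rfl
  have hf₀ : ∀ i, c i = 0 → SSet.yonedaEquiv χ (f i) = 0 := by
    intro i h
    simp only [f, dif_pos h]
    exact yonedaEquiv_fib_val χ _ 0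
  have hf₁ : ∀ i, c i ≠ 0 → SSet.yonedaEquiv χ (f i) = 1 := by
    intro i h
    simp only [f, dif_neg h]
    exact yonedaEquiv_fib_val χ _ 0
  have hf : Monotone f := by
    intro i j hij
    let y : (Δ[d] : SSet.{u}) _⦋1⦌ := SSet.stdSimplex.objMk ⟨![i, j], by
      intro a b hab
      fin_cases a <;> fin_cases b <;> simp_all⟩
    by_cases hi : c i = 0
    · by_cases hj : c j = 0
      · have hy : y ∈ (fib 0 s.χ).obj (op ⦋1⦌) := (mem_fib_iff _ _).2 fun a ↦ by
          fin_cases a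
          · exact hi
          · exact hj
        refine (hl y hy 0).symm.le.trans (le_trans ?_ (hl y hy 1).le)
        exact SSet.stdSimplex.monotone_apply _ (Fin.zero_le _)
      · by_contra! h
        have : SSet.yonedaEquiv χ (f j) ≤ SSet.yonedaEquiv χ (f i) :=
          SSet.stdSimplex.monotone_apply (SSet.yonedaEquiv χ) h.le
        rw [hf₀ i hi, hf₁ j hj] at this
        exact absurd this (by decide)
    · by_cases hj : c j = 0
      · have := hc hij
        rw [hj, hc₁ i hi] at this
        exact absurd this (by decide)
      · have hy : y ∈ (fib 1 s.χ).obj (op ⦋1⦌) := (mem_fib_iff _ _).2 fun a ↦ by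
          fin_cases a
          · exact hc₁ i hi
          · exact hc₁ j hj
        refine (hr y hy 0).symm.le.trans (le_trans ?_ (hr y hy 1).le)
        exact SSet.stdSimplex.monotone_apply _ (Fin.zero_le _)
  refine ⟨SSet.stdSimplex.objMk ⟨f, hf⟩, ?_⟩
  refine JoinSimplex.ext' ?_ ?_ ?_
  · refine SSet.yonedaEquiv.injective (SSet.stdSimplex.ext _ _ fun i ↦ ?_)
    refine Eq.trans (b := SSet.yonedaEquiv χ (f i)) ?_ ?_
    · exact stdSimplex_hom_app_apply χ (SSet.stdSimplex.objMk ⟨f, hf⟩) i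
    change SSet.yonedaEquiv χ (f i) = c i
    by_cases hi : c i = 0
    · rw [hf₀ i hi, hi]
    · rw [hf₁ i hi, hc₁ i hi]
  · intro k y h₁ h₂
    exact Subtype.ext (SSet.stdSimplex.ext _ _ fun i ↦ (hl (k := k.unop.len) y h₂ i).symm)
  · intro k y h₁ h₂
    exact Subtype.ext (SSet.stdSimplex.ext _ _ fun i ↦ (hr (k := k.unop.len) y h₂ i).symm)

/-- A simplex `Δ[N]` is the join of the fibres of a map `χ : Δ[N] ⟶ Δ[1]`. -/
def stdJoinIso (χ : (Δ[N] : SSet.{u}) ⟶ Δ[1]) :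
    (Δ[N] : SSet.{u}) ≅ join (fib 0 χ : SSet.{u}) (fib 1 χ : SSet.{u}) :=
  @asIso _ _ _ _ (stdCyl χ).toJoin (isIso_of_bijective _ fun k ↦
    ⟨toJoin_stdCyl_injective χ (d := k.unop.len), toJoin_stdCyl_surjective χ (d := k.unop.len)⟩)

/-- A simplex of `A ⋆ B` is the join of its components. -/
lemma yonedaEquiv_symm_joinSimplex {A B : SSet.{u}} (s : JoinSimplex A B ⦋N⦌) :
    (SSet.yonedaEquiv.symm s : Δ[N] ⟶ join A B) =
      (stdJoinIso s.χ).hom ≫ joinMap s.left s.right := by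
  refine SSet.yonedaEquiv.injective ((SSet.yonedaEquiv.apply_symm_apply _).trans ?_)
  have h : SSet.yonedaEquiv.symm (SSet.yonedaEquiv (𝟙 Δ[N])) = 𝟙 _ := Equiv.symm_apply_apply _ _
  symm
  refine JoinSimplex.ext' ?_ (fun k y _ _ ↦ ?_) (fun k y _ _ ↦ ?_)
  · change SSet.yonedaEquiv.symm (SSet.yonedaEquiv (𝟙 _)) ≫ s.χ = s.χ
    rw [h, Category.id_comp]
  · exact congrArg (s.left.app k) (Subtype.ext (congrArg (fun t ↦ t.app k y) h))
  · exact congrArg (s.right.app k) (Subtype.ext (congrArg (fun t ↦ t.app k y) h))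

end StandardCylinder

/-! ### Pushout-joins in a standard simplex -/

section InnerHorns

/-- Gluing of maps out of the images of two monomorphisms. -/
lemma exists_desc_sup_range {Z E P Q : SSet.{u}} (f : P ⟶ Z) (g : Q ⟶ Z) [Mono f] [Mono g]
    (a : P ⟶ E) (b : Q ⟶ E)
    (h : ∀ (k : SimplexCategoryᵒᵖ) (p : P.obj k) (q : Q.obj k), f.app k p = g.app k q →
      a.app k p = b.app k q) :
    ∃ c : ((SSet.Subcomplex.range f ⊔ SSet.Subcomplex.range g : Z.Subcomplex) : SSet.{u}) ⟶ E,
      SSet.Subcomplex.lift f le_sup_left ≫ c = a ∧ SSet.Subcomplex.lift g le_sup_right ≫ c = b := by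
  have hf : ∀ (k : SimplexCategoryᵒᵖ) (p : P.obj k),
      (inv (SSet.Subcomplex.toRange f)).app k ((SSet.Subcomplex.toRange f).app k p) = p :=
    fun k p ↦ ConcreteCategory.congr_hom
      (congr_app (IsIso.hom_inv_id (SSet.Subcomplex.toRange f)) k) p
  have hg : ∀ (k : SimplexCategoryᵒᵖ) (q : Q.obj k),
      (inv (SSet.Subcomplex.toRange g)).app k ((SSet.Subcomplex.toRange g).app k q) = q :=
    fun k q ↦ ConcreteCategory.congr_hom
      (congr_app (IsIso.hom_inv_id (SSet.Subcomplex.toRange g)) k) q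
  obtain ⟨c, hc₁, hc₂⟩ := exists_desc_sup (inv (SSet.Subcomplex.toRange f) ≫ a)
    (inv (SSet.Subcomplex.toRange g) ≫ b) (by
      rintro k _ ⟨p, rfl⟩ ⟨q, hq⟩
      have h₁ : (inv (SSet.Subcomplex.toRange f)).app k ⟨f.app k p, ⟨p, rfl⟩⟩ = p := hf k p
      have h₂ : (inv (SSet.Subcomplex.toRange g)).app k ⟨f.app k p, ⟨q, hq⟩⟩ = q :=
        (congrArg _ (Subtype.ext hq.symm)).trans (hg k q)
      change a.app k ((inv (SSet.Subcomplex.toRange f)).app k _) =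
        b.app k ((inv (SSet.Subcomplex.toRange g)).app k _)
      rw [h₁, h₂]
      exact h k p q hq.symm)
  refine ⟨c, ?_, ?_⟩
  · rw [← IsIso.hom_inv_id_assoc (SSet.Subcomplex.toRange f) a, ← hc₁]
    rfl
  · rw [← IsIso.hom_inv_id_assoc (SSet.Subcomplex.toRange g) b, ← hc₂]
    rfl

lemma sup_range_hom_ext {Z E P Q : SSet.{u}} {f : P ⟶ Z} {g : Q ⟶ Z}
    {c c' : ((SSet.Subcomplex.range f ⊔ SSet.Subcomplex.range g : Z.Subcomplex) : SSet.{u}) ⟶ E}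
    (h₁ : SSet.Subcomplex.lift f le_sup_left ≫ c = SSet.Subcomplex.lift f le_sup_left ≫ c')
    (h₂ : SSet.Subcomplex.lift g le_sup_right ≫ c = SSet.Subcomplex.lift g le_sup_right ≫ c') :
    c = c' := by
  ext k ⟨z, hz⟩
  obtain ⟨y, rfl⟩ | ⟨y, rfl⟩ := hz
  · exact ConcreteCategory.congr_hom (congr_app h₁ k) y
  · exact ConcreteCategory.congr_hom (congr_app h₂ k) y

instance {K L M T : SSet.{u}} (i : K ⟶ M) (j : L ⟶ T) [Mono i] [Mono j] : Mono (joinMap i j) := by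
  rw [NatTrans.mono_iff_mono_app]
  intro n
  rw [mono_iff_injective]
  rintro ⟨χ, l, r⟩ ⟨χ', l', r'⟩ h
  obtain rfl : χ = χ' := congrArg JoinSimplex.χ h
  have h' := JoinSimplex.mk.inj h
  obtain rfl : l = l' := (cancel_mono i).1 (eq_of_heq h'.2.1)
  obtain rfl : r = r' := (cancel_mono j).1 (eq_of_heq h'.2.2)
  rfl

variable {A B : SSet.{u}} {X : Cyl A B} {N : ℕ} (χ : (Δ[N] : SSet.{u}) ⟶ Δ[1])

/-- The lifting property against a pushout-join of subcomplexes of the fibres of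
`χ : Δ[N] ⟶ Δ[1]` is the one against the corresponding subcomplex of `Δ[N]`. -/
lemma Cyl.joinLift_iff_exists_lift {K L : SSet.{u}} (i : K ⟶ (fib 0 χ : SSet.{u}))
    (j : L ⟶ (fib 1 χ : SSet.{u})) [Mono i] [Mono j] (Q : (Δ[N] : SSet.{u}).Subcomplex)
    (hQ : SSet.Subcomplex.range (joinMap i (𝟙 _) ≫ (stdJoinIso χ).inv) ⊔
      SSet.Subcomplex.range (joinMap (𝟙 _) j ≫ (stdJoinIso χ).inv) = Q) :
    X.JoinLift i j ↔ ∀ (α : (fib 0 χ : SSet.{u}) ⟶ A) (β : (fib 1 χ : SSet.{u}) ⟶ B)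
      (v : (Q : SSet.{u}) ⟶ X.X), v ≫ X.toJoin = Q.ι ≫ (stdJoinIso χ).hom ≫ joinMap α β →
        ∃ w : Δ[N] ⟶ X.X, Q.ι ≫ w = v ∧ w ≫ X.toJoin = (stdJoinIso χ).hom ≫ joinMap α β := by
  subst hQ
  let f := joinMap i (𝟙 (fib 1 χ : SSet.{u})) ≫ (stdJoinIso χ).inv
  let g := joinMap (𝟙 (fib 0 χ : SSet.{u})) j ≫ (stdJoinIso χ).inv
  let Q : (Δ[N] : SSet.{u}).Subcomplex := SSet.Subcomplex.range f ⊔ SSet.Subcomplex.range g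
  let f' : join K (fib 1 χ) ⟶ (Q : SSet.{u}) := SSet.Subcomplex.lift f le_sup_left
  let g' : join (fib 0 χ) L ⟶ (Q : SSet.{u}) := SSet.Subcomplex.lift g le_sup_right
  have hf : f' ≫ Q.ι ≫ (stdJoinIso χ).hom = joinMap i (𝟙 _) := by
    change (joinMap i (𝟙 _) ≫ (stdJoinIso χ).inv) ≫ (stdJoinIso χ).hom = _
    rw [Category.assoc, Iso.inv_hom_id, Category.comp_id]
  have hg : g' ≫ Q.ι ≫ (stdJoinIso χ).hom = joinMap (𝟙 _) j := by
    change (joinMap (𝟙 _) j ≫ (stdJoinIso χ).inv) ≫ (stdJoinIso χ).hom = _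
    rw [Category.assoc, Iso.inv_hom_id, Category.comp_id]
  constructor
  · intro H α β v hv
    change (Q : SSet.{u}) ⟶ X.X at v
    change v ≫ X.toJoin = Q.ι ≫ _ at hv
    have hv' : joinMap i (𝟙 L) ≫ g' = joinMap (𝟙 K) j ≫ f' := rfl
    obtain ⟨c, hc, hca, hcb⟩ := H α β (g' ≫ v) (f' ≫ v)
      (by
        rw [Category.assoc, hv, reassoc_of% hg, ← joinMap_comp, Category.id_comp])
      (by
        rw [Category.assoc, hv, reassoc_of% hf, ← joinMap_comp, Category.id_comp])
      (by rw [reassoc_of% hv'])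
    refine ⟨(stdJoinIso χ).hom ≫ c, sup_range_hom_ext (f := f) (g := g) ?_ ?_, by
      rw [Category.assoc, hc]⟩
    · change f' ≫ Q.ι ≫ _ ≫ c = f' ≫ v
      rw [reassoc_of% hf, hcb]
    · change g' ≫ Q.ι ≫ _ ≫ c = g' ≫ v
      rw [reassoc_of% hg, hca]
  · intro H α β a b ha hb hab
    obtain ⟨v, hvb, hva⟩ := exists_desc_sup_range f g b a (by
      intro k s s' h
      have h' : (joinMap i (𝟙 _)).app k s = (joinMap (𝟙 _) j).app k s' := by
        have := congrArg ((stdJoinIso χ).hom.app k) h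
        have h₁ : f ≫ (stdJoinIso χ).hom = joinMap i (𝟙 _) := hf
        have h₂ : g ≫ (stdJoinIso χ).hom = joinMap (𝟙 _) j := hg
        rw [← h₁, ← h₂]
        exact this
      clear h
      obtain ⟨χ', l, r⟩ := s
      obtain ⟨χ'', l', r'⟩ := s'
      obtain rfl : χ' = χ'' := congrArg JoinSimplex.χ h'
      have h'' := JoinSimplex.mk.inj h'
      obtain rfl : l ≫ i = l' := eq_of_heq h''.2.1
      obtain rfl : r = r' ≫ j := eq_of_heq h''.2.2
      exact (ConcreteCategory.congr_hom (congr_app hab k) ⟨χ', l, r'⟩).symm)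
    change (Q : SSet.{u}) ⟶ X.X at v
    change f' ≫ v = b at hvb
    change g' ≫ v = a at hva
    obtain ⟨w, hw, hw'⟩ := H α β v (sup_range_hom_ext (f := f) (g := g)
      (by
        change f' ≫ v ≫ X.toJoin = f' ≫ Q.ι ≫ _ ≫ _
        rw [reassoc_of% hvb, hb, reassoc_of% hf, ← joinMap_comp, Category.id_comp])
      (by
        change g' ≫ v ≫ X.toJoin = g' ≫ Q.ι ≫ _ ≫ _
        rw [reassoc_of% hva, ha, reassoc_of% hg, ← joinMap_comp, Category.id_comp]))
    change Q.ι ≫ w = v at hw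
    refine ⟨(stdJoinIso χ).inv ≫ w, by rw [Category.assoc, hw', Iso.inv_hom_id_assoc], ?_, ?_⟩
    · rw [← hva, ← hw]
      rfl
    · rw [← hvb, ← hw]
      rfl

end InnerHorns

/-! ### Horns as pushout-joins -/

section InnerHornsOfJoins

variable {N : ℕ} (χ : (Δ[N] : SSet.{u}) ⟶ Δ[1])

/-- The vertices of `Δ[N]` lying over the vertex `ε` of `Δ[1]`. -/
def fibVertices (ε : Fin 2) : Finset (Fin (N + 1)) :=
  Finset.univ.filter fun i ↦ SSet.yonedaEquiv χ i = ε

variable {χ}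

lemma mem_fibVertices_iff {ε : Fin 2} {i : Fin (N + 1)} :
    i ∈ fibVertices χ ε ↔ SSet.yonedaEquiv χ i = ε := by
  simp [fibVertices]

variable (χ)

lemma fib_eq_face (ε : Fin 2) : fib ε χ = SSet.stdSimplex.face (fibVertices χ ε) :=
  subcomplex_stdSimplex_ext fun d x ↦ by
    rw [mem_fib_iff, SSet.stdSimplex.mem_face_iff]
    simp only [mem_fibVertices_iff]

lemma facets_le_fib (ε : Fin 2) (S : Finset (Fin (N + 1))) :
    facets (fibVertices χ ε) S ≤ fib ε χ :=
  (facets_le_face _ _).trans_eq (fib_eq_face χ ε).symm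

/-- The inclusion in a fibre of `χ : Δ[N] ⟶ Δ[1]` of the union of the facets opposite to
the vertices in `S`. -/
def facetsToFib (ε : Fin 2) (S : Finset (Fin (N + 1))) :
    (facets (fibVertices χ ε) S : SSet.{u}) ⟶ (fib ε χ : SSet.{u}) :=
  SSet.Subcomplex.homOfLE (facets_le_fib χ ε S)

instance (ε : Fin 2) (S : Finset (Fin (N + 1))) : Mono (facetsToFib χ ε S) :=
  inferInstanceAs (Mono (SSet.Subcomplex.homOfLE (facets_le_fib χ ε S)))

lemma facetsToFib_arrow (ε : Fin 2) (S : Finset (Fin (N + 1))) :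
    Arrow.mk (facetsToFib χ ε S) =
      Arrow.mk (SSet.Subcomplex.homOfLE (facets_le_face.{u} (fibVertices χ ε) S)) := by
  have key : ∀ (F F' : (Δ[N] : SSet.{u}).Subcomplex) (h : F = F')
      (hF : facets (fibVertices χ ε) S ≤ F), Arrow.mk (SSet.Subcomplex.homOfLE hF) =
        Arrow.mk (SSet.Subcomplex.homOfLE (hF.trans_eq h)) := by
    rintro F _ rfl hF
    rfl
  exact key _ _ (fib_eq_face χ ε) (facets_le_fib χ ε S)

lemma mem_facets_univ_iff (S : Finset (Fin (N + 1))) {d : ℕ} (x : (Δ[N] : SSet.{u}) _⦋d⦌) :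
    x ∈ (facets Finset.univ S).obj (op ⦋d⦌) ↔ ∃ j ∈ S, ∀ i, x i ≠ j := by
  rw [mem_facets_iff]
  simp

lemma facets_univ_erase (k : Fin (N + 1)) :
    facets.{u} Finset.univ (Finset.univ.erase k) = Λ[N, k] :=
  subcomplex_stdSimplex_ext fun d x ↦ by
    rw [mem_facets_univ_iff, SSet.mem_horn_iff_notMem_range]
    simp

lemma facets_univ_union (S S' : Finset (Fin (N + 1))) :
    facets.{u} Finset.univ S ⊔ facets Finset.univ S' = facets Finset.univ (S ∪ S') :=
  subcomplex_stdSimplex_ext fun d x ↦ by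
    change x ∈ _ ∪ _ ↔ _
    rw [Set.mem_union, mem_facets_univ_iff, mem_facets_univ_iff, mem_facets_univ_iff]
    simp only [Finset.mem_union, or_and_right, exists_or]

lemma mem_range_comp_stdJoinIso_inv_iff {Z : SSet.{u}}
    (f : Z ⟶ join (fib 0 χ : SSet.{u}) (fib 1 χ : SSet.{u})) {d : ℕ}
    (x : (Δ[N] : SSet.{u}) _⦋d⦌) :
    x ∈ (SSet.Subcomplex.range (f ≫ (stdJoinIso χ).inv)).obj (op ⦋d⦌) ↔
      ∃ z, f.app (op ⦋d⦌) z = (stdCyl χ).toJoin.app (op ⦋d⦌) x := by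
  constructor
  · rintro ⟨z, rfl⟩
    refine ⟨z, ?_⟩
    exact (ConcreteCategory.congr_hom (congr_app (stdJoinIso χ).inv_hom_id (op ⦋d⦌))
      (f.app (op ⦋d⦌) z)).symm
  · rintro ⟨z, hz⟩
    refine ⟨z, ?_⟩
    change (stdJoinIso χ).inv.app _ (f.app (op ⦋d⦌) z) = x
    rw [hz]
    exact ConcreteCategory.congr_hom (congr_app (stdJoinIso χ).hom_inv_id (op ⦋d⦌)) x

/-- A map from a fibre of `ψ : Δ[d] ⟶ Δ[1]` which extends to `Δ[d]` and whose image is in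
a union of facets has its image in one of them. -/
lemma exists_forall_ne_of_retraction {d : ℕ} {ψ : (Δ[d] : SSet.{u}) ⟶ Δ[1]} {ε : Fin 2}
    {V S : Finset (Fin (N + 1))} (l : (fib ε ψ : SSet.{u}) ⟶ (facets V S : SSet.{u}))
    (r : (Δ[d] : SSet.{u}) ⟶ (fib ε ψ : SSet.{u})) (hr : (fib ε ψ).ι ≫ r = 𝟙 _) :
    ∃ j ∈ S, ∀ (i : Fin (d + 1))
      (hi : SSet.stdSimplex.obj₀Equiv.symm i ∈ (fib ε ψ).obj (op ⦋0⦌)),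
      ((l.app (op ⦋0⦌) ⟨_, hi⟩).1 : (Δ[N] : SSet.{u}) _⦋0⦌) 0 ≠ j := by
  let L : (Δ[d] : SSet.{u}) ⟶ Δ[N] := r ≫ l ≫ (facets V S).ι
  have hL : SSet.yonedaEquiv L ∈ (facets V S).obj (op ⦋d⦌) :=
    ((r ≫ l).app (op ⦋d⦌) (SSet.yonedaEquiv (𝟙 _))).2
  obtain ⟨j, hj, h⟩ := (mem_facets_iff _ _ _).1 hL
  refine ⟨j, hj, fun i hi ↦ ?_⟩
  have h₁ : (l.app (op ⦋0⦌) ⟨_, hi⟩).1 = L.app (op ⦋0⦌) (SSet.stdSimplex.obj₀Equiv.symm i) := by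
    have h₂ : r.app (op ⦋0⦌) (SSet.stdSimplex.obj₀Equiv.symm i) = ⟨_, hi⟩ :=
      ConcreteCategory.congr_hom (congr_app hr (op ⦋0⦌)) ⟨_, hi⟩
    exact congrArg (fun t ↦ (l.app (op ⦋0⦌) t).1) h₂.symm
  rw [h₁, stdSimplex_hom_app_apply]
  exact Finset.ne_of_mem_erase (h i)

lemma yonedaEquiv_symm_comp_apply {d : ℕ} (x : (Δ[N] : SSet.{u}) _⦋d⦌) (i : Fin (d + 1)) :
    SSet.yonedaEquiv (SSet.yonedaEquiv.symm x ≫ χ) i = SSet.yonedaEquiv χ (x i) := by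
  have h : SSet.yonedaEquiv (SSet.yonedaEquiv.symm x ≫ χ) = χ.app (op ⦋d⦌) x := by
    rw [SSet.yonedaEquiv_comp, Equiv.apply_symm_apply]
  rw [h]
  exact stdSimplex_hom_app_apply χ x i

lemma toJoin_stdCyl_left_apply {d : ℕ} (x : (Δ[N] : SSet.{u}) _⦋d⦌)
    (s : JoinSimplex (fib 0 χ : SSet.{u}) (fib 1 χ : SSet.{u}) ⦋d⦌)
    (h : s = (stdCyl χ).toJoin.app (op ⦋d⦌) x) (i : Fin (d + 1)) (hi : x i ∈ fibVertices χ 0) :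
    ∃ hi' : SSet.stdSimplex.obj₀Equiv.symm i ∈ (fib 0 s.χ).obj (op ⦋0⦌),
      ((s.left.app (op ⦋0⦌) ⟨_, hi'⟩).1 : (Δ[N] : SSet.{u}) _⦋0⦌) 0 = x i := by
  subst h
  have hi' : SSet.stdSimplex.obj₀Equiv.symm i ∈
      (fib 0 (SSet.yonedaEquiv.symm x ≫ χ)).obj (op ⦋0⦌) := by
    rw [obj₀Equiv_symm_mem_fib_iff]
    exact (yonedaEquiv_symm_comp_apply χ x i).trans (mem_fibVertices_iff.1 hi)
  exact ⟨hi', rfl⟩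

lemma toJoin_stdCyl_right_apply {d : ℕ} (x : (Δ[N] : SSet.{u}) _⦋d⦌)
    (s : JoinSimplex (fib 0 χ : SSet.{u}) (fib 1 χ : SSet.{u}) ⦋d⦌)
    (h : s = (stdCyl χ).toJoin.app (op ⦋d⦌) x) (i : Fin (d + 1)) (hi : x i ∈ fibVertices χ 1) :
    ∃ hi' : SSet.stdSimplex.obj₀Equiv.symm i ∈ (fib 1 s.χ).obj (op ⦋0⦌),
      ((s.right.app (op ⦋0⦌) ⟨_, hi'⟩).1 : (Δ[N] : SSet.{u}) _⦋0⦌) 0 = x i := by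
  subst h
  have hi' : SSet.stdSimplex.obj₀Equiv.symm i ∈
      (fib 1 (SSet.yonedaEquiv.symm x ≫ χ)).obj (op ⦋0⦌) := by
    rw [obj₀Equiv_symm_mem_fib_iff]
    exact (yonedaEquiv_symm_comp_apply χ x i).trans (mem_fibVertices_iff.1 hi)
  exact ⟨hi', rfl⟩

lemma toJoin_stdCyl_χ_apply {d : ℕ} (x : (Δ[N] : SSet.{u}) _⦋d⦌)
    (s : JoinSimplex (fib 0 χ : SSet.{u}) (fib 1 χ : SSet.{u}) ⦋d⦌)
    (h : s = (stdCyl χ).toJoin.app (op ⦋d⦌) x) (i : Fin (d + 1)) :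
    SSet.yonedaEquiv s.χ i = SSet.yonedaEquiv χ (x i) := by
  subst h
  exact yonedaEquiv_symm_comp_apply χ x i

lemma yonedaEquiv_eq_of_fib_eq_top {d : ℕ} {ε : Fin 2} {ψ : (Δ[d] : SSet.{u}) ⟶ Δ[1]}
    (h : fib ε ψ = ⊤) (i : Fin (d + 1)) : SSet.yonedaEquiv ψ i = ε := by
  rw [← obj₀Equiv_symm_mem_fib_iff, h]
  trivial

/-- If `x` misses the vertex `j`, so does its part over `ε`. -/
lemma range_fib_ι_comp_le_facets {d : ℕ} (x : (Δ[N] : SSet.{u}) _⦋d⦌) {ε : Fin 2}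
    {S : Finset (Fin (N + 1))} {j : Fin (N + 1)} (hj : j ∈ S) (h : ∀ i, x i ≠ j) :
    SSet.Subcomplex.range ((fib ε (SSet.yonedaEquiv.symm x ≫ χ)).ι ≫ SSet.yonedaEquiv.symm x) ≤
      facets (fibVertices χ ε) S := by
  rintro k _ ⟨y, rfl⟩
  induction k using Opposite.rec with | _ k
  induction k using SimplexCategory.rec with | _ k
  refine (mem_facets_iff _ _ _).2 ⟨j, hj, fun i ↦ Finset.mem_erase.2 ⟨h _, ?_⟩⟩
  refine mem_fibVertices_iff.2 (Eq.trans ?_ (yonedaEquiv_fib_val _ y i))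
  exact (yonedaEquiv_symm_comp_apply χ x (y.1 i)).symm

/-- If `S` is nonempty, the simplices of `Δ[N]` with no vertex over `0` miss a vertex in `S`, as do
the simplices of `facets V S ⋆ χ⁻¹(1)` with nonempty left part, `V` being the set of vertices
over `0`. -/
lemma range_joinMap_facetsToFib_left {S : Finset (Fin (N + 1))} (hS : S ⊆ fibVertices χ 0)
    (hS₀ : S.Nonempty) :
    SSet.Subcomplex.range (joinMap (facetsToFib χ 0 S) (𝟙 _) ≫ (stdJoinIso χ).inv) =
      facets Finset.univ S := by
  refine subcomplex_stdSimplex_ext fun d x ↦ ?_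
  rw [mem_range_comp_stdJoinIso_inv_iff, mem_facets_univ_iff]
  constructor
  · rintro ⟨s, hs⟩
    change JoinSimplex _ _ ⦋d⦌ at s
    obtain h | ⟨r, hr⟩ := fib_one_eq_top_or_exists_retraction s.χ
    · obtain ⟨j, hj⟩ := hS₀
      refine ⟨j, hj, ?_⟩
      rintro i rfl
      have h₁ := toJoin_stdCyl_χ_apply χ x _ hs i
      have h₂ : SSet.yonedaEquiv s.χ i = 1 := yonedaEquiv_eq_of_fib_eq_top h i
      rw [mem_fibVertices_iff.1 (hS hj)] at h₁
      exact absurd (h₁.symm.trans h₂) (by decide)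
    · obtain ⟨j, hj, h⟩ := exists_forall_ne_of_retraction s.left r hr
      refine ⟨j, hj, ?_⟩
      rintro i rfl
      obtain ⟨hi, hi'⟩ := toJoin_stdCyl_left_apply χ x _ hs i (hS hj)
      exact h i hi hi'
  · rintro ⟨j, hj, h⟩
    exact ⟨⟨SSet.yonedaEquiv.symm x ≫ χ, SSet.Subcomplex.lift
      ((fib 0 (SSet.yonedaEquiv.symm x ≫ χ)).ι ≫ SSet.yonedaEquiv.symm x)
      (range_fib_ι_comp_le_facets χ x hj h), fibMap 1 (SSet.yonedaEquiv.symm x) χ⟩, rfl⟩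

/-- The symmetric statement for the fibre over `1`. -/
lemma range_joinMap_facetsToFib_right {S : Finset (Fin (N + 1))} (hS : S ⊆ fibVertices χ 1)
    (hS₀ : S.Nonempty) :
    SSet.Subcomplex.range (joinMap (𝟙 _) (facetsToFib χ 1 S) ≫ (stdJoinIso χ).inv) =
      facets Finset.univ S := by
  refine subcomplex_stdSimplex_ext fun d x ↦ ?_
  rw [mem_range_comp_stdJoinIso_inv_iff, mem_facets_univ_iff]
  constructor
  · rintro ⟨s, hs⟩
    change JoinSimplex _ _ ⦋d⦌ at s
    obtain h | ⟨r, hr⟩ := fib_zero_eq_top_or_exists_retraction s.χ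
    · obtain ⟨j, hj⟩ := hS₀
      refine ⟨j, hj, ?_⟩
      rintro i rfl
      have h₁ := toJoin_stdCyl_χ_apply χ x _ hs i
      have h₂ : SSet.yonedaEquiv s.χ i = 0 := yonedaEquiv_eq_of_fib_eq_top h i
      rw [mem_fibVertices_iff.1 (hS hj)] at h₁
      exact absurd (h₁.symm.trans h₂) (by decide)
    · obtain ⟨j, hj, h⟩ := exists_forall_ne_of_retraction s.right r hr
      refine ⟨j, hj, ?_⟩
      rintro i rfl
      obtain ⟨hi, hi'⟩ := toJoin_stdCyl_right_apply χ x _ hs i (hS hj)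
      exact h i hi hi'
  · rintro ⟨j, hj, h⟩
    exact ⟨⟨SSet.yonedaEquiv.symm x ≫ χ, fibMap 0 (SSet.yonedaEquiv.symm x) χ,
      SSet.Subcomplex.lift ((fib 1 (SSet.yonedaEquiv.symm x ≫ χ)).ι ≫ SSet.yonedaEquiv.symm x)
        (range_fib_ι_comp_le_facets χ x hj h)⟩, rfl⟩

lemma fibVertices_union : fibVertices χ 0 ∪ fibVertices χ 1 = Finset.univ := by
  ext i
  simp only [Finset.mem_union, mem_fibVertices_iff, Finset.mem_univ, iff_true]
  exact fin_two_eq_zero_or_one _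

lemma notMem_fibVertices_one {i : Fin (N + 1)} (hi : i ∈ fibVertices χ 0) :
    i ∉ fibVertices χ 1 := by
  rw [mem_fibVertices_iff] at hi ⊢
  rw [hi]
  decide

variable {A B : SSet.{u}} {X : Cyl A B}

/-- The pushout-join of the horn of `χ⁻¹(0)` at `k` and of the boundary of `χ⁻¹(1)` is the horn
of `Δ[N]` at `k`. -/
lemma Cyl.joinLift_horn_boundary_iff {m n : ℕ} (e₀ : Fin (m + 2) ≃o fibVertices χ 0)
    (e₁ : Fin (n + 1) ≃o fibVertices χ 1) (k : Fin (m + 2)) :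
    X.JoinLift (Λ[m + 1, k] : SSet.Subcomplex.{u} _).ι (∂Δ[n] : SSet.Subcomplex.{u} _).ι ↔
      ∀ (α : (fib 0 χ : SSet.{u}) ⟶ A) (β : (fib 1 χ : SSet.{u}) ⟶ B)
      (v : (Λ[N, (e₀ k).1] : SSet.{u}) ⟶ X.X), v ≫ X.toJoin =
        (Λ[N, (e₀ k).1] : SSet.Subcomplex.{u} _).ι ≫ (stdJoinIso χ).hom ≫ joinMap α β →
        ∃ w : Δ[N] ⟶ X.X, (Λ[N, (e₀ k).1] : SSet.Subcomplex.{u} _).ι ≫ w = v ∧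
          w ≫ X.toJoin = (stdJoinIso χ).hom ≫ joinMap α β := by
  let i₀ := facetsHornIso.{u} e₀ k ≪≫ eqToIso (facetsToFib_arrow χ 0 _).symm
  let i₁ := facetsBoundaryIso.{u} e₁ ≪≫ eqToIso (facetsToFib_arrow χ 1 _).symm
  have h : X.JoinLift (Λ[m + 1, k] : SSet.Subcomplex.{u} _).ι
      (∂Δ[n] : SSet.Subcomplex.{u} _).ι ↔ X.JoinLift
        (facetsToFib χ 0 ((fibVertices χ 0).erase (e₀ k)))
        (facetsToFib χ 1 (fibVertices χ 1)) :=
    ⟨fun h ↦ (h.of_arrow_iso_left i₀).of_arrow_iso_right i₁,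
      fun h ↦ (h.of_arrow_iso_left i₀.symm).of_arrow_iso_right i₁.symm⟩
  rw [h]
  refine joinLift_iff_exists_lift χ _ _ _ ?_
  rw [range_joinMap_facetsToFib_left χ (Finset.erase_subset _ _),
    range_joinMap_facetsToFib_right χ subset_rfl, facets_univ_union, ← facets_univ_erase,
    ← fibVertices_union χ, Finset.erase_union_distrib,
    Finset.erase_eq_of_notMem (notMem_fibVertices_one χ (e₀ k).2)]
  · exact ⟨_, (e₁ 0).2⟩
  · obtain ⟨k', hk'⟩ := exists_ne k
    exact ⟨e₀ k', Finset.mem_erase.2 ⟨fun h ↦ hk' (e₀.injective (Subtype.ext h)), (e₀ k').2⟩⟩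

/-- The pushout-join of the boundary of `χ⁻¹(0)` and of the horn of `χ⁻¹(1)` at `k` is the horn
of `Δ[N]` at `k`. -/
lemma Cyl.joinLift_boundary_horn_iff {m n : ℕ} (e₀ : Fin (m + 1) ≃o fibVertices χ 0)
    (e₁ : Fin (n + 2) ≃o fibVertices χ 1) (k : Fin (n + 2)) :
    X.JoinLift (∂Δ[m] : SSet.Subcomplex.{u} _).ι (Λ[n + 1, k] : SSet.Subcomplex.{u} _).ι ↔
      ∀ (α : (fib 0 χ : SSet.{u}) ⟶ A) (β : (fib 1 χ : SSet.{u}) ⟶ B)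
      (v : (Λ[N, (e₁ k).1] : SSet.{u}) ⟶ X.X), v ≫ X.toJoin =
        (Λ[N, (e₁ k).1] : SSet.Subcomplex.{u} _).ι ≫ (stdJoinIso χ).hom ≫ joinMap α β →
        ∃ w : Δ[N] ⟶ X.X, (Λ[N, (e₁ k).1] : SSet.Subcomplex.{u} _).ι ≫ w = v ∧
          w ≫ X.toJoin = (stdJoinIso χ).hom ≫ joinMap α β := by
  let i₀ := facetsBoundaryIso.{u} e₀ ≪≫ eqToIso (facetsToFib_arrow χ 0 _).symm
  let i₁ := facetsHornIso.{u} e₁ k ≪≫ eqToIso (facetsToFib_arrow χ 1 _).symm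
  have h : X.JoinLift (∂Δ[m] : SSet.Subcomplex.{u} _).ι
      (Λ[n + 1, k] : SSet.Subcomplex.{u} _).ι ↔ X.JoinLift
        (facetsToFib χ 0 (fibVertices χ 0))
        (facetsToFib χ 1 ((fibVertices χ 1).erase (e₁ k))) :=
    ⟨fun h ↦ (h.of_arrow_iso_left i₀).of_arrow_iso_right i₁,
      fun h ↦ (h.of_arrow_iso_left i₀.symm).of_arrow_iso_right i₁.symm⟩
  rw [h]
  refine joinLift_iff_exists_lift χ _ _ _ ?_
  rw [range_joinMap_facetsToFib_left χ subset_rfl,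
    range_joinMap_facetsToFib_right χ (Finset.erase_subset _ _), facets_univ_union,
    ← facets_univ_erase, ← fibVertices_union χ, Finset.erase_union_distrib,
    Finset.erase_eq_of_notMem (fun h ↦ notMem_fibVertices_one χ h (e₁ k).2)]
  · obtain ⟨k', hk'⟩ := exists_ne k
    exact ⟨e₁ k', Finset.mem_erase.2 ⟨fun h ↦ hk' (e₁.injective (Subtype.ext h)), (e₁ k').2⟩⟩
  · exact ⟨_, (e₀ 0).2⟩

end InnerHornsOfJoins

/-! ### Inner fibrations and Reedy fibrancy -/

section InnerFibrations

variable {A B : SSet.{u}} {X : Cyl A B} {N : ℕ}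

/-- Over a simplex of `A ⋆ B` contained in `A` or `B`, lifting problems for `X ⟶ A ⋆ B` are
trivial. -/
lemma Cyl.exists_lift_of_fib_eq_top (P : (Δ[N] : SSet.{u}).Subcomplex) (v : (P : SSet.{u}) ⟶ X.X)
    (s : JoinSimplex A B ⦋N⦌) (hv : v ≫ X.toJoin = P.ι ≫ SSet.yonedaEquiv.symm s)
    (hs : fib 0 s.χ = ⊤ ∨ fib 1 s.χ = ⊤) :
    ∃ w : Δ[N] ⟶ X.X, P.ι ≫ w = v ∧ w ≫ X.toJoin = SSet.yonedaEquiv.symm s := by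
  have key : ∀ {n : SimplexCategory} (s : JoinSimplex A B n), (fib 0 s.χ = ⊤ ∨ fib 1 s.χ = ⊤) →
      ∃! x : X.X.obj (op n), X.toJoin.app (op n) x = s := by
    rintro n s (h | h)
    · exact X.existsUnique_of_fib_zero s h
    · exact X.existsUnique_of_fib_one s h
  obtain ⟨x, hx, -⟩ := key s hs
  have hw : SSet.yonedaEquiv.symm x ≫ X.toJoin = SSet.yonedaEquiv.symm s := by
    rw [SSet.yonedaEquiv_symm_comp]
    exact congrArg _ hx
  refine ⟨SSet.yonedaEquiv.symm x, ?_, hw⟩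
  ext k y
  refine (key (n := k.unop) ((SSet.yonedaEquiv.symm s : Δ[N] ⟶ join A B).app k y.1) ?_).unique
    ?_ ?_
  · exact hs.imp (fib_comp_eq_top _) (fib_comp_eq_top _)
  · exact ConcreteCategory.congr_hom (congr_app hw k) y.1
  · exact ConcreteCategory.congr_hom (congr_app hv k) y

lemma fib_zero_eq_top_of_fibVertices_eq_empty (χ : (Δ[N] : SSet.{u}) ⟶ Δ[1])
    (h : fibVertices χ 1 = ∅) : fib 0 χ = ⊤ := by
  have := fibVertices_union χ
  rw [h, Finset.union_empty] at this
  rw [fib_eq_face, this, SSet.stdSimplex.face_univ]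

lemma fib_one_eq_top_of_fibVertices_eq_empty (χ : (Δ[N] : SSet.{u}) ⟶ Δ[1])
    (h : fibVertices χ 0 = ∅) : fib 1 χ = ⊤ := by
  have := fibVertices_union χ
  rw [h, Finset.empty_union] at this
  rw [fib_eq_face, this, SSet.stdSimplex.face_univ]

lemma zero_mem_fibVertices (χ : (Δ[N] : SSet.{u}) ⟶ Δ[1]) (h : (fibVertices χ 0).Nonempty) :
    0 ∈ fibVertices χ 0 := by
  obtain ⟨i, hi⟩ := h
  rw [mem_fibVertices_iff] at hi ⊢
  exact le_antisymm ((SSet.stdSimplex.monotone_apply (SSet.yonedaEquiv χ) (Fin.zero_le i)).trans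
    hi.le) (Fin.zero_le _)

lemma last_mem_fibVertices (χ : (Δ[N] : SSet.{u}) ⟶ Δ[1]) (h : (fibVertices χ 1).Nonempty) :
    Fin.last N ∈ fibVertices χ 1 := by
  obtain ⟨i, hi⟩ := h
  rw [mem_fibVertices_iff] at hi ⊢
  exact le_antisymm (Fin.le_last _)
    (hi.ge.trans (SSet.stdSimplex.monotone_apply (SSet.yonedaEquiv χ) (Fin.le_last i)))

/-- The fibre containing `k` has at least two vertices, as it also contains `0` (over `0`) or the
last vertex (over `1`), so that its horn at `k` is defined. -/
lemma Cyl.innerFibrations_toJoin (h₁ : X.VerticallyReedyLeftFibrant)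
    (h₂ : X.HorizontallyReedyRightFibrant) : SSet.innerFibrations X.toJoin := by
  rw [verticallyReedyLeftFibrant_iff] at h₁
  rw [horizontallyReedyRightFibrant_iff] at h₂
  suffices ∀ (n : ℕ) (k : Fin (n + 3)) (_ : 0 < k) (_ : k < Fin.last (n + 2))
      (v : (Λ[n + 2, k] : SSet.{u}) ⟶ X.X) (s : JoinSimplex A B ⦋n + 2⦌),
      v ≫ X.toJoin = (Λ[n + 2, k] : SSet.Subcomplex.{u} _).ι ≫ SSet.yonedaEquiv.symm s →
      ∃ w : Δ[n + 2] ⟶ X.X, (Λ[n + 2, k] : SSet.Subcomplex.{u} _).ι ≫ w = v ∧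
        w ≫ X.toJoin = SSet.yonedaEquiv.symm s by
    rintro _ _ _ @⟨n, k, hk₀, hk₁⟩
    refine ⟨fun {v t} sq ↦ ?_⟩
    obtain ⟨s, rfl⟩ := SSet.yonedaEquiv.symm.surjective t
    obtain ⟨w, hw, hw'⟩ := this n k hk₀ hk₁ v s sq.w
    exact ⟨⟨⟨w, hw, hw'⟩⟩⟩
  intro n k hk₀ hk₁ v s hv
  by_cases hs₀ : fibVertices s.χ 0 = ∅
  · exact exists_lift_of_fib_eq_top _ v s hv (.inr (fib_one_eq_top_of_fibVertices_eq_empty _ hs₀))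
  by_cases hs₁ : fibVertices s.χ 1 = ∅
  · exact exists_lift_of_fib_eq_top _ v s hv (.inl (fib_zero_eq_top_of_fibVertices_eq_empty _ hs₁))
  have h0 := zero_mem_fibVertices _ (Finset.nonempty_iff_ne_empty.2 hs₀)
  have hl := last_mem_fibVertices _ (Finset.nonempty_iff_ne_empty.2 hs₁)
  rw [yonedaEquiv_symm_joinSimplex] at hv ⊢
  have hk : k ∈ fibVertices s.χ 0 ∪ fibVertices s.χ 1 := by
    rw [fibVertices_union]
    exact Finset.mem_univ k
  obtain hk | hk := Finset.mem_union.1 hk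
  · obtain ⟨a, ha⟩ : ∃ a, (fibVertices s.χ 0).card = a + 2 := by
      have := Finset.one_lt_card.2 ⟨0, h0, k, hk, hk₀.ne⟩
      exact ⟨(fibVertices s.χ 0).card - 2, by lia⟩
    obtain ⟨b, hb⟩ : ∃ b, (fibVertices s.χ 1).card = b + 1 := by
      have := Finset.card_pos.2 ⟨_, hl⟩
      exact ⟨(fibVertices s.χ 1).card - 1, by lia⟩
    let e₀ := (fibVertices s.χ 0).orderIsoOfFin ha
    let e₁ := (fibVertices s.χ 1).orderIsoOfFin hb
    obtain ⟨k', hk'⟩ := e₀.surjective ⟨k, hk⟩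
    obtain rfl : (e₀ k').1 = k := congrArg Subtype.val hk'
    refine (joinLift_horn_boundary_iff s.χ e₀ e₁ k').1 (h₂ b a k' ?_) _ _ v hv
    refine (Fin.zero_le (e₀.symm ⟨0, h0⟩)).trans_lt ?_
    rw [OrderIso.symm_apply_lt]
    exact hk₀
  · obtain ⟨a, ha⟩ : ∃ a, (fibVertices s.χ 0).card = a + 1 := by
      have := Finset.card_pos.2 ⟨_, h0⟩
      exact ⟨(fibVertices s.χ 0).card - 1, by lia⟩
    obtain ⟨b, hb⟩ : ∃ b, (fibVertices s.χ 1).card = b + 2 := by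
      have := Finset.one_lt_card.2 ⟨_, hl, k, hk, hk₁.ne'⟩
      exact ⟨(fibVertices s.χ 1).card - 2, by lia⟩
    let e₀ := (fibVertices s.χ 0).orderIsoOfFin ha
    let e₁ := (fibVertices s.χ 1).orderIsoOfFin hb
    obtain ⟨k', hk'⟩ := e₁.surjective ⟨k, hk⟩
    obtain rfl : (e₁ k').1 = k := congrArg Subtype.val hk'
    refine (joinLift_boundary_horn_iff s.χ e₀ e₁ k').1 (h₁ a b k' ?_) _ _ v hv
    refine lt_of_lt_of_le ?_ (Fin.le_last (e₁.symm ⟨Fin.last _, hl⟩))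
    rw [OrderIso.lt_symm_apply]
    exact hk₁

/-- A map `Δ[N] ⟶ Δ[1]` with fibres of prescribed sizes. -/
lemma exists_card_fibVertices {a b : ℕ} (hN : N + 1 = a + b) :
    ∃ χ : (Δ[N] : SSet.{u}) ⟶ Δ[1], (fibVertices χ 0).card = a ∧ (fibVertices χ 1).card = b := by
  have hmono : Monotone fun i : Fin (N + 1) ↦ if i.1 < a then (0 : Fin 2) else 1 := by
    intro i j hij
    by_cases hj : j.1 < a
    · have hi : i.1 < a := lt_of_le_of_lt hij hj
      simp only [if_pos hi, if_pos hj, le_rfl]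
    · simp only [if_neg hj]
      exact Fin.le_last _
  let x : (Δ[1] : SSet.{u}) _⦋N⦌ := SSet.stdSimplex.objMk ⟨_, hmono⟩
  have hx : ∀ i, SSet.yonedaEquiv (SSet.yonedaEquiv.symm x) i = if i.1 < a then 0 else 1 := by
    intro i
    rw [Equiv.apply_symm_apply]
    rfl
  have h₀ : (fibVertices (SSet.yonedaEquiv.symm x) 0).card = a := by
    have : fibVertices (SSet.yonedaEquiv.symm x) 0 = Finset.univ.filter fun i ↦ i.1 < a := by
      ext i
      rw [mem_fibVertices_iff, hx]
      by_cases h : i.1 < a <;> simp [h]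
    rw [this, Fin.card_filter_val_lt]
    lia
  refine ⟨SSet.yonedaEquiv.symm x, h₀, ?_⟩
  have h := congrArg Finset.card (fibVertices_union (SSet.yonedaEquiv.symm x))
  rw [Finset.card_union_of_disjoint (Finset.disjoint_left.2 fun _ ↦ notMem_fibVertices_one _),
    Finset.card_univ, Fintype.card_fin] at h
  lia

lemma Cyl.exists_lift_of_innerFibrations (hX : SSet.innerFibrations X.toJoin) {n : ℕ}
    {k : Fin (n + 3)} (hk₀ : 0 < k) (hk₁ : k < Fin.last (n + 2))
    (v : (Λ[n + 2, k] : SSet.{u}) ⟶ X.X) (t : Δ[n + 2] ⟶ join A B)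
    (hv : v ≫ X.toJoin = (Λ[n + 2, k] : SSet.Subcomplex.{u} _).ι ≫ t) :
    ∃ w : Δ[n + 2] ⟶ X.X, (Λ[n + 2, k] : SSet.Subcomplex.{u} _).ι ≫ w = v ∧
      w ≫ X.toJoin = t := by
  have := hX _ (SSet.horn_ι_mem_innerHornInclusions hk₀ hk₁)
  obtain ⟨⟨l⟩⟩ := this.sq_hasLift ⟨hv⟩
  exact ⟨l.l, l.fac_left, l.fac_right⟩

lemma Cyl.verticallyReedyLeftFibrant_of_innerFibrations (hX : SSet.innerFibrations X.toJoin) :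
    X.VerticallyReedyLeftFibrant := by
  rw [verticallyReedyLeftFibrant_iff]
  intro m n k hk
  obtain ⟨χ, h₀, h₁⟩ := exists_card_fibVertices.{u} (N := m + n + 2) (a := m + 1) (b := n + 2)
    (by lia)
  let e₀ := (fibVertices χ 0).orderIsoOfFin h₀
  let e₁ := (fibVertices χ 1).orderIsoOfFin h₁
  refine (joinLift_boundary_horn_iff χ e₀ e₁ k).2 fun α β v hv ↦
    exists_lift_of_innerFibrations hX ?_ ?_ v _ hv
  · refine Fin.pos_iff_ne_zero.2 fun h ↦ notMem_fibVertices_one χ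
      (zero_mem_fibVertices χ ⟨_, (e₀ 0).2⟩) ?_
    rw [← h]
    exact (e₁ k).2
  · exact lt_of_lt_of_le (e₁.strictMono hk) (Fin.le_last (e₁ (Fin.last _)).1)

lemma Cyl.horizontallyReedyRightFibrant_of_innerFibrations (hX : SSet.innerFibrations X.toJoin) :
    X.HorizontallyReedyRightFibrant := by
  rw [horizontallyReedyRightFibrant_iff]
  intro n m k hk
  obtain ⟨χ, h₀, h₁⟩ := exists_card_fibVertices.{u} (N := m + n + 2) (a := m + 2) (b := n + 1)
    (by lia)
  let e₀ := (fibVertices χ 0).orderIsoOfFin h₀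
  let e₁ := (fibVertices χ 1).orderIsoOfFin h₁
  refine (joinLift_horn_boundary_iff χ e₀ e₁ k).2 fun α β v hv ↦
    exists_lift_of_innerFibrations hX ?_ ?_ v _ hv
  · exact lt_of_le_of_lt (Fin.zero_le (e₀ 0).1) (e₀.strictMono hk)
  · refine Fin.lt_last_iff_ne_last.2 fun h ↦ notMem_fibVertices_one χ (e₀ k).2 ?_
    rw [h]
    exact last_mem_fibVertices χ ⟨_, (e₁ 0).2⟩

end InnerFibrations

end SSetCyl

end

theorem proposition3p7 {A B : SSet.{u}} (X : SSetCyl.Cyl A B) :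
    List.TFAE [
      SSet.innerFibrations X.toJoin,
      X.VerticallyReedyLeftFibrant ∧ X.HorizontallyReedyRightFibrant,
      X.VerticallyReedyLeftFibrant ∧ X.VerticallyRightLocal] := by
  tfae_have 1 → 2 := fun h ↦
    ⟨SSetCyl.Cyl.verticallyReedyLeftFibrant_of_innerFibrations h,
      SSetCyl.Cyl.horizontallyReedyRightFibrant_of_innerFibrations h⟩
  tfae_have 2 → 1 := fun h ↦ SSetCyl.Cyl.innerFibrations_toJoin h.1 h.2
  tfae_have 2 ↔ 3 := and_congr_right fun h ↦
    h.horizontallyReedyRightFibrant_iff_verticallyRightLocal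
  tfae_finish
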